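/- Let $\Sigma\subset\mathbb R^2$ be the closed unit disc or a closed annulus $\{a\le |w|\le 1\}$ with $0<a<1$, and let $X=(x,y,z):\Sigma\to\mathbb R^3$ be an immersion of class $C^4$ up to the boundary which is axially symmetric about the $z$-axis: for some integer $k$, rotating $w$ by an angle $\theta$ rotates $X(w)$ by $k\theta$ about the $z$-axis. Let $\nu=(\nu_1,\nu_2,\nu_3)=X_u\times X_v/|X_u\times X_v|$, let the mean curvature $H$ be normalized by $\Delta X=2H\nu$, let $c_o\in\mathbb R$, and assume $H\neq -c_o$ everywhere on $\Sigma$. Put $$\mathcal H[\Sigma]=\int_\Sigma (H+c_o)^2\,d\Sigma,\qquad \mathcal G[\Sigma]=\int_\Sigma\frac{1}{z^2}\,d\Sigma+2c_o\int_\Sigma\frac{\nu_3}{z}\,d\Sigma .$$ "Critical for $\mathcal H$" means: the first variation vanishes for all $C^4$ variation fields with compact support in the interior of $\Sigma$. "Critical for $\mathcal G$" (considered when $z\ne0$ on $\Sigma$) means: the first variation vanishes for all $C^4$ variation fields that vanish on $\partial\Sigma$. Say that $X$ has zero flux if $\Sigma$ is a disc, or if $\Sigma$ is an annulus and $$\oint_{C}\big((H+c_o)\,\partial_n\nu_3-\nu_3\,\partial_nH+(H+c_o)^2\,\partial_nz\big)\,ds=0$$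 for some parallel $C=\{|w|=\rho\}$, $a\le\rho\le1$, with unit conormal $n$. Then: 1. $X$ is critical for $\mathcal H$ and has zero flux if and only if there is a unique $A\in\mathbb R$ such that $(H+c_o)(z-A)=-\nu_3$ on $\Sigma$; that is, after a unique vertical translation, $(H+c_o)z=-\nu_3$ on $\Sigma$. 2. Assume that $z\neq0$ on $\Sigma$. Then $X$ is critical for $\mathcal G$ if and only if $$H+c_o=-\frac{\nu_3}{z}\quad\text{on }\Sigma,$$ and in this case $X$ is critical for $\mathcal H$. Suppose moreover that $X$ has zero flux and that its vertical position is normalized so that $H+c_o=-\nu_3/z$ holds at one point of $\Sigma$. Then $X$ is critical for $\mathcal H$ if and only if it is critical for $\mathcal G$; and if it is critical for $\mathcal H$, then $H+c_o=-\nu_3/z$ holds on all of $\Sigma$. 3. If $z>0$ on $\Sigma$, then $\mathcal G[\Sigma]=\widetilde{\mathcal A}-2c_o\int z\,d\widetilde V$, where $\widetilde{\mathcal A}$ is the area of $X$ in the hyperbolic metric $(dx^2+dy^2+dz^2)/z^2$ of the upper half-space, and the integral is taken with respect to the hyperbolic volume $d\widetilde V=dx\,dy\,dz/z^3$ over the region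 swept out by the upward vertical rays from $\Sigma$, counted with sign (positively where $\nu$ points out of the region). -/

import Mathlib

open scoped Matrix

namespace AxialHelfrich

noncomputable section

/-! Surfaces are maps `X : ℂ → Fin 3 → ℝ` restricted to a compact domain of the oriented plane
`ℂ = ℝ²`, with coordinates `u = Re w`, `v = Im w`.  All metric quantities of `ℝ³` are expressed by
the dot product `⬝ᵥ` and the cross product `⨯₃`, i.e. they are the Euclidean ones. -/

/-- The parameter domain: the closed unit disc if `a = 0`, a closed annulus if `0 < a < 1`. -/
def dom (a : ℝ) : Set ℂ := {w | a ≤ ‖w‖ ∧ ‖w‖ ≤ 1}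

/-- Rotation of `ℝ³` about the `z`-axis by the angle `φ`. -/
def rotZ (φ : ℝ) (p : Fin 3 → ℝ) : Fin 3 → ℝ :=
  ![Real.cos φ * p 0 - Real.sin φ * p 1, Real.sin φ * p 0 + Real.cos φ * p 1, p 2]

/-- `X` restricted to `dom a` is an immersion, of class `C⁴` up to the boundary (it is the
restriction of a map that is `C⁴` near the domain), and it is a surface of revolution about the
`z`-axis: rotations of the domain correspond to rotations of space.  The integer `k` is `±1` on a
disc (according to the orientation); on an annulus other values describe multiple covers. -/
structure IsAxiallySymmetricImmersion (a : ℝ) (X : ℂ → Fin 3 → ℝ) : Prop where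
  contDiffAt : ∀ w ∈ dom a, ContDiffAt ℝ 4 X w
  immersion : ∀ w ∈ dom a, Function.Injective (fderiv ℝ X w)
  symm : ∃ k : ℤ, ∀ θ : ℝ, ∀ w ∈ dom a,
    X (Complex.exp (θ * Complex.I) * w) = rotZ (k * θ) (X w)

variable (X : ℂ → Fin 3 → ℝ) (w : ℂ)

/-- `∂X/∂u`. -/
def Xu : Fin 3 → ℝ := fderiv ℝ X w 1

/-- `∂X/∂v`. -/
def Xv : Fin 3 → ℝ := fderiv ℝ X w Complex.I

/-- The area density `|X_u × X_v|`, so that `dΣ = areaDensity du dv`. -/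
def areaDensity : ℝ := √((Xu X w ⨯₃ Xv X w) ⬝ᵥ (Xu X w ⨯₃ Xv X w))

/-- The unit normal `ν = X_u × X_v / |X_u × X_v|`. -/
def unitNormal : Fin 3 → ℝ := (areaDensity X w)⁻¹ • (Xu X w ⨯₃ Xv X w)

/-- The mean curvature `H = (G L - 2 F M + E N) / (2 (E G - F²))`, where `E, F, G` and `L, M, N`
are the coefficients of the first form and of the second form (`L = X_uu ⬝ ν`, …).  The sign is
the one for which `ΔX = 2 H ν`; a sphere of radius `R` with outward normal has `H = -1/R`. -/
def meanCurvature : ℝ :=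
  let E := Xu X w ⬝ᵥ Xu X w
  let F := Xu X w ⬝ᵥ Xv X w
  let G := Xv X w ⬝ᵥ Xv X w
  let L := Xu (Xu X) w ⬝ᵥ unitNormal X w
  let M := Xv (Xu X) w ⬝ᵥ unitNormal X w
  let N := Xv (Xv X) w ⬝ᵥ unitNormal X w
  (G * L - 2 * F * M + E * N) / (2 * (E * G - F ^ 2))

/-- The Helfrich energy `∫_Σ (H + c₀)² dΣ`. -/
def helfrich (a c₀ : ℝ) : ℝ :=
  ∫ w in dom a, (meanCurvature X w + c₀) ^ 2 * areaDensity X w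

/-- The functional `𝒢[Σ] = ∫_Σ z⁻² dΣ + 2 c₀ ∫_Σ (ν₃ / z) dΣ`. -/
def energyG (a c₀ : ℝ) : ℝ :=
  (∫ w in dom a, 1 / (X w 2) ^ 2 * areaDensity X w)
    + 2 * c₀ * ∫ w in dom a, unitNormal X w 2 / X w 2 * areaDensity X w

/-- Criticality for the Helfrich energy, for variations with compact support in the interior. -/
def HelfrichCritical (a c₀ : ℝ) : Prop :=
  ∀ V : ℂ → Fin 3 → ℝ, ContDiff ℝ 4 V → tsupport V ⊆ interior (dom a) →
    HasDerivAt (fun ε : ℝ => helfrich (fun w => X w + ε • V w) a c₀) 0 0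

/-- Criticality for `𝒢`, for variations vanishing on the boundary. -/
def GCritical (a c₀ : ℝ) : Prop :=
  ∀ V : ℂ → Fin 3 → ℝ, ContDiff ℝ 4 V → (∀ w ∈ frontier (dom a), V w = 0) →
    HasDerivAt (fun ε : ℝ => energyG (fun w => X w + ε • V w) a c₀) 0 0

/-- The vector `n` of the parameter plane at `w ≠ 0` whose image under `dX` is the unit conormal,
pointing in the direction of increasing `|w|`, of the parallel `{|w| = const}`. -/
def conormal : ℂ :=
  let T := fderiv ℝ X w (Complex.I * w)
  let d : ℂ := w - ((fderiv ℝ X w w ⬝ᵥ T) / (T ⬝ᵥ T)) • (Complex.I * w)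
  (√(fderiv ℝ X w d ⬝ᵥ fderiv ℝ X w d))⁻¹ • d

/-- The flux through the parallel `{|w| = ρ}` that belongs to vertical translations,
`∮ ((H + c₀) ∂ₙν₃ - ν₃ ∂ₙH + (H + c₀)² ∂ₙz) ds`.  On a surface of revolution the integrand is
constant along the parallel. -/
def verticalFlux (c₀ ρ : ℝ) : ℝ :=
  ∫ θ in (0 : ℝ)..(2 * Real.pi),
    let w : ℂ := ρ * Complex.exp (θ * Complex.I)
    let n := conormal X w
    ((meanCurvature X w + c₀) * fderiv ℝ (fun w => unitNormal X w 2) w n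
        - unitNormal X w 2 * fderiv ℝ (meanCurvature X) w n
        + (meanCurvature X w + c₀) ^ 2 * fderiv ℝ (fun w => X w 2) w n)
      * √(fderiv ℝ X w (Complex.I * w) ⬝ᵥ fderiv ℝ X w (Complex.I * w))

/-- The area of the surface for the metric `(dx² + dy² + dz²) / z²` of hyperbolic space. -/
def hyperbolicArea (a : ℝ) : ℝ :=
  ∫ w in dom a,
    √((Xu X w ⬝ᵥ Xu X w / (X w 2) ^ 2) * (Xv X w ⬝ᵥ Xv X w / (X w 2) ^ 2)
      - (Xu X w ⬝ᵥ Xv X w / (X w 2) ^ 2) ^ 2)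

/-- For a surface in the upper half-space: the integral of `z` with respect to the hyperbolic
volume `dx dy dz / z³` over the region swept out by the vertical rays `X w + t e₃`, `t > 0`.  The
Jacobian determinant of `(u, v, t) ↦ X w + t e₃` is `(X_u × X_v) ⬝ᵥ e₃`; the minus sign makes the
volume positive where `ν` points out of the region. -/
def weightedHyperbolicVolume (a : ℝ) : ℝ :=
  ∫ w in dom a, ∫ t in Set.Ioi (0 : ℝ),
    (X w 2 + t) * (1 / (X w 2 + t) ^ 3) * (-((Xu X w ⨯₃ Xv X w) ⬝ᵥ ![0, 0, 1]))

end

end AxialHelfrich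

open scoped Matrix
open MeasureTheory Set Filter Topology

namespace AxialHelfrich

/-! ### Calculus and integration in the plane -/

/-! All energies are integrals over the parameter domain of smooth functions of the 2-jet of `X`.
The jet of `X + εV` is affine in `ε` (`jet_add_smul`), so a first variation is obtained by
differentiating under the integral, and Euler–Lagrange fields arise from integration by parts with
vanishing boundary terms. Write `W` for the area density and `ζ = z - A`.

For `𝒢`, the identity `ΔX = 2Hν` (`Reg.laplace_identity`) and the formula for the tangential
gradient of `z` show that the Euler–Lagrange field is the normal field `-(2W/ζ²)(H + c₀ + ν₃/ζ) ν`
(`Reg.div_flux`). The fundamental lemma then makes criticality equivalent to the reduced equation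
(`gCritical_iff`).

That the reduced equation implies criticality for the Helfrich energy rests on completing a square
(`lagrangianH_eq`): `(H + c₀)² = (H + c₀ + ν₃/ζ)² - (1/ζ² + 2c₀ν₃/ζ) - div(∇z/ζ)`. On a solution the
square vanishes to second order, the divergence is a null Lagrangian, and the middle term is the
integrand of `𝒢`, whose variation vanishes. This works only where `ζ ≠ 0`. The Helfrich variation is
however represented by a continuous field (`exists_eulerH`), and the set `ζ ≠ 0` is dense: an open
piece of the surface in the plane `z = A` would have `ν₃ = ±1`, while the reduced equation gives `ν₃
= 0` there. Hence `helfrichCritical_of_reduced`.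

The converse is the conservation law that belongs to vertical translations. For a surface of
revolution and a vertical field `φ(|w|) e₃` the energy becomes a one-dimensional integral that sees
only `φ'` and `φ''`, since translations do not change it. The lemma of du Bois-Reymond shows that
the momentum conjugate to the height is constant (`HelfrichCritical.exists_momentum_eq`). This
momentum is a positive factor times the flux density `(H + c₀)ν₃' - ν₃H' + (H + c₀)²z'`. It vanishes
by the zero flux hypothesis on an annulus; on a disc it vanishes because `φ` may be a nonzero
constant near the centre. Finally the flux density is `(H + c₀)²` times the derivative of `z + ν₃/(H
+ c₀)` (`Reg.hasDerivAt_potential`), so this function equals a constant `A`, which is the reduced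
equation. The constant is unique because `H + c₀ ≠ 0`.

The hyperbolic interpretation of `𝒢` comes from `∫₀^∞ (z + t)⁻² dt = 1/z`. -/

theorem continuousOn_add_smul {E : Type*} [NormedAddCommGroup E] [NormedSpace ℝ E]
    {K : Set ℂ} {J j : ℂ → E} (hJ : ContinuousOn J K) (hj : ContinuousOn j K) :
    ContinuousOn (fun q : ℝ × ℂ => J q.2 + q.1 • j q.2) (univ ×ˢ K) :=
  (hJ.comp continuousOn_snd fun _ hq => hq.2).add
    (continuousOn_fst.smul (hj.comp continuousOn_snd fun _ hq => hq.2))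

/-- Compactness of `K` turns the pointwise openness condition into one that is uniform in `w`. -/
theorem eventually_forall_add_smul_mem {E : Type*} [NormedAddCommGroup E] [NormedSpace ℝ E]
    {K : Set ℂ} (hK : IsCompact K) {S : Set E} (hS : IsOpen S) {J j : ℂ → E}
    (hJ : ContinuousOn J K) (hj : ContinuousOn j K) (hJS : MapsTo J K S) :
    ∀ᶠ ε : ℝ in 𝓝 0, ∀ w ∈ K, J w + ε • j w ∈ S := by
  have hev : ∀ᶠ ε : ℝ in 𝓝 0, ∀ w ∈ K, w ∈ K → J w + ε • j w ∈ S := by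
    refine hK.eventually_forall_of_forall_eventually
      (P := fun ε w => w ∈ K → J w + ε • j w ∈ S) fun w hw => ?_
    have h1 := continuousOn_add_smul hJ hj (0, w) ⟨mem_univ _, hw⟩
    have h2 : ∀ᶠ q in 𝓝[univ ×ˢ K] ((0 : ℝ), w), J q.2 + q.1 • j q.2 ∈ S :=
      h1.eventually (hS.mem_nhds (by simpa using hJS hw))
    filter_upwards [eventually_nhdsWithin_iff.1 h2] with q hq hqK
    exact hq ⟨mem_univ _, hqK⟩
  filter_upwards [hev] with ε hε w hw using hε w hw hw

/-- On a compact `ε`-interval times `K` the derivative of the integrand is continuous, hence bounded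
by a constant, which is integrable on `K`. Every first variation below is computed with this lemma,
for `J` and `j` the jets of the surface and of the variation. -/
theorem hasDerivAt_setIntegral_comp_add_smul {E : Type*} [NormedAddCommGroup E] [NormedSpace ℝ E]
    {K : Set ℂ} (hK : IsCompact K) {F : E → ℝ} {S : Set E} (hS : IsOpen S)
    (hF : ContDiffOn ℝ 1 F S) {J j : ℂ → E} (hJ : ContinuousOn J K) (hj : ContinuousOn j K)
    (hJS : MapsTo J K S) :
    HasDerivAt (fun ε : ℝ => ∫ w in K, F (J w + ε • j w))
      (∫ w in K, fderiv ℝ F (J w) (j w)) 0 := by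
  have hcont := continuousOn_add_smul hJ hj
  have hev := eventually_forall_add_smul_mem hK hS hJ hj hJS
  obtain ⟨δ, hδ, hδS⟩ := Metric.eventually_nhds_iff_ball.1 hev
  have hI : Icc (-(δ / 2)) (δ / 2) ⊆ Metric.ball (0 : ℝ) δ := by
    intro x hx
    rw [Metric.mem_ball, dist_zero_right, Real.norm_eq_abs, abs_lt]
    constructor <;> linarith [hx.1, hx.2]
  have hmaps : MapsTo (fun q : ℝ × ℂ => J q.2 + q.1 • j q.2) (Icc (-(δ / 2)) (δ / 2) ×ˢ K) S :=
    fun q hq => hδS q.1 (hI hq.1) q.2 hq.2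
  have hcont' := hcont.mono (prod_mono_left (t := K) (subset_univ (Icc (-(δ / 2)) (δ / 2))))
  have hdF : ContinuousOn (fderiv ℝ F) S := hF.continuousOn_fderiv_of_isOpen hS le_rfl
  have hg : ContinuousOn (fun q : ℝ × ℂ => fderiv ℝ F (J q.2 + q.1 • j q.2) (j q.2))
      (Icc (-(δ / 2)) (δ / 2) ×ˢ K) :=
    (hdF.comp hcont' hmaps).clm_apply (hj.comp continuousOn_snd fun q hq => hq.2)
  obtain ⟨C, hC⟩ := (isCompact_Icc.prod hK).exists_bound_of_continuousOn hg
  have hslice : ∀ ε ∈ Icc (-(δ / 2)) (δ / 2),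
      ContinuousOn (fun w => F (J w + ε • j w)) K := fun ε hε =>
    hF.continuousOn.comp (hJ.add (hj.const_smul ε)) fun w hw => hδS ε (hI hε) w hw
  have h0 : (0 : ℝ) ∈ Icc (-(δ / 2)) (δ / 2) := ⟨by linarith, by linarith⟩
  have hnhds : Icc (-(δ / 2)) (δ / 2) ∈ 𝓝 (0 : ℝ) := Icc_mem_nhds (by linarith) (by linarith)
  have key := hasDerivAt_integral_of_dominated_loc_of_deriv_le (μ := volume.restrict K)
    (F := fun (ε : ℝ) w => F (J w + ε • j w)) (x₀ := (0 : ℝ)) (bound := fun _ => C)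
    (F' := fun ε w => fderiv ℝ F (J w + ε • j w) (j w)) hnhds
    (by
      filter_upwards [hnhds] with ε hε
      exact (hslice ε hε).aestronglyMeasurable hK.measurableSet)
    ((hslice 0 h0).integrableOn_compact hK)
    ((hg.comp (f := fun w => ((0 : ℝ), w)) (by fun_prop)
      (fun w hw => ⟨h0, hw⟩)).aestronglyMeasurable hK.measurableSet)
    (by
      filter_upwards [ae_restrict_mem hK.measurableSet] with w hw ε hε
      exact hC (ε, w) ⟨hε, hw⟩)
    (integrableOn_const hK.measure_lt_top.ne)
    (by
      filter_upwards [ae_restrict_mem hK.measurableSet] with w hw ε hε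
      have hmem : J w + ε • j w ∈ S := hδS ε (hI hε) w hw
      have hd : HasFDerivAt F (fderiv ℝ F (J w + ε • j w)) (J w + ε • j w) :=
        ((hF.contDiffAt (hS.mem_nhds hmem)).differentiableAt one_ne_zero).hasFDerivAt
      have hl : HasDerivAt (fun ε : ℝ => J w + ε • j w) (j w) ε := by
        simpa using ((hasDerivAt_id ε).smul_const (j w)).const_add (J w)
      exact hd.comp_hasDerivAt ε hl)
  simpa using key.2

theorem fderiv_apply_one_eq_deriv {F : Type*} [NormedAddCommGroup F] [NormedSpace ℝ F] {f : ℂ → F}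
    {x : ℝ} (hf : DifferentiableAt ℝ f x) :
    HasDerivAt (fun t : ℝ => f t) (fderiv ℝ f x 1) x :=
  hf.hasFDerivAt.comp_hasDerivAt x (Complex.ofRealCLM.hasDerivAt (x := x))

/-- A line meets a circle in at most two points. The fundamental theorem of calculus used on
horizontal lines tolerates a countable set of bad points. -/
theorem countable_line_inter_sphere (y : ℝ) (c : ℂ) (r : ℝ) :
    {x : ℝ | (⟨x, y⟩ : ℂ) ∈ Metric.sphere c r}.Countable := by
  refine Set.Finite.countable ?_
  refine Set.Finite.subset (s := {c.re + √(r ^ 2 - (y - c.im) ^ 2),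
    c.re - √(r ^ 2 - (y - c.im) ^ 2)})
    (by simp) ?_
  intro x hx
  have h1 : ‖(⟨x, y⟩ : ℂ) - c‖ = r := by simpa [dist_eq_norm] using hx
  have h2 : (x - c.re) ^ 2 + (y - c.im) ^ 2 = r ^ 2 := by
    rw [← h1, ← Complex.normSq_eq_norm_sq, Complex.normSq_apply]
    simp; ring
  have h3 : √(r ^ 2 - (y - c.im) ^ 2) = |x - c.re| := by
    rw [← Real.sqrt_sq_eq_abs]; congr 1; linarith
  rw [h3]
  rcases abs_cases (x - c.re) with ⟨h, -⟩ | ⟨h, -⟩ <;> simp [h]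

/-- A continuous function of bounded support that is differentiable off a set which meets the
horizontal lines in countable sets has `∫ ∂f/∂u = 0`. -/
theorem integral_fderiv_one_eq_zero {f : ℂ → ℝ} {s : Set ℂ} {r : ℝ} (hf : Continuous f)
    (hsupp : ∀ w : ℂ, r ≤ |w.re| → f w = 0)
    (hs : ∀ y : ℝ, {x : ℝ | (⟨x, y⟩ : ℂ) ∈ s}.Countable)
    (hd : ∀ w ∉ s, DifferentiableAt ℝ f w) (hi : Integrable (fun w => fderiv ℝ f w 1)) :
    ∫ w, fderiv ℝ f w 1 = 0 := by
  have hmp := Complex.volume_preserving_equiv_real_prod.symm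
  have hi' := (hmp.integrable_comp_emb (MeasurableEquiv.measurableEmbedding _)).2 hi
  rw [← hmp.integral_comp (MeasurableEquiv.measurableEmbedding _), Measure.volume_eq_prod,
    integral_prod_symm (fun q => fderiv ℝ f (Complex.measurableEquivRealProd.symm q) 1) hi']
  have hslices := (integrable_prod_iff' hi'.aestronglyMeasurable).1 hi'
  refine integral_eq_zero_of_ae ?_
  filter_upwards [hslices.1] with y hy
  have hval : ∀ x : ℝ, Complex.measurableEquivRealProd.symm (x, y) = (⟨x, y⟩ : ℂ) := fun x => rfl
  simp only [hval, Function.comp_apply] at hy ⊢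
  have hline : ∀ x : ℝ, HasDerivAt (fun x : ℝ => (⟨x, y⟩ : ℂ)) 1 x := by
    intro x
    have h := (Complex.ofRealCLM.hasDerivAt (x := x)).add_const (y * Complex.I)
    refine (h.congr_deriv (by simp)).congr_of_eventuallyEq (.of_forall fun t => ?_)
    apply Complex.ext <;> simp
  have hlc : Continuous (fun x : ℝ => (⟨x, y⟩ : ℂ)) :=
    continuous_iff_continuousAt.2 fun x => (hline x).continuousAt
  have hle : -(|r| + 1) ≤ |r| + 1 := by linarith [abs_nonneg r]
  have hzero : ∀ x : ℝ, x ∉ Ioc (-(|r| + 1)) (|r| + 1) → fderiv ℝ f ⟨x, y⟩ 1 = 0 := by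
    intro x hx
    have hx' : r < |x| := by
      by_contra hcon
      push Not at hcon
      have := abs_le.1 (hcon.trans (le_abs_self r))
      exact hx ⟨by linarith, by linarith⟩
    have : f =ᶠ[𝓝 (⟨x, y⟩ : ℂ)] fun _ => 0 := by
      have hopen : IsOpen {w : ℂ | r < |w.re|} :=
        isOpen_lt continuous_const (Complex.continuous_re.abs)
      filter_upwards [hopen.mem_nhds hx'] with w hw
      exact hsupp w (le_of_lt hw)
    rw [this.fderiv_eq]; simp
  -- On each slice this is the fundamental theorem of calculus with a countable exceptional set; `f`
  -- vanishes at both endpoints.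
  rw [← setIntegral_eq_integral_of_forall_compl_eq_zero (s := Ioc (-(|r| + 1)) (|r| + 1))
    (fun x hx => hzero x hx), ← intervalIntegral.integral_of_le hle,
    integral_eq_of_hasDerivAt_off_countable (fun x => f ⟨x, y⟩) _ (hs y)
      (hf.comp hlc).continuousOn]
  · have hr : r ≤ |r| + 1 := (le_abs_self r).trans (by linarith)
    have h1 : |(|r| + 1)| = |r| + 1 := abs_of_nonneg (by positivity)
    rw [hsupp ⟨|r| + 1, y⟩ (by simpa [h1] using hr),
      hsupp ⟨-(|r| + 1), y⟩ (by simpa only [abs_neg, h1] using hr)]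
    simp
  · intro x hx
    exact (hd _ hx.2).hasFDerivAt.comp_hasDerivAt x (hline x)
  · exact (intervalIntegrable_iff_integrableOn_Ioc_of_le hle).2 hy.integrableOn

/-- This replaces the divergence theorem. The extension of `g` by zero is continuous because `g`
vanishes on the frontier, and it is differentiable off the frontier, which lies on circles and is
therefore null. Two circles are allowed in order to cover annuli; for a ball they coincide. -/
theorem setIntegral_fderiv_one_eq_zero {D : Set ℂ} (hD : IsCompact D) {c₁ c₂ : ℂ} {r₁ r₂ : ℝ}
    (hfr : frontier D ⊆ Metric.sphere c₁ r₁ ∪ Metric.sphere c₂ r₂) {g : ℂ → ℝ}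
    (hg : ∀ w ∈ D, ContDiffAt ℝ 1 g w) (h0 : ∀ w ∈ frontier D, g w = 0) :
    ∫ w in D, fderiv ℝ g w 1 = 0 := by
  set f := D.indicator g with hfdef
  have hgc : ContinuousOn g D := fun w hw => (hg w hw).continuousAt.continuousWithinAt
  have hf : Continuous f := continuous_indicator h0 (by rwa [hD.isClosed.closure_eq])
  have hin : ∀ w ∈ interior D, f =ᶠ[𝓝 w] g := fun w hw => by
    filter_upwards [isOpen_interior.mem_nhds hw] with v hv
    exact indicator_of_mem (interior_subset hv) _
  have hout : ∀ w ∉ D, f =ᶠ[𝓝 w] fun _ => 0 := fun w hw => by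
    filter_upwards [hD.isClosed.isOpen_compl.mem_nhds hw] with v hv
    exact indicator_of_notMem hv _
  have hgD : ContinuousOn (fun w => fderiv ℝ g w 1) D := fun w hw =>
    (((hg w hw).fderiv_right (m := 0) (by norm_num)).continuousAt.clm_apply
      continuousAt_const).continuousWithinAt
  have hnull : volume (frontier D) = 0 := by
    refine measure_mono_null hfr ?_
    rw [measure_union_null_iff]
    exact ⟨Measure.addHaar_sphere _ _ _, Measure.addHaar_sphere _ _ _⟩
  have hae : (fun w => fderiv ℝ f w 1) =ᵐ[volume] D.indicator (fun w => fderiv ℝ g w 1) := by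
    filter_upwards [compl_mem_ae_iff.2 hnull] with w hw
    by_cases hwD : w ∈ D
    · have hwi : w ∈ interior D := by
        by_contra hcon
        exact hw (by rw [hD.isClosed.frontier_eq]; exact ⟨hwD, hcon⟩)
      rw [indicator_of_mem hwD, (hin w hwi).fderiv_eq]
    · rw [indicator_of_notMem hwD, (hout w hwD).fderiv_eq]; simp
  rw [← integral_indicator hD.measurableSet, ← integral_congr_ae hae]
  obtain ⟨r, hr⟩ := hD.isBounded.exists_norm_le
  refine integral_fderiv_one_eq_zero (s := frontier D) (r := r + 1) hf ?_ ?_ ?_ ?_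
  · intro w hw
    refine indicator_of_notMem (fun hwD => ?_) _
    linarith [hr w hwD, Complex.abs_re_le_norm w]
  · intro y
    refine ((countable_line_inter_sphere y c₁ r₁).union
      (countable_line_inter_sphere y c₂ r₂)).mono ?_
    intro x hx
    exact hfr hx
  · intro w hw
    by_cases hwD : w ∈ D
    · have hwi : w ∈ interior D := by
        by_contra hcon
        exact hw (by rw [hD.isClosed.frontier_eq]; exact ⟨hwD, hcon⟩)
      exact (hin w hwi).differentiableAt_iff.2 ((hg w hwD).differentiableAt one_ne_zero)
    · exact (hout w hwD).differentiableAt_iff.2 (differentiableAt_const _)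
  · refine Integrable.congr ?_ hae.symm
    rw [integrable_indicator_iff hD.measurableSet]
    exact hgD.integrableOn_compact hD

/-- Multiplication by `i` as an isometry of the plane. -/
noncomputable def mulI : ℂ ≃ₗᵢ[ℝ] ℂ := rotation ⟨Complex.I, by simp [Submonoid.unitSphere]⟩

theorem mulI_apply (w : ℂ) : mulI w = Complex.I * w := rfl

/-- A quarter turn of the plane preserves measure, maps circles to circles and turns the direction
`1` into `i`. -/
theorem setIntegral_fderiv_I_eq_zero {D : Set ℂ} (hD : IsCompact D) {c₁ c₂ : ℂ} {r₁ r₂ : ℝ}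
    (hfr : frontier D ⊆ Metric.sphere c₁ r₁ ∪ Metric.sphere c₂ r₂) {g : ℂ → ℝ}
    (hg : ∀ w ∈ D, ContDiffAt ℝ 1 g w) (h0 : ∀ w ∈ frontier D, g w = 0) :
    ∫ w in D, fderiv ℝ g w Complex.I = 0 := by
  have hmp : MeasurePreserving mulI := mulI.measurePreserving
  rw [← hmp.setIntegral_preimage_emb mulI.toHomeomorph.measurableEmbedding]
  have hfr' : frontier (mulI ⁻¹' D) = mulI ⁻¹' frontier D :=
    (mulI.toHomeomorph.preimage_frontier D).symm
  have hsub : frontier (mulI ⁻¹' D) ⊆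
      Metric.sphere (mulI.symm c₁) r₁ ∪ Metric.sphere (mulI.symm c₂) r₂ := by
    rw [hfr']
    intro w hw
    have := hfr hw
    simp only [mem_union, Metric.mem_sphere] at this ⊢
    rw [← mulI.dist_map, mulI.apply_symm_apply, ← mulI.dist_map w, mulI.apply_symm_apply]
    exact this
  have hD' : IsCompact (mulI ⁻¹' D) := mulI.toHomeomorph.isCompact_preimage.2 hD
  rw [← setIntegral_fderiv_one_eq_zero hD' hsub (g := fun w => g (mulI w))
    (fun w hw => (hg _ hw).comp w (mulI.contDiff.contDiffAt))
    (fun w hw => h0 _ (by rwa [hfr'] at hw))]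
  refine setIntegral_congr_fun hD'.measurableSet fun w hw => ?_
  have h1 : HasFDerivAt (fun w => g (mulI w)) _ w :=
    ((hg (mulI w) hw).differentiableAt one_ne_zero).hasFDerivAt.comp w
      (mulI.toContinuousLinearEquiv.hasFDerivAt)
  simp only [h1.fderiv, ContinuousLinearMap.comp_apply]
  congr 1
  change _ = mulI 1
  simp [mulI_apply]

/-- The fundamental lemma of the calculus of variations, for vector fields continuous on an open
set. -/
theorem eq_zero_of_forall_setIntegral_dotProduct_eq_zero {O D : Set ℂ} (hO : IsOpen O)
    (hOD : O ⊆ D) (hD : MeasurableSet D) {G : ℂ → Fin 3 → ℝ} (hG : ContinuousOn G O)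
    (h : ∀ V : ℂ → Fin 3 → ℝ, ContDiff ℝ (⊤ : ℕ∞) V → HasCompactSupport V → tsupport V ⊆ O →
      ∫ w in D, G w ⬝ᵥ V w = 0) : ∀ w ∈ O, G w = 0 := by
  have hi : ∀ i, ∀ᵐ w : ℂ, w ∈ O → G w i = 0 := by
    intro i
    refine hO.ae_eq_zero_of_integral_contDiff_smul_eq_zero ?_ ?_
    · exact ((continuous_apply i).comp_continuousOn hG).locallyIntegrableOn hO.measurableSet
    · intro g hg hgc hgs
      have hts : tsupport (fun w => g w • (Pi.single i 1 : Fin 3 → ℝ)) ⊆ tsupport g :=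
        closure_mono (fun w hw => by
          rw [Function.mem_support] at hw ⊢
          intro h0; exact hw (by rw [h0, zero_smul]))
      have := h (fun w => g w • (Pi.single i 1 : Fin 3 → ℝ)) (hg.smul contDiff_const)
        (hgc.smul_right) (hts.trans hgs)
      rw [← this, ← setIntegral_eq_integral_of_forall_compl_eq_zero (s := D)]
      · refine setIntegral_congr_fun hD fun w _ => ?_
        simp [mul_comm]
      · intro w hw
        have : g w = 0 := image_eq_zero_of_notMem_tsupport fun hmem => hw (hOD (hgs hmem))
        simp [this]
  intro w hw
  ext i
  have hcont : ContinuousOn (fun w => G w i) O := (continuous_apply i).comp_continuousOn hG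
  have := Measure.eqOn_open_of_ae_eq (μ := (volume : Measure ℂ)) (f := fun w => G w i)
    (g := fun _ => (0 : ℝ))
    ((ae_restrict_iff' hO.measurableSet).2 (hi i)) hO hcont continuousOn_const
  exact this hw


/-! ### Vector algebra -/

theorem dot3 (v w : Fin 3 → ℝ) : v ⬝ᵥ w = v 0 * w 0 + v 1 * w 1 + v 2 * w 2 := by
  simp [dotProduct, Fin.sum_univ_three]

theorem cross_zero (v w : Fin 3 → ℝ) : (v ⨯₃ w) 0 = v 1 * w 2 - v 2 * w 1 := by simp [cross_apply]

theorem cross_one (v w : Fin 3 → ℝ) : (v ⨯₃ w) 1 = v 2 * w 0 - v 0 * w 2 := by simp [cross_apply]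

theorem cross_two (v w : Fin 3 → ℝ) : (v ⨯₃ w) 2 = v 0 * w 1 - v 1 * w 0 := by simp [cross_apply]

theorem ext3 {v w : Fin 3 → ℝ} (h0 : v 0 = w 0) (h1 : v 1 = w 1) (h2 : v 2 = w 2) : v = w := by
  ext i; fin_cases i <;> assumption

/-- Up to the factor `|a × b|²`, the vectors `b × (a × b)`, `(a × b) × a`, `a × b` are dual to `a`,
`b`, `a × b`. -/
theorem cross_dual_basis (y a b : Fin 3 → ℝ) :
    ((a ⨯₃ b) ⬝ᵥ (a ⨯₃ b)) • y = (y ⬝ᵥ (a ⨯₃ b)) • (a ⨯₃ b) + (y ⬝ᵥ a) • (b ⨯₃ (a ⨯₃ b))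
      + (y ⬝ᵥ b) • ((a ⨯₃ b) ⨯₃ a) := by
  apply ext3 <;> simp only [Pi.add_apply, Pi.smul_apply, smul_eq_mul, dot3, cross_zero, cross_one,
    cross_two] <;> ring

/-- The cross product as a continuous bilinear map. -/
noncomputable def crossL : (Fin 3 → ℝ) →L[ℝ] (Fin 3 → ℝ) →L[ℝ] (Fin 3 → ℝ) :=
  LinearMap.toContinuousBilinearMap (crossProduct (R := ℝ))

theorem crossL_apply (v w : Fin 3 → ℝ) : crossL v w = v ⨯₃ w := rfl

/-- The dot product as a continuous bilinear map. -/
noncomputable def dotL : (Fin 3 → ℝ) →L[ℝ] (Fin 3 → ℝ) →L[ℝ] ℝ :=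
  LinearMap.toContinuousBilinearMap (dotProductBilin ℝ ℝ)

theorem dotL_apply (v w : Fin 3 → ℝ) : dotL v w = v ⬝ᵥ w := rfl

section
variable {E : Type*} [NormedAddCommGroup E] [NormedSpace ℝ E] {f g : E → Fin 3 → ℝ} {x : E}

theorem contDiffAt_cross {n : WithTop ℕ∞} (hf : ContDiffAt ℝ n f x) (hg : ContDiffAt ℝ n g x) :
    ContDiffAt ℝ n (fun x => f x ⨯₃ g x) x :=
  (crossL.contDiff.contDiffAt.comp x hf).clm_apply hg

theorem contDiffAt_dot {n : WithTop ℕ∞} (hf : ContDiffAt ℝ n f x) (hg : ContDiffAt ℝ n g x) :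
    ContDiffAt ℝ n (fun x => f x ⬝ᵥ g x) x :=
  (dotL.contDiff.contDiffAt.comp x hf).clm_apply hg

theorem fderiv_cross (hf : DifferentiableAt ℝ f x) (hg : DifferentiableAt ℝ g x) (e : E) :
    fderiv ℝ (fun x => f x ⨯₃ g x) x e = fderiv ℝ f x e ⨯₃ g x + f x ⨯₃ fderiv ℝ g x e := by
  have := crossL.hasFDerivAt_of_bilinear hf.hasFDerivAt hg.hasFDerivAt
  have h2 : HasFDerivAt (fun x => f x ⨯₃ g x) _ x := this
  rw [h2.fderiv]
  simp [crossL_apply, add_comm]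

theorem fderiv_dot (hf : DifferentiableAt ℝ f x) (hg : DifferentiableAt ℝ g x) (e : E) :
    fderiv ℝ (fun x => f x ⬝ᵥ g x) x e = fderiv ℝ f x e ⬝ᵥ g x + f x ⬝ᵥ fderiv ℝ g x e := by
  have := dotL.hasFDerivAt_of_bilinear hf.hasFDerivAt hg.hasFDerivAt
  have h2 : HasFDerivAt (fun x => f x ⬝ᵥ g x) _ x := this
  rw [h2.fderiv]
  simp [dotL_apply, add_comm]

theorem fderiv_comp_apply (hf : DifferentiableAt ℝ f x) (e : E) (i : Fin 3) :
    fderiv ℝ (fun x => f x i) x e = fderiv ℝ f x e i := by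
  have := ((ContinuousLinearMap.proj (R := ℝ) (φ := fun _ : Fin 3 => ℝ) i).hasFDerivAt.comp x
    hf.hasFDerivAt)
  have h2 : HasFDerivAt (fun x => f x i) _ x := this
  rw [h2.fderiv]; rfl

end

/-! ### Two-jets of surfaces -/

/-- Second order jets, with components `X, X_u, X_v, X_uu, X_uv, X_vv`. -/
abbrev Jet := Fin 6 → Fin 3 → ℝ

/-- The second order jet of a surface. -/
noncomputable def jet (X : ℂ → Fin 3 → ℝ) (w : ℂ) : Jet :=
  ![X w, Xu X w, Xv X w, Xu (Xu X) w, Xv (Xu X) w, Xv (Xv X) w]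

/-- `X_u × X_v` as a function of the jet. -/
noncomputable def jetNormal (p : Jet) : Fin 3 → ℝ := p 1 ⨯₃ p 2

/-- The area density as a function of the jet. -/
noncomputable def jetArea (p : Jet) : ℝ := √(jetNormal p ⬝ᵥ jetNormal p)

/-- The unit normal as a function of the jet. -/
noncomputable def jetUnit (p : Jet) : Fin 3 → ℝ := (jetArea p)⁻¹ • jetNormal p

/-- The mean curvature as a function of the jet. -/
noncomputable def jetMean (p : Jet) : ℝ :=
  (p 2 ⬝ᵥ p 2 * (p 3 ⬝ᵥ jetUnit p) - 2 * (p 1 ⬝ᵥ p 2) * (p 4 ⬝ᵥ jetUnit p)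
    + p 1 ⬝ᵥ p 1 * (p 5 ⬝ᵥ jetUnit p)) / (2 * (p 1 ⬝ᵥ p 1 * (p 2 ⬝ᵥ p 2) - (p 1 ⬝ᵥ p 2) ^ 2))

/-- Jets of immersions. -/
def regularJets : Set Jet := {p | jetNormal p ⬝ᵥ jetNormal p ≠ 0}

section
variable (X : ℂ → Fin 3 → ℝ) (w : ℂ)

theorem jet_zero : jet X w 0 = X w := rfl

theorem jet_one : jet X w 1 = Xu X w := rfl

theorem jet_two : jet X w 2 = Xv X w := rfl

theorem jet_three : jet X w 3 = Xu (Xu X) w := rfl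

theorem jet_four : jet X w 4 = Xv (Xu X) w := rfl

theorem jet_five : jet X w 5 = Xv (Xv X) w := rfl

theorem jetNormal_jet : jetNormal (jet X w) = Xu X w ⨯₃ Xv X w := by
  rw [jetNormal, jet_one, jet_two]

theorem areaDensity_eq : areaDensity X w = jetArea (jet X w) := by
  rw [areaDensity, jetArea, jetNormal_jet]

theorem unitNormal_eq : unitNormal X w = jetUnit (jet X w) := by
  rw [unitNormal, jetUnit, jetNormal_jet, areaDensity_eq]

theorem meanCurvature_eq : meanCurvature X w = jetMean (jet X w) := by
  simp only [meanCurvature, jetMean, unitNormal_eq, jet_one, jet_two, jet_three, jet_four, jet_five]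

end

theorem jetNormal_dot_self (p : Jet) :
    jetNormal p ⬝ᵥ jetNormal p = p 1 ⬝ᵥ p 1 * (p 2 ⬝ᵥ p 2) - (p 1 ⬝ᵥ p 2) ^ 2 := by
  rw [jetNormal, cross_dot_cross, dotProduct_comm (p 2) (p 1)]; ring

theorem dot_self_nonneg (v : Fin 3 → ℝ) : 0 ≤ v ⬝ᵥ v := by
  rw [dot3]; nlinarith [mul_self_nonneg (v 0), mul_self_nonneg (v 1), mul_self_nonneg (v 2)]

theorem jetArea_sq (p : Jet) : jetArea p ^ 2 = jetNormal p ⬝ᵥ jetNormal p :=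
  Real.sq_sqrt (dot_self_nonneg _)

theorem jetArea_pos {p : Jet} (hp : p ∈ regularJets) : 0 < jetArea p :=
  Real.sqrt_pos.2 (lt_of_le_of_ne (dot_self_nonneg _) (Ne.symm hp))

theorem jetNormal_eq_smul {p : Jet} (hp : p ∈ regularJets) :
    jetNormal p = jetArea p • jetUnit p := by
  rw [jetUnit, smul_smul, mul_inv_cancel₀ (jetArea_pos hp).ne', one_smul]

theorem jetUnit_dot_self {p : Jet} (hp : p ∈ regularJets) : jetUnit p ⬝ᵥ jetUnit p = 1 := by
  have := (jetArea_pos hp).ne'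
  rw [jetUnit, smul_dotProduct, dotProduct_smul, ← jetArea_sq]
  simp only [smul_eq_mul]; field_simp

theorem contDiff_jetNormal {n : WithTop ℕ∞} : ContDiff ℝ n jetNormal :=
  contDiff_iff_contDiffAt.2 fun _ => contDiffAt_cross (contDiff_apply ℝ _ 1).contDiffAt
    (contDiff_apply ℝ _ 2).contDiffAt

theorem isOpen_regularJets : IsOpen regularJets :=
  isOpen_ne.preimage
    (contDiff_iff_contDiffAt.2 fun _ => contDiffAt_dot (n := 0) contDiff_jetNormal.contDiffAt
      contDiff_jetNormal.contDiffAt).continuous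

section
variable {n : WithTop ℕ∞} {p : Jet} (hp : p ∈ regularJets)
include hp

theorem contDiffAt_jetArea : ContDiffAt ℝ n jetArea p :=
  (contDiffAt_dot contDiff_jetNormal.contDiffAt contDiff_jetNormal.contDiffAt).sqrt hp

theorem contDiffAt_jetUnit : ContDiffAt ℝ n jetUnit p :=
  ((contDiffAt_jetArea hp).inv (jetArea_pos hp).ne').smul contDiff_jetNormal.contDiffAt

theorem contDiffAt_jetMean : ContDiffAt ℝ n jetMean p := by
  have hc : ∀ i : Fin 6, ContDiffAt ℝ n (fun p : Jet => p i) p := fun i =>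
    (contDiff_apply ℝ _ i).contDiffAt
  have hu := contDiffAt_jetUnit (n := n) hp
  refine ContDiffAt.div ?_ ?_ ?_
  · exact ((((contDiffAt_dot (hc 2) (hc 2)).mul (contDiffAt_dot (hc 3) hu))).sub
      ((contDiffAt_const.mul (contDiffAt_dot (hc 1) (hc 2))).mul (contDiffAt_dot (hc 4) hu))).add
      ((contDiffAt_dot (hc 1) (hc 1)).mul (contDiffAt_dot (hc 5) hu))
  · exact contDiffAt_const.mul (((contDiffAt_dot (hc 1) (hc 1)).mul
      (contDiffAt_dot (hc 2) (hc 2))).sub ((contDiffAt_dot (hc 1) (hc 2)).pow 2))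
  · rw [← jetNormal_dot_self]
    exact mul_ne_zero two_ne_zero hp

end

/-! ### Regularity of the geometric quantities -/

/-- `X` is of class `C⁴` near `w` and immersive at `w`. -/
def Reg (X : ℂ → Fin 3 → ℝ) (w : ℂ) : Prop := ContDiffAt ℝ 4 X w ∧ jet X w ∈ regularJets

section
variable {X : ℂ → Fin 3 → ℝ} {w : ℂ}

theorem contDiffAt_Xu {n : WithTop ℕ∞} (h : ContDiffAt ℝ (n + 1) X w) :
    ContDiffAt ℝ n (Xu X) w :=
  (h.fderiv_right le_rfl).clm_apply contDiffAt_const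

theorem contDiffAt_Xv {n : WithTop ℕ∞} (h : ContDiffAt ℝ (n + 1) X w) :
    ContDiffAt ℝ n (Xv X) w :=
  (h.fderiv_right le_rfl).clm_apply contDiffAt_const

theorem contDiffAt_Xu3 (h : ContDiffAt ℝ 4 X w) : ContDiffAt ℝ 3 (Xu X) w :=
  contDiffAt_Xu (n := 3) (by simpa [show (3 : WithTop ℕ∞) + 1 = 4 by norm_num] using h)

theorem contDiffAt_Xv3 (h : ContDiffAt ℝ 4 X w) : ContDiffAt ℝ 3 (Xv X) w :=
  contDiffAt_Xv (n := 3) (by simpa [show (3 : WithTop ℕ∞) + 1 = 4 by norm_num] using h)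

theorem contDiffAt_jet (h : ContDiffAt ℝ 4 X w) : ContDiffAt ℝ 2 (jet X) w := by
  have h32 : (2 : WithTop ℕ∞) + 1 = 3 := by norm_num
  have hu := contDiffAt_Xu3 h
  have hv := contDiffAt_Xv3 h
  have h23 : (2 : WithTop ℕ∞) ≤ 3 := by norm_num
  rw [contDiffAt_pi]
  intro i
  fin_cases i
  · exact h.of_le (by norm_num)
  · exact hu.of_le h23
  · exact hv.of_le h23
  · exact contDiffAt_Xu (by rw [h32]; exact hu)
  · exact contDiffAt_Xv (by rw [h32]; exact hu)
  · exact contDiffAt_Xv (by rw [h32]; exact hv)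

theorem Xu_Xv_comm (h : ContDiffAt ℝ 4 X w) : Xu (Xv X) w = Xv (Xu X) w := by
  have hs : IsSymmSndFDerivAt ℝ X w := h.isSymmSndFDerivAt (by simp; norm_num)
  have hd : DifferentiableAt ℝ (fderiv ℝ X) w :=
    (h.fderiv_right (m := 1) (by norm_num)).differentiableAt one_ne_zero
  have hgen : ∀ e e' : ℂ, fderiv ℝ (fun w => fderiv ℝ X w e) w e' =
      fderiv ℝ (fderiv ℝ X) w e' e := by
    intro e e'
    rw [fderiv_clm_apply hd (differentiableAt_const _)]
    simp
  change fderiv ℝ (fun w => fderiv ℝ X w Complex.I) w 1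
    = fderiv ℝ (fun w => fderiv ℝ X w 1) w Complex.I
  rw [hgen, hgen, hs.eq]

theorem Reg.eventually (h : Reg X w) : ∀ᶠ v in 𝓝 w, Reg X v :=
  (h.1.eventually (by decide)).and
    ((contDiffAt_jet h.1).continuousAt.eventually (isOpen_regularJets.mem_nhds h.2))

theorem Reg.contDiffAt_meanCurvature (h : Reg X w) : ContDiffAt ℝ 2 (meanCurvature X) w := by
  rw [funext (meanCurvature_eq X)]
  exact (contDiffAt_jetMean h.2).comp w (contDiffAt_jet h.1)

/-- The part of order at most one of the jet of a surface. -/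
noncomputable def jetOne (X : ℂ → Fin 3 → ℝ) (w : ℂ) : Jet := ![X w, Xu X w, Xv X w, 0, 0, 0]

/-- The normal and the area density involve first derivatives only. Discarding the second-order
slots gains one derivative over the full jet, which is merely `C²`. -/
theorem contDiffAt_jetOne (h : ContDiffAt ℝ 4 X w) : ContDiffAt ℝ 3 (jetOne X) w := by
  rw [contDiffAt_pi]
  intro i
  fin_cases i
  · exact h.of_le (by norm_num)
  · exact contDiffAt_Xu3 h
  · exact contDiffAt_Xv3 h
  all_goals exact contDiffAt_const

theorem jetNormal_jetOne : jetNormal (jetOne X w) = jetNormal (jet X w) := by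
  rw [jetNormal_jet, jetNormal]; congr 1

theorem Reg.jetOne_mem (h : Reg X w) : jetOne X w ∈ regularJets := by
  change jetNormal (jetOne X w) ⬝ᵥ jetNormal (jetOne X w) ≠ 0
  rw [jetNormal_jetOne]; exact h.2

theorem Reg.contDiffAt_areaDensity (h : Reg X w) : ContDiffAt ℝ 3 (areaDensity X) w := by
  have := (contDiffAt_jetArea (n := 3) h.jetOne_mem).comp w (contDiffAt_jetOne h.1)
  exact this.congr_of_eventuallyEq (.of_forall fun v => by
    rw [areaDensity_eq, Function.comp_apply, jetArea, jetArea, jetNormal_jetOne])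

theorem Reg.contDiffAt_unitNormal (h : Reg X w) : ContDiffAt ℝ 3 (unitNormal X) w := by
  have := (contDiffAt_jetUnit (n := 3) h.jetOne_mem).comp w (contDiffAt_jetOne h.1)
  exact this.congr_of_eventuallyEq (.of_forall fun v => by
    rw [unitNormal_eq, Function.comp_apply, jetUnit, jetUnit, jetArea, jetArea, jetNormal_jetOne])

theorem Reg.areaDensity_pos (h : Reg X w) : 0 < areaDensity X w := by
  rw [areaDensity_eq]; exact jetArea_pos h.2

theorem Reg.cross_eq (h : Reg X w) : Xu X w ⨯₃ Xv X w = areaDensity X w • unitNormal X w := by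
  rw [areaDensity_eq, unitNormal_eq, ← jetNormal_eq_smul h.2, jetNormal_jet]

theorem Reg.unitNormal_dot_self (h : Reg X w) : unitNormal X w ⬝ᵥ unitNormal X w = 1 := by
  rw [unitNormal_eq]; exact jetUnit_dot_self h.2

theorem areaDensity_sq : areaDensity X w ^ 2 = (Xu X w ⨯₃ Xv X w) ⬝ᵥ (Xu X w ⨯₃ Xv X w) := by
  rw [areaDensity_eq, jetArea_sq, jetNormal_jet]

/-- Linearity of differentiation: a variation of the surface moves its jet along a straight line in
jet space. -/
theorem jet_add_smul {V : ℂ → Fin 3 → ℝ} (h : ContDiffAt ℝ 4 X w) (hV : ContDiff ℝ 4 V) (ε : ℝ) :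
    jet (fun w => X w + ε • V w) w = jet X w + ε • jet V w := by
  have hD : ∀ {f g : ℂ → Fin 3 → ℝ} {w e : ℂ}, DifferentiableAt ℝ f w → DifferentiableAt ℝ g w →
      fderiv ℝ (fun w => f w + ε • g w) w e = fderiv ℝ f w e + ε • fderiv ℝ g w e := by
    intro f g w e hf hg
    have : HasFDerivAt (fun w => f w + ε • g w) _ w :=
      hf.hasFDerivAt.add (hg.hasFDerivAt.const_smul ε)
    rw [this.fderiv]; rfl
  have hV' : ∀ w, ContDiffAt ℝ 4 V w := fun w => hV.contDiffAt
  have h4 : (4 : WithTop ℕ∞) ≠ 0 := by norm_num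
  have h3 : (3 : WithTop ℕ∞) ≠ 0 := by norm_num
  have hu : ∀ᶠ v in 𝓝 w, Xu (fun w => X w + ε • V w) v = Xu X v + ε • Xu V v := by
    filter_upwards [h.eventually (by decide)] with v hv
    exact hD (hv.differentiableAt h4) ((hV' v).differentiableAt h4)
  have hv : ∀ᶠ v in 𝓝 w, Xv (fun w => X w + ε • V w) v = Xv X v + ε • Xv V v := by
    filter_upwards [h.eventually (by decide)] with v hv
    exact hD (hv.differentiableAt h4) ((hV' v).differentiableAt h4)
  have hXu := (contDiffAt_Xu3 h).differentiableAt h3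
  have hXv := (contDiffAt_Xv3 h).differentiableAt h3
  have hVu := (contDiffAt_Xu3 (hV' w)).differentiableAt h3
  have hVv := (contDiffAt_Xv3 (hV' w)).differentiableAt h3
  funext i
  fin_cases i
  · rfl
  · exact hu.self_of_nhds
  · exact hv.self_of_nhds
  · exact (congrArg (fun L => L 1) (EventuallyEq.fderiv_eq (𝕜 := ℝ) hu)).trans (hD hXu hVu)
  · exact (congrArg (fun L => L Complex.I) (EventuallyEq.fderiv_eq (𝕜 := ℝ) hu)).trans (hD hXu hVu)
  · exact (congrArg (fun L => L Complex.I) (EventuallyEq.fderiv_eq (𝕜 := ℝ) hv)).trans (hD hXv hVv)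

end

/-! ### Compactness of the domain and regularity of immersions on it -/

theorem isCompact_dom (a : ℝ) : IsCompact (dom a) := by
  have : dom a = {w | a ≤ ‖w‖} ∩ Metric.closedBall 0 1 := by
    ext w; simp [dom]
  rw [this, inter_comm]
  exact (isCompact_closedBall 0 1).inter_right (isClosed_le continuous_const continuous_norm)

theorem IsAxiallySymmetricImmersion.reg {a : ℝ} {X : ℂ → Fin 3 → ℝ}
    (hX : IsAxiallySymmetricImmersion a X) {w : ℂ} (hw : w ∈ dom a) : Reg X w := by
  refine ⟨hX.contDiffAt w hw, ?_⟩
  have hinj := hX.immersion w hw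
  have hli : LinearIndependent ℝ ![(1 : ℂ), Complex.I] := by
    have := Complex.basisOneI.linearIndependent
    rwa [Complex.coe_basisOneI] at this
  have h2 := hli.map' (fderiv ℝ X w).toLinearMap (LinearMap.ker_eq_bot.2 hinj)
  have h3 : (fderiv ℝ X w).toLinearMap ∘ ![(1 : ℂ), Complex.I] = ![Xu X w, Xv X w] := by
    ext i; fin_cases i <;> rfl
  rw [h3] at h2
  have h4 := crossProduct_ne_zero_iff_linearIndependent.2 h2
  intro h5
  rw [jetNormal_jet] at h5
  exact h4 (dotProduct_self_eq_zero.1 h5)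


/-! ### The divergence form of the mean curvature -/

/-- The vertical unit vector. -/
def e₃ : Fin 3 → ℝ := ![0, 0, 1]

theorem e₃_zero : e₃ 0 = 0 := rfl

theorem e₃_one : e₃ 1 = 0 := rfl

theorem e₃_two : e₃ 2 = 1 := rfl

section
variable {X : ℂ → Fin 3 → ℝ} {w : ℂ}

theorem Reg.differentiableAt_unitNormal (h : Reg X w) : DifferentiableAt ℝ (unitNormal X) w :=
  h.contDiffAt_unitNormal.differentiableAt (by norm_num)

theorem Reg.differentiableAt_Xu (h : Reg X w) : DifferentiableAt ℝ (Xu X) w :=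
  (contDiffAt_Xu3 h.1).differentiableAt (by norm_num)

theorem Reg.differentiableAt_Xv (h : Reg X w) : DifferentiableAt ℝ (Xv X) w :=
  (contDiffAt_Xv3 h.1).differentiableAt (by norm_num)

theorem unitNormal_dot_Xu : unitNormal X w ⬝ᵥ Xu X w = 0 := by
  rw [unitNormal, smul_dotProduct, dotProduct_comm, dot_self_cross, smul_zero]

theorem unitNormal_dot_Xv : unitNormal X w ⬝ᵥ Xv X w = 0 := by
  rw [unitNormal, smul_dotProduct, dotProduct_comm, dot_cross_self, smul_zero]

theorem Reg.fderiv_unitNormal_dot_self (h : Reg X w) (e : ℂ) :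
    unitNormal X w ⬝ᵥ fderiv ℝ (unitNormal X) w e = 0 := by
  have h1 : (fun v => unitNormal X v ⬝ᵥ unitNormal X v) =ᶠ[𝓝 w] fun _ => 1 := by
    filter_upwards [h.eventually] with v hv using hv.unitNormal_dot_self
  have h2 := fderiv_dot h.differentiableAt_unitNormal h.differentiableAt_unitNormal e
  rw [h1.fderiv_eq] at h2
  simp only [fderiv_fun_const, Pi.zero_apply, _root_.zero_apply] at h2
  rw [dotProduct_comm (fderiv ℝ (unitNormal X) w e)] at h2
  linarith

theorem Reg.fderiv_unitNormal_dot_Xu (h : Reg X w) (e : ℂ) :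
    fderiv ℝ (unitNormal X) w e ⬝ᵥ Xu X w = -(fderiv ℝ (Xu X) w e ⬝ᵥ unitNormal X w) := by
  have h1 : (fun v => unitNormal X v ⬝ᵥ Xu X v) =ᶠ[𝓝 w] fun _ => 0 := by
    exact .of_forall fun v => unitNormal_dot_Xu
  have h2 := fderiv_dot h.differentiableAt_unitNormal h.differentiableAt_Xu e
  rw [h1.fderiv_eq] at h2
  simp only [fderiv_fun_const, Pi.zero_apply, _root_.zero_apply] at h2
  rw [dotProduct_comm (fderiv ℝ (Xu X) w e)]
  linarith

theorem Reg.fderiv_unitNormal_dot_Xv (h : Reg X w) (e : ℂ) :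
    fderiv ℝ (unitNormal X) w e ⬝ᵥ Xv X w = -(fderiv ℝ (Xv X) w e ⬝ᵥ unitNormal X w) := by
  have h1 : (fun v => unitNormal X v ⬝ᵥ Xv X v) =ᶠ[𝓝 w] fun _ => 0 := by
    exact .of_forall fun v => unitNormal_dot_Xv
  have h2 := fderiv_dot h.differentiableAt_unitNormal h.differentiableAt_Xv e
  rw [h1.fderiv_eq] at h2
  simp only [fderiv_fun_const, Pi.zero_apply, _root_.zero_apply] at h2
  rw [dotProduct_comm (fderiv ℝ (Xv X) w e)]
  linarith

theorem Reg.meanCurvature_mul (h : Reg X w) :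
    2 * meanCurvature X w * areaDensity X w ^ 2 =
      Xv X w ⬝ᵥ Xv X w * (Xu (Xu X) w ⬝ᵥ unitNormal X w)
        - 2 * (Xu X w ⬝ᵥ Xv X w) * (Xv (Xu X) w ⬝ᵥ unitNormal X w)
        + Xu X w ⬝ᵥ Xu X w * (Xv (Xv X) w ⬝ᵥ unitNormal X w) := by
  have h1 := jetNormal_dot_self (jet X w)
  have h2 := h.areaDensity_pos.ne'
  rw [jetNormal_jet, ← areaDensity_sq, jet_one, jet_two] at h1
  simp only [meanCurvature]
  rw [← h1]
  field_simp

theorem smul_eq_of_dot {y a b n : Fin 3 → ℝ} {W : ℝ} (hW : W ≠ 0) (hab : a ⨯₃ b = W • n)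
    (hn : n ⬝ᵥ n = 1) :
    W • y = (W * (y ⬝ᵥ n)) • n + (y ⬝ᵥ a) • (b ⨯₃ n) + (y ⬝ᵥ b) • (n ⨯₃ a) := by
  have h := cross_dual_basis y a b
  rw [hab] at h
  simp only [smul_dotProduct, dotProduct_smul, hn, smul_eq_mul, map_smul, LinearMap.smul_apply] at h
  have h2 : W • (W • y) = W • ((W * (y ⬝ᵥ n)) • n + (y ⬝ᵥ a) • (b ⨯₃ n) + (y ⬝ᵥ b) • (n ⨯₃ a)) := by
    simp only [smul_add, smul_smul] at h ⊢
    rw [mul_one] at h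
    rw [h]
    congr 2 <;> ring_nf
  exact smul_right_injective _ hW h2

/-- The tangential gradient of a height function, in divergence form. -/
theorem Reg.grad_identity (h : Reg X w) :
    (Xu X w 2) • (Xv X w ⨯₃ unitNormal X w) + (Xv X w 2) • (unitNormal X w ⨯₃ Xu X w)
      = areaDensity X w • (e₃ - unitNormal X w 2 • unitNormal X w) := by
  have key := smul_eq_of_dot (y := e₃) h.areaDensity_pos.ne' h.cross_eq h.unitNormal_dot_self
  have he : ∀ v : Fin 3 → ℝ, e₃ ⬝ᵥ v = v 2 := fun v => by
    rw [dot3, e₃_zero, e₃_one, e₃_two]; ring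
  rw [he, he, he] at key
  rw [smul_sub, key, smul_smul]
  abel

theorem Reg.grad_identity_e₃ (h : Reg X w) :
    (Xu X w 2) • (Xv X w ⨯₃ e₃) + (Xv X w 2) • (e₃ ⨯₃ Xu X w)
      = areaDensity X w • (unitNormal X w 2 • e₃ - unitNormal X w) := by
  rw [smul_sub, smul_smul, ← h.cross_eq]
  have : areaDensity X w * unitNormal X w 2 = (Xu X w ⨯₃ Xv X w) 2 := by rw [h.cross_eq]; rfl
  rw [this]
  apply ext3 <;> simp only [Pi.add_apply, Pi.sub_apply, Pi.smul_apply, smul_eq_mul, cross_zero,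
    cross_one, cross_two, e₃_zero, e₃_one, e₃_two] <;> ring

/-- `ΔX = 2Hν` in divergence form. -/
theorem Reg.laplace_identity (h : Reg X w) :
    fderiv ℝ (fun w => Xv X w ⨯₃ unitNormal X w) w 1
      + fderiv ℝ (fun w => unitNormal X w ⨯₃ Xu X w) w Complex.I
      = (2 * meanCurvature X w * areaDensity X w) • unitNormal X w := by
  rw [fderiv_cross h.differentiableAt_Xv h.differentiableAt_unitNormal,
    fderiv_cross h.differentiableAt_unitNormal h.differentiableAt_Xu]
  change Xu (Xv X) w ⨯₃ _ + _ + (_ + _ ⨯₃ Xv (Xu X) w) = _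
  rw [Xu_Xv_comm h.1]
  set νu := fderiv ℝ (unitNormal X) w 1 with hνu
  set νv := fderiv ℝ (unitNormal X) w Complex.I with hνv
  -- The two terms with the mixed second derivative cancel by antisymmetry.
  have hy : Xv (Xu X) w ⨯₃ unitNormal X w + Xv X w ⨯₃ νu
      + (νv ⨯₃ Xu X w + unitNormal X w ⨯₃ Xv (Xu X) w) = Xv X w ⨯₃ νu + νv ⨯₃ Xu X w := by
    rw [← cross_anticomm (unitNormal X w)]; abel
  rw [hy]
  set y := Xv X w ⨯₃ νu + νv ⨯₃ Xu X w with hydef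
  have hW := h.areaDensity_pos.ne'
  have huu : νu ⬝ᵥ Xu X w = -(Xu (Xu X) w ⬝ᵥ unitNormal X w) := h.fderiv_unitNormal_dot_Xu 1
  have hvu : νv ⬝ᵥ Xu X w = -(Xv (Xu X) w ⬝ᵥ unitNormal X w) :=
    h.fderiv_unitNormal_dot_Xu Complex.I
  have huv : νu ⬝ᵥ Xv X w = -(Xv (Xu X) w ⬝ᵥ unitNormal X w) := by
    rw [← Xu_Xv_comm h.1]; exact h.fderiv_unitNormal_dot_Xv 1
  have hvv : νv ⬝ᵥ Xv X w = -(Xv (Xv X) w ⬝ᵥ unitNormal X w) :=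
    h.fderiv_unitNormal_dot_Xv Complex.I
  -- The tangential components vanish: each is a triple product equal to `W` times the product of a
  -- derivative of `ν` with `ν`, which is zero as `|ν| = 1`.
  have hya : y ⬝ᵥ Xu X w = 0 := by
    have h1 : y ⬝ᵥ Xu X w = νu ⬝ᵥ (Xu X w ⨯₃ Xv X w) := by
      simp only [hydef, dot3, Pi.add_apply, cross_zero, cross_one, cross_two]; ring
    rw [h1, h.cross_eq, dotProduct_smul, dotProduct_comm, hνu, h.fderiv_unitNormal_dot_self,
      smul_zero]
  have hyb : y ⬝ᵥ Xv X w = 0 := by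
    have h1 : y ⬝ᵥ Xv X w = νv ⬝ᵥ (Xu X w ⨯₃ Xv X w) := by
      simp only [hydef, dot3, Pi.add_apply, cross_zero, cross_one, cross_two]; ring
    rw [h1, h.cross_eq, dotProduct_smul, dotProduct_comm, hνv, h.fderiv_unitNormal_dot_self,
      smul_zero]
  have hyn : areaDensity X w * (y ⬝ᵥ unitNormal X w)
      = 2 * meanCurvature X w * areaDensity X w ^ 2 := by
    have h1 : areaDensity X w * (y ⬝ᵥ unitNormal X w) = y ⬝ᵥ (Xu X w ⨯₃ Xv X w) := by
      rw [h.cross_eq, dotProduct_smul, smul_eq_mul]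
    rw [h1, hydef, add_dotProduct, cross_dot_cross, cross_dot_cross, huu, huv, hvu, hvv,
      h.meanCurvature_mul, dotProduct_comm (Xv X w) (Xu X w)]
    ring
  have key := smul_eq_of_dot (y := y) hW h.cross_eq h.unitNormal_dot_self
  rw [hya, hyb, zero_smul, zero_smul, add_zero, add_zero, hyn] at key
  refine smul_right_injective _ hW (key.trans ?_)
  change _ = areaDensity X w • _
  rw [smul_smul]; congr 1; ring

end

/-! ### The first variation of the functional `𝒢` -/

/-- The Lagrangian of `𝒢` with respect to the plane `z = A`. -/
noncomputable def lagrangianG (c₀ A : ℝ) (p : Jet) : ℝ :=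
  jetArea p / (p 0 2 - A) ^ 2 + 2 * c₀ * (jetNormal p 2 / (p 0 2 - A))

/-- Jets of immersions at points off the plane `z = A`. -/
def regularJetsOff (A : ℝ) : Set Jet := regularJets ∩ {p | p 0 2 ≠ A}

theorem isOpen_regularJetsOff (A : ℝ) : IsOpen (regularJetsOff A) :=
  isOpen_regularJets.inter (isOpen_ne.preimage (by fun_prop))

theorem contDiffAt_height {n : WithTop ℕ∞} {p : Jet} (A : ℝ) :
    ContDiffAt ℝ n (fun p : Jet => p 0 2 - A) p := by fun_prop

theorem contDiffAt_lagrangianG {n : WithTop ℕ∞} {c₀ A : ℝ} {p : Jet} (hp : p ∈ regularJetsOff A) :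
    ContDiffAt ℝ n (lagrangianG c₀ A) p := by
  have h0 : p 0 2 - A ≠ 0 := sub_ne_zero.2 hp.2
  have hn : ContDiffAt ℝ n (fun p => jetNormal p 2) p :=
    (contDiff_apply ℝ ℝ (2 : Fin 3)).contDiffAt.comp p contDiff_jetNormal.contDiffAt
  exact ((contDiffAt_jetArea hp.1).div ((contDiffAt_height A).pow 2) (pow_ne_zero 2 h0)).add
    (contDiffAt_const.mul (hn.div (contDiffAt_height A) h0))

/-- Fréchet derivatives of Lagrangians are identified by differentiating along a line, where
explicit formulas are available. -/
theorem fderiv_apply_eq_of_hasDerivAt {E : Type*} [NormedAddCommGroup E] [NormedSpace ℝ E]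
    {F : E → ℝ} {p q : E} {c : ℝ} (hF : DifferentiableAt ℝ F p)
    (h : HasDerivAt (fun ε : ℝ => F (p + ε • q)) c 0) : fderiv ℝ F p q = c := by
  have hl : HasDerivAt (fun ε : ℝ => p + ε • q) q 0 := by
    simpa using ((hasDerivAt_id (0 : ℝ)).smul_const q).const_add p
  have hF' : HasFDerivAt F (fderiv ℝ F p) (p + (0 : ℝ) • q) := by simpa using hF.hasFDerivAt
  exact (hF'.comp_hasDerivAt (0 : ℝ) hl).unique h

/-- The derivative of `jetNormal` at `p` in direction `q`. -/
noncomputable def jetNormalDeriv (p q : Jet) : Fin 3 → ℝ := q 1 ⨯₃ p 2 + p 1 ⨯₃ q 2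

theorem hasDerivAt_jetNormal (p q : Jet) (i : Fin 3) :
    HasDerivAt (fun ε : ℝ => jetNormal (p + ε • q) i) (jetNormalDeriv p q i) 0 := by
  -- The cross product is bilinear, so the normal is a quadratic polynomial in `ε`.
  have h : ∀ ε : ℝ, jetNormal (p + ε • q)
      = jetNormal p + ε • jetNormalDeriv p q + ε ^ 2 • (q 1 ⨯₃ q 2) := by
    intro ε
    apply ext3 <;> simp only [jetNormal, jetNormalDeriv, Pi.add_apply, Pi.smul_apply, smul_eq_mul,
      cross_zero, cross_one, cross_two] <;> ring
  simp only [h, Pi.add_apply, Pi.smul_apply, smul_eq_mul]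
  have := (((hasDerivAt_id (0 : ℝ)).mul_const (jetNormalDeriv p q i)).const_add
    (jetNormal p i)).add (((hasDerivAt_id (0 : ℝ)).pow 2).mul_const ((q 1 ⨯₃ q 2) i))
  exact this.congr_deriv (by simp)

theorem hasDerivAt_jetArea {p : Jet} (hp : p ∈ regularJets) (q : Jet) :
    HasDerivAt (fun ε : ℝ => jetArea (p + ε • q)) (jetUnit p ⬝ᵥ jetNormalDeriv p q) 0 := by
  have h0 : jetNormal (p + (0 : ℝ) • q) = jetNormal p := by simp
  have hd : HasDerivAt (fun ε : ℝ => jetNormal (p + ε • q) ⬝ᵥ jetNormal (p + ε • q))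
      (2 * (jetNormal p ⬝ᵥ jetNormalDeriv p q)) 0 := by
    simp only [dot3]
    have h := fun i => (hasDerivAt_jetNormal p q i).mul (hasDerivAt_jetNormal p q i)
    have h2 := ((h 0).add (h 1)).add (h 2)
    simp only [h0] at h2
    refine h2.congr_deriv ?_
    ring
  have hs := hd.sqrt (by rw [h0]; exact hp)
  refine hs.congr_deriv ?_
  rw [h0, jetUnit, smul_dotProduct, smul_eq_mul]
  change _ / (2 * jetArea p) = _
  have := (jetArea_pos hp).ne'
  field_simp

theorem fderiv_lagrangianG {c₀ A : ℝ} {p : Jet} (hp : p ∈ regularJetsOff A) (q : Jet) :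
    fderiv ℝ (lagrangianG c₀ A) p q =
      jetUnit p ⬝ᵥ jetNormalDeriv p q / (p 0 2 - A) ^ 2
        - 2 * jetArea p * q 0 2 / (p 0 2 - A) ^ 3
        + 2 * c₀ * (jetNormalDeriv p q 2 / (p 0 2 - A)
          - jetNormal p 2 * q 0 2 / (p 0 2 - A) ^ 2) := by
  have h0 : p 0 2 - A ≠ 0 := sub_ne_zero.2 hp.2
  refine fderiv_apply_eq_of_hasDerivAt
    ((contDiffAt_lagrangianG (n := 1) hp).differentiableAt one_ne_zero) ?_
  have hz : HasDerivAt (fun ε : ℝ => (p + ε • q) 0 2 - A) (q 0 2) 0 := by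
    simp only [Pi.add_apply, Pi.smul_apply, smul_eq_mul]
    simpa using (((hasDerivAt_id (0 : ℝ)).mul_const (q 0 2)).const_add (p 0 2)).sub_const A
  have hz0 : (p + (0 : ℝ) • q) 0 2 - A = p 0 2 - A := by simp
  have h1 := (hasDerivAt_jetArea hp.1 q).div (hz.pow 2) (pow_ne_zero 2 (ne_of_eq_of_ne hz0 h0))
  have h2 := ((hasDerivAt_jetNormal p q 2).div hz (ne_of_eq_of_ne hz0 h0)).const_mul (2 * c₀)
  refine (h1.add h2).congr_deriv ?_
  simp only [zero_smul, add_zero]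
  field_simp
  norm_num
  ring

/-- The flux vectors of the functional `𝒢`. -/
noncomputable def fluxU (c₀ A : ℝ) (X : ℂ → Fin 3 → ℝ) (w : ℂ) : Fin 3 → ℝ :=
  ((X w 2 - A) ^ 2)⁻¹ • (Xv X w ⨯₃ unitNormal X w) + (2 * c₀ / (X w 2 - A)) • (Xv X w ⨯₃ e₃)

/-- The second flux vector of the functional `𝒢`. -/
noncomputable def fluxV (c₀ A : ℝ) (X : ℂ → Fin 3 → ℝ) (w : ℂ) : Fin 3 → ℝ :=
  ((X w 2 - A) ^ 2)⁻¹ • (unitNormal X w ⨯₃ Xu X w) + (2 * c₀ / (X w 2 - A)) • (e₃ ⨯₃ Xu X w)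

/-- The Euler–Lagrange field of `𝒢`. -/
noncomputable def eulerG (c₀ A : ℝ) (X : ℂ → Fin 3 → ℝ) (w : ℂ) : Fin 3 → ℝ :=
  (-(2 * areaDensity X w / (X w 2 - A) ^ 2)
    * (meanCurvature X w + c₀ + unitNormal X w 2 / (X w 2 - A))) • unitNormal X w

section
variable {X : ℂ → Fin 3 → ℝ} {w : ℂ} {c₀ A : ℝ}

theorem Reg.contDiffAt_fluxU (h : Reg X w) (hA : X w 2 ≠ A) : ContDiffAt ℝ 3 (fluxU c₀ A X) w := by
  have h0 := sub_ne_zero.2 hA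
  have hz : ContDiffAt ℝ 3 (fun w => X w 2 - A) w :=
    ((contDiff_apply ℝ ℝ (2 : Fin 3)).contDiffAt.comp w (h.1.of_le (by norm_num))).sub
      contDiffAt_const
  exact (((hz.pow 2).inv (pow_ne_zero 2 h0)).smul
    (contDiffAt_cross (contDiffAt_Xv3 h.1) h.contDiffAt_unitNormal)).add
    ((contDiffAt_const.div hz h0).smul (contDiffAt_cross (contDiffAt_Xv3 h.1) contDiffAt_const))

theorem Reg.contDiffAt_fluxV (h : Reg X w) (hA : X w 2 ≠ A) : ContDiffAt ℝ 3 (fluxV c₀ A X) w := by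
  have h0 := sub_ne_zero.2 hA
  have hz : ContDiffAt ℝ 3 (fun w => X w 2 - A) w :=
    ((contDiff_apply ℝ ℝ (2 : Fin 3)).contDiffAt.comp w (h.1.of_le (by norm_num))).sub
      contDiffAt_const
  exact (((hz.pow 2).inv (pow_ne_zero 2 h0)).smul
    (contDiffAt_cross h.contDiffAt_unitNormal (contDiffAt_Xu3 h.1))).add
    ((contDiffAt_const.div hz h0).smul (contDiffAt_cross contDiffAt_const (contDiffAt_Xu3 h.1)))

/-- Both flux vectors have this shape, with `ζ` the height over the plane `z = A`. -/
theorem fderiv_smul_add_smul {f g : ℂ → Fin 3 → ℝ} {ζ : ℂ → ℝ} (c : ℝ) {e : ℂ}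
    (hf : DifferentiableAt ℝ f w) (hg : DifferentiableAt ℝ g w) (hζ : DifferentiableAt ℝ ζ w)
    (h0 : ζ w ≠ 0) :
    fderiv ℝ (fun w => (ζ w ^ 2)⁻¹ • f w + (c / ζ w) • g w) w e =
      (ζ w ^ 2)⁻¹ • fderiv ℝ f w e - (2 * fderiv ℝ ζ w e / ζ w ^ 3) • f w
        + (c / ζ w) • fderiv ℝ g w e - (c * fderiv ℝ ζ w e / ζ w ^ 2) • g w := by
  have h1 : HasDerivAt (fun t : ℝ => (t ^ 2)⁻¹) (-(2 / ζ w ^ 3)) (ζ w) := by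
    have := ((hasDerivAt_id (ζ w)).pow 2).inv (pow_ne_zero 2 h0)
    refine this.congr_deriv ?_
    simp only [id]; norm_num; field_simp
  have h2 : HasDerivAt (fun t : ℝ => c / t) (-(c / ζ w ^ 2)) (ζ w) := by
    have := (hasDerivAt_const (ζ w) c).div (hasDerivAt_id (ζ w)) h0
    refine this.congr_deriv ?_
    simp only [id]; ring
  have H : HasFDerivAt (fun w => (ζ w ^ 2)⁻¹ • f w + (c / ζ w) • g w) _ w :=
    ((h1.comp_hasFDerivAt w hζ.hasFDerivAt).smul hf.hasFDerivAt).add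
      ((h2.comp_hasFDerivAt w hζ.hasFDerivAt).smul hg.hasFDerivAt)
  rw [H.fderiv]
  ext i
  simp
  ring

/-- The Euler–Lagrange identity for `𝒢`. -/
theorem Reg.div_flux (h : Reg X w) (hA : X w 2 ≠ A) :
    eulerG c₀ A X w = -(fderiv ℝ (fluxU c₀ A X) w 1 + fderiv ℝ (fluxV c₀ A X) w Complex.I)
      - (2 * areaDensity X w / (X w 2 - A) ^ 3
        + 2 * c₀ * (areaDensity X w * unitNormal X w 2) / (X w 2 - A) ^ 2) • e₃ := by
  have h0 := sub_ne_zero.2 hA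
  have hX : DifferentiableAt ℝ X w := h.1.differentiableAt (by norm_num)
  have hz : DifferentiableAt ℝ (fun w => X w 2 - A) w := by fun_prop
  have hz' : ∀ e, fderiv ℝ (fun w => X w 2 - A) w e = fderiv ℝ X w e 2 := by
    intro e
    rw [fderiv_sub_const, fderiv_comp_apply hX]
  have hν := h.differentiableAt_unitNormal
  have hu := h.differentiableAt_Xu
  have hv := h.differentiableAt_Xv
  have hc : DifferentiableAt ℝ (fun _ : ℂ => e₃) w := differentiableAt_const _
  have d1 : DifferentiableAt ℝ (fun w => Xv X w ⨯₃ unitNormal X w) w :=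
    (contDiffAt_cross (contDiffAt_Xv3 h.1) h.contDiffAt_unitNormal).differentiableAt (by norm_num)
  have d2 : DifferentiableAt ℝ (fun w => unitNormal X w ⨯₃ Xu X w) w :=
    (contDiffAt_cross h.contDiffAt_unitNormal (contDiffAt_Xu3 h.1)).differentiableAt (by norm_num)
  have d3 : DifferentiableAt ℝ (fun w => Xv X w ⨯₃ e₃) w :=
    (contDiffAt_cross (contDiffAt_Xv3 h.1) contDiffAt_const).differentiableAt (by norm_num)
  have d4 : DifferentiableAt ℝ (fun w => e₃ ⨯₃ Xu X w) w :=
    (contDiffAt_cross contDiffAt_const (contDiffAt_Xu3 h.1)).differentiableAt (by norm_num)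
  have hU := fderiv_smul_add_smul (2 * c₀) (e := 1) d1 d3 hz h0
  have hV := fderiv_smul_add_smul (2 * c₀) (e := Complex.I) d2 d4 hz h0
  have hlap := h.laplace_identity
  have hg := h.grad_identity
  have hg3 := h.grad_identity_e₃
  -- With `e₃` constant, only mixed second derivatives remain, and they cancel.
  have hcross : fderiv ℝ (fun w => Xv X w ⨯₃ e₃) w 1
      + fderiv ℝ (fun w => e₃ ⨯₃ Xu X w) w Complex.I = 0 := by
    rw [fderiv_cross hv hc, fderiv_cross hc hu]
    simp only [fderiv_fun_const, Pi.zero_apply, _root_.zero_apply, map_zero,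
      LinearMap.zero_apply, add_zero, zero_add]
    change Xu (Xv X) w ⨯₃ e₃ + e₃ ⨯₃ Xv (Xu X) w = 0
    rw [Xu_Xv_comm h.1, cross_anticomm']
  change _ = -(fderiv ℝ (fun w => ((X w 2 - A) ^ 2)⁻¹ • (Xv X w ⨯₃ unitNormal X w)
    + (2 * c₀ / (X w 2 - A)) • (Xv X w ⨯₃ e₃)) w 1
    + fderiv ℝ (fun w => ((X w 2 - A) ^ 2)⁻¹ • (unitNormal X w ⨯₃ Xu X w)
    + (2 * c₀ / (X w 2 - A)) • (e₃ ⨯₃ Xu X w)) w Complex.I) - _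
  rw [hU, hV, hz', hz']
  change _ = -(_ - (2 * Xu X w 2 / _) • _ + _ - (2 * c₀ * Xu X w 2 / _) • _
    + (_ - (2 * Xv X w 2 / _) • _ + _ - (2 * c₀ * Xv X w 2 / _) • _)) - _
  rw [eulerG]
  ext i
  have hlap' := congrFun hlap i
  have hg' := congrFun hg i
  have hg3' := congrFun hg3 i
  have hcross' := congrFun hcross i
  simp only [Pi.add_apply, Pi.sub_apply, Pi.neg_apply, Pi.smul_apply, smul_eq_mul,
    Pi.zero_apply] at hlap' hg' hg3' hcross' ⊢
  set ζ := X w 2 - A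
  clear_value ζ
  -- The Laplacian contributes the term with `H`; the gradient identities evaluate the derivatives
  -- of the weights `ζ⁻²` and `2c₀/ζ`. The vertical parts they produce are exactly those subtracted
  -- in the statement, and a multiple of `ν` is left.
  linear_combination (ζ ^ 2)⁻¹ * hlap' - (2 / ζ ^ 3) * hg' - (2 * c₀ / ζ ^ 2) * hg3'
    + (2 * c₀ / ζ) * hcross'

theorem Reg.mem_regularJetsOff (h : Reg X w) (hA : X w 2 ≠ A) : jet X w ∈ regularJetsOff A :=
  ⟨h.2, hA⟩

/-- The first variation of the Lagrangian of `𝒢`, up to a divergence. -/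
theorem Reg.first_variation_G (h : Reg X w) (hA : X w 2 ≠ A) {V : ℂ → Fin 3 → ℝ}
    (hV : DifferentiableAt ℝ V w) :
    fderiv ℝ (lagrangianG c₀ A) (jet X w) (jet V w) =
      fderiv ℝ (fun w => V w ⬝ᵥ fluxU c₀ A X w) w 1
        + fderiv ℝ (fun w => V w ⬝ᵥ fluxV c₀ A X w) w Complex.I + eulerG c₀ A X w ⬝ᵥ V w := by
  have h0 := sub_ne_zero.2 hA
  rw [fderiv_lagrangianG (h.mem_regularJetsOff hA),
    fderiv_dot hV ((h.contDiffAt_fluxU hA).differentiableAt (by norm_num)),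
    fderiv_dot hV ((h.contDiffAt_fluxV hA).differentiableAt (by norm_num)),
    h.div_flux hA, jetNormalDeriv, ← unitNormal_eq, ← areaDensity_eq, jetNormal_jet, h.cross_eq]
  simp only [jet_zero, jet_one, jet_two]
  change _ = Xu V w ⬝ᵥ _ + _ + (Xv V w ⬝ᵥ _ + _) + _
  simp only [fluxU, fluxV, dot3, Pi.add_apply, Pi.sub_apply, Pi.neg_apply, Pi.smul_apply,
    smul_eq_mul, cross_zero, cross_one, cross_two, e₃_zero, e₃_one, e₃_two]
  field_simp
  ring

end


/-! ### The parameter domain -/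

/-- The open annulus `a < |w| < 1`. -/
def openDom (a : ℝ) : Set ℂ := {w | a < ‖w‖ ∧ ‖w‖ < 1}

theorem isOpen_openDom (a : ℝ) : IsOpen (openDom a) :=
  (isOpen_lt continuous_const continuous_norm).inter (isOpen_lt continuous_norm continuous_const)

theorem openDom_subset_interior (a : ℝ) : openDom a ⊆ interior (dom a) :=
  interior_maximal (fun _ hw => ⟨hw.1.le, hw.2.le⟩) (isOpen_openDom a)

theorem frontier_dom_subset (a : ℝ) :
    frontier (dom a) ⊆ Metric.sphere 0 a ∪ Metric.sphere 0 1 := by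
  intro w hw
  rw [(isCompact_dom a).isClosed.frontier_eq] at hw
  by_contra hcon
  simp only [mem_union, mem_sphere_zero_iff_norm, not_or] at hcon
  exact hw.2 (openDom_subset_interior a ⟨lt_of_le_of_ne hw.1.1 (Ne.symm hcon.1),
    lt_of_le_of_ne hw.1.2 hcon.2⟩)

/-- Every point is approached along its ray from the origin. For `a = 0` the open set is the
punctured disc, so the centre of the disc is reached as well. -/
theorem dom_subset_closure_openDom {a : ℝ} (ha₀ : 0 ≤ a) (ha₁ : a < 1) :
    dom a ⊆ closure (openDom a) := by
  intro w hw
  obtain ⟨u, hu, hwu⟩ : ∃ u : ℂ, ‖u‖ = 1 ∧ w = (‖w‖ : ℂ) * u := by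
    by_cases h0 : w = 0
    · exact ⟨1, by simp, by simp [h0]⟩
    · refine ⟨w / ‖w‖, by simp [h0], ?_⟩
      have : (‖w‖ : ℂ) ≠ 0 := by simpa using h0
      field_simp
  have hc : Continuous fun t : ℝ => (t : ℂ) * u := by fun_prop
  have h1 : ‖w‖ ∈ closure (Ioo a 1) := by rw [closure_Ioo ha₁.ne]; exact hw
  have h2 := image_closure_subset_closure_image hc (mem_image_of_mem _ h1)
  rw [← hwu] at h2
  refine closure_mono ?_ h2
  rintro _ ⟨t, ht, rfl⟩
  have : ‖(t : ℂ) * u‖ = t := by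
    rw [norm_mul, hu, mul_one, Complex.norm_real, Real.norm_of_nonneg (ha₀.trans ht.1.le)]
  exact ⟨by rw [this]; exact ht.1, by rw [this]; exact ht.2⟩

theorem openDom_subset_dom (a : ℝ) : openDom a ⊆ dom a := fun _ hw => ⟨hw.1.le, hw.2.le⟩

/-- Equalities of continuous functions extend to the boundary. -/
theorem eqOn_dom_of_eqOn_openDom {β : Type*} [TopologicalSpace β] [T2Space β] {a : ℝ}
    (ha₀ : 0 ≤ a) (ha₁ : a < 1) {f g : ℂ → β} (hf : ContinuousOn f (dom a))
    (hg : ContinuousOn g (dom a)) (h : EqOn f g (openDom a)) : EqOn f g (dom a) :=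
  h.of_subset_closure hf hg (openDom_subset_dom a) (dom_subset_closure_openDom ha₀ ha₁)

/-! ### Criticality for `𝒢` -/

theorem jet_continuousOn {K : Set ℂ} {X : ℂ → Fin 3 → ℝ} (h : ∀ w ∈ K, ContDiffAt ℝ 4 X w) :
    ContinuousOn (jet X) K := fun w hw => (contDiffAt_jet (h w hw)).continuousAt.continuousWithinAt

section
variable {K : Set ℂ} {X V : ℂ → Fin 3 → ℝ} {c₀ A : ℝ} {c₁ c₂ : ℂ} {r₁ r₂ : ℝ}

theorem continuousOn_eulerG (h : ∀ w ∈ K, Reg X w) (hA : ∀ w ∈ K, X w 2 ≠ A) :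
    ContinuousOn (eulerG c₀ A X) K := by
  intro w hw
  have hX := (h w hw).1.continuousAt
  have hW := (h w hw).contDiffAt_areaDensity.continuousAt
  have hν := (h w hw).contDiffAt_unitNormal.continuousAt
  have hH := (h w hw).contDiffAt_meanCurvature.continuousAt
  have hz : ContinuousAt (fun w => X w 2 - A) w :=
    ((continuous_apply (2 : Fin 3)).continuousAt.comp hX).sub continuousAt_const
  have h0 := sub_ne_zero.2 (hA w hw)
  have hν2 : ContinuousAt (fun w => unitNormal X w 2) w :=
    (continuous_apply (2 : Fin 3)).continuousAt.comp hν
  have key := ((((continuousAt_const (y := (2 : ℝ))).mul hW).div (hz.pow 2)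
    (pow_ne_zero 2 h0)).neg.mul ((hH.add (continuousAt_const (y := c₀))).add
    (hν2.div hz h0))).smul hν
  exact key.continuousWithinAt

/-- The divergence part of the first variation integrates to zero because `V` vanishes on the
frontier. -/
theorem setIntegral_first_variation_G (hK : IsCompact K)
    (hfr : frontier K ⊆ Metric.sphere c₁ r₁ ∪ Metric.sphere c₂ r₂) (h : ∀ w ∈ K, Reg X w)
    (hA : ∀ w ∈ K, X w 2 ≠ A) (hV : ContDiff ℝ 4 V) (hV0 : ∀ w ∈ frontier K, V w = 0) :
    ∫ w in K, fderiv ℝ (lagrangianG c₀ A) (jet X w) (jet V w) =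
      ∫ w in K, eulerG c₀ A X w ⬝ᵥ V w := by
  have hVc : ∀ w, ContDiffAt ℝ 1 V w := fun w => hV.contDiffAt.of_le (by norm_num)
  have hU : ∀ w ∈ K, ContDiffAt ℝ 1 (fun w => V w ⬝ᵥ fluxU c₀ A X w) w := fun w hw =>
    contDiffAt_dot (hVc w) (((h w hw).contDiffAt_fluxU (hA w hw)).of_le (by norm_num))
  have hF : ∀ w ∈ K, ContDiffAt ℝ 1 (fun w => V w ⬝ᵥ fluxV c₀ A X w) w := fun w hw =>
    contDiffAt_dot (hVc w) (((h w hw).contDiffAt_fluxV (hA w hw)).of_le (by norm_num))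
  have hcont : ∀ {g : ℂ → ℝ} (e : ℂ), (∀ w ∈ K, ContDiffAt ℝ 1 g w) →
      IntegrableOn (fun w => fderiv ℝ g w e) K := fun e hg =>
    ContinuousOn.integrableOn_compact hK fun w hw =>
      (((hg w hw).fderiv_right (m := 0) (by norm_num)).continuousAt.clm_apply
        continuousAt_const).continuousWithinAt
  have hE : IntegrableOn (fun w => eulerG c₀ A X w ⬝ᵥ V w) K := by
    refine ContinuousOn.integrableOn_compact hK ?_
    have h1 := continuousOn_eulerG (c₀ := c₀) h hA
    have h2 : ContinuousOn V K := hV.continuous.continuousOn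
    exact fun w hw => ((dotL.continuous.continuousAt.comp_continuousWithinAt (h1 w hw)).clm_apply
      (h2 w hw))
  have hUF : IntegrableOn (fun w => fderiv ℝ (fun w => V w ⬝ᵥ fluxU c₀ A X w) w 1
      + fderiv ℝ (fun w => V w ⬝ᵥ fluxV c₀ A X w) w Complex.I) K :=
    Integrable.add (hcont 1 hU) (hcont Complex.I hF)
  rw [setIntegral_congr_fun hK.measurableSet (fun w hw => (h w hw).first_variation_G (hA w hw)
    ((hVc w).differentiableAt one_ne_zero)),
    integral_add hUF hE,
    integral_add (hcont 1 hU) (hcont Complex.I hF),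
    setIntegral_fderiv_one_eq_zero hK hfr hU (fun w hw => by simp [hV0 w hw]),
    setIntegral_fderiv_I_eq_zero hK hfr hF (fun w hw => by simp [hV0 w hw])]
  simp

end

section
variable {a c₀ : ℝ} {X V : ℂ → Fin 3 → ℝ}

theorem energyG_eq (h : ∀ w ∈ dom a, Reg X w) (h0 : ∀ w ∈ dom a, X w 2 ≠ 0) :
    energyG X a c₀ = ∫ w in dom a, lagrangianG c₀ 0 (jet X w) := by
  have hz : ContinuousOn (fun w => X w 2) (dom a) := fun w hw =>
    ((continuous_apply (2 : Fin 3)).continuousAt.comp (h w hw).1.continuousAt).continuousWithinAt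
  have hW : ContinuousOn (areaDensity X) (dom a) := fun w hw =>
    (h w hw).contDiffAt_areaDensity.continuousAt.continuousWithinAt
  have hν : ContinuousOn (fun w => unitNormal X w 2) (dom a) := fun w hw =>
    ((continuous_apply (2 : Fin 3)).continuousAt.comp
      (h w hw).contDiffAt_unitNormal.continuousAt).continuousWithinAt
  have hi₁ : IntegrableOn (fun w => 1 / (X w 2) ^ 2 * areaDensity X w) (dom a) :=
    ((continuousOn_const.div (hz.pow 2) fun w hw => pow_ne_zero 2 (h0 w hw)).mul
      hW).integrableOn_compact (isCompact_dom a)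
  have hi₂ : IntegrableOn (fun w => unitNormal X w 2 / X w 2 * areaDensity X w) (dom a) :=
    ((hν.div hz h0).mul hW).integrableOn_compact (isCompact_dom a)
  rw [energyG, ← integral_const_mul, ← integral_add hi₁ (hi₂.const_mul _)]
  refine setIntegral_congr_fun (isCompact_dom a).measurableSet fun w hw => ?_
  have hc : jetNormal (jet X w) 2 = areaDensity X w * unitNormal X w 2 := by
    rw [jetNormal_jet, (h w hw).cross_eq]; rfl
  simp only [lagrangianG, hc, ← areaDensity_eq, jet_zero, sub_zero]
  ring

theorem eventually_reg_add_smul {K : Set ℂ} (hK : IsCompact K) {S : Set Jet} (hS : IsOpen S)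
    (h : ∀ w ∈ K, ContDiffAt ℝ 4 X w) (hJ : MapsTo (jet X) K S) (hV : ContDiff ℝ 4 V) :
    ∀ᶠ ε : ℝ in 𝓝 0, ∀ w ∈ K, ContDiffAt ℝ 4 (fun w => X w + ε • V w) w ∧
      jet (fun w => X w + ε • V w) w ∈ S := by
  filter_upwards [eventually_forall_add_smul_mem hK hS (jet_continuousOn h)
    (jet_continuousOn fun w _ => hV.contDiffAt) hJ] with ε hε w hw
  refine ⟨(h w hw).add (hV.const_smul ε).contDiffAt, ?_⟩
  rw [jet_add_smul (h w hw) hV]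
  exact hε w hw

theorem hasDerivAt_energyG (h : ∀ w ∈ dom a, Reg X w) (h0 : ∀ w ∈ dom a, X w 2 ≠ 0)
    (hV : ContDiff ℝ 4 V) (hV0 : ∀ w ∈ frontier (dom a), V w = 0) :
    HasDerivAt (fun ε : ℝ => energyG (fun w => X w + ε • V w) a c₀)
      (∫ w in dom a, eulerG c₀ 0 X w ⬝ᵥ V w) 0 := by
  have hK := isCompact_dom a
  have hX4 : ∀ w ∈ dom a, ContDiffAt ℝ 4 X w := fun w hw => (h w hw).1
  have hS : MapsTo (jet X) (dom a) (regularJetsOff 0) := fun w hw =>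
    (h w hw).mem_regularJetsOff (h0 w hw)
  rw [← setIntegral_first_variation_G hK (frontier_dom_subset a) h h0 hV hV0]
  refine (hasDerivAt_setIntegral_comp_add_smul hK (isOpen_regularJetsOff 0)
    (fun p hp => (contDiffAt_lagrangianG hp).contDiffWithinAt) (jet_continuousOn hX4)
    (jet_continuousOn fun w _ => hV.contDiffAt) hS).congr_of_eventuallyEq ?_
  filter_upwards [eventually_reg_add_smul hK (isOpen_regularJetsOff 0) hX4 hS hV] with ε hε
  rw [energyG_eq (fun w hw => ⟨(hε w hw).1, (hε w hw).2.1⟩) fun w hw => (hε w hw).2.2]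
  refine setIntegral_congr_fun hK.measurableSet fun w hw => ?_
  simp only [jet_add_smul (hX4 w hw) hV]

theorem eulerG_eq_zero_iff {A : ℝ} {w : ℂ} (h : Reg X w) (hA : X w 2 ≠ A) :
    eulerG c₀ A X w = 0 ↔ meanCurvature X w + c₀ = -(unitNormal X w 2 / (X w 2 - A)) := by
  have h0 := sub_ne_zero.2 hA
  have hν : unitNormal X w ≠ 0 := fun hν => by
    have := h.unitNormal_dot_self
    simp [hν] at this
  have hc : -(2 * areaDensity X w / (X w 2 - A) ^ 2) ≠ 0 :=
    neg_ne_zero.2 (div_ne_zero (mul_ne_zero two_ne_zero h.areaDensity_pos.ne') (pow_ne_zero 2 h0))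
  rw [eulerG, smul_eq_zero, or_iff_left hν, mul_eq_zero, or_iff_right hc]
  exact ⟨fun h => by linarith, fun h => by linarith⟩

/-- The Euler–Lagrange field is a nowhere vanishing multiple of `ν` times the defect of the reduced
equation, so the two vanish together. -/
theorem gCritical_iff (ha₀ : 0 ≤ a) (ha₁ : a < 1) (h : ∀ w ∈ dom a, Reg X w)
    (h0 : ∀ w ∈ dom a, X w 2 ≠ 0) :
    GCritical X a c₀ ↔
      ∀ w ∈ dom a, meanCurvature X w + c₀ = -(unitNormal X w 2 / X w 2) := by
  have hiff : ∀ w ∈ dom a, eulerG c₀ 0 X w = 0 ↔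
      meanCurvature X w + c₀ = -(unitNormal X w 2 / X w 2) := fun w hw => by
    rw [eulerG_eq_zero_iff (h w hw) (h0 w hw), sub_zero]
  constructor
  · intro hcrit
    have hcont : ContinuousOn (eulerG c₀ 0 X) (dom a) := continuousOn_eulerG h h0
    -- Test fields supported in the open annulus are enough, since continuity carries the equation
    -- to the rest of the domain.
    have hint : ∀ w ∈ openDom a, eulerG c₀ 0 X w = 0 := by
      refine eq_zero_of_forall_setIntegral_dotProduct_eq_zero (isOpen_openDom a)
        (openDom_subset_dom a) (isCompact_dom a).measurableSet
        (hcont.mono (openDom_subset_dom a)) fun V hV _ hVs => ?_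
      have hV4 : ContDiff ℝ 4 V := hV.of_le (WithTop.coe_le_coe.2 (le_top : (4 : ℕ∞) ≤ ⊤))
      have hV0 : ∀ w ∈ frontier (dom a), V w = 0 := fun w hw =>
        image_eq_zero_of_notMem_tsupport fun hmem =>
          hw.2 (openDom_subset_interior a (hVs hmem))
      exact (hasDerivAt_energyG h h0 hV4 hV0).unique (hcrit V hV4 hV0)
    intro w hw
    exact (hiff w hw).1 (eqOn_dom_of_eqOn_openDom ha₀ ha₁ hcont continuousOn_const hint hw)
  · intro hred V hV hV0
    have := hasDerivAt_energyG (c₀ := c₀) h h0 hV hV0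
    rwa [setIntegral_congr_fun (g := fun _ => 0) (isCompact_dom a).measurableSet
      (fun w hw => by simp [(hiff w hw).2 (hred w hw)]), integral_zero] at this

/-- The functional `𝒢` as hyperbolic area plus weighted hyperbolic volume. -/
theorem energyG_eq_hyperbolic (h : ∀ w ∈ dom a, Reg X w) (h0 : ∀ w ∈ dom a, 0 < X w 2) :
    energyG X a c₀ = hyperbolicArea X a - 2 * c₀ * weightedHyperbolicVolume X a := by
  have hm := (isCompact_dom a).measurableSet
  have h1 : ∫ w in dom a, 1 / (X w 2) ^ 2 * areaDensity X w = hyperbolicArea X a := by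
    refine setIntegral_congr_fun hm fun w hw => ?_
    have hz := h0 w hw
    have hE : Xu X w ⬝ᵥ Xu X w / X w 2 ^ 2 * (Xv X w ⬝ᵥ Xv X w / X w 2 ^ 2) -
        (Xu X w ⬝ᵥ Xv X w / X w 2 ^ 2) ^ 2 = (1 / (X w 2) ^ 2 * areaDensity X w) ^ 2 := by
      rw [mul_pow, areaDensity_sq, ← jetNormal_jet, jetNormal_dot_self, jet_one, jet_two]
      field_simp
    simp only [hE]
    rw [Real.sqrt_sq]
    exact mul_nonneg (by positivity) (h w hw).areaDensity_pos.le
  have h2 : ∫ w in dom a, unitNormal X w 2 / X w 2 * areaDensity X w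
      = -weightedHyperbolicVolume X a := by
    rw [weightedHyperbolicVolume, ← integral_neg]
    refine setIntegral_congr_fun hm fun w hw => ?_
    have hz := h0 w hw
    have hN : (Xu X w ⨯₃ Xv X w) ⬝ᵥ ![0, 0, 1] = areaDensity X w * unitNormal X w 2 := by
      rw [(h w hw).cross_eq, dot3]; simp
    -- The integrand is `(z + t)⁻²`, with primitive `-(z + t)⁻¹`.
    have hint : ∫ t in Ioi (0 : ℝ), (X w 2 + t) * (1 / (X w 2 + t) ^ 3) = 1 / X w 2 := by
      have hd : ∀ t ∈ Ici (0 : ℝ), HasDerivAt (fun t => -(X w 2 + t)⁻¹)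
          ((X w 2 + t) * (1 / (X w 2 + t) ^ 3)) t := fun t ht => by
        have ht' : X w 2 + t ≠ 0 := (add_pos_of_pos_of_nonneg hz ht).ne'
        refine (((hasDerivAt_id t).const_add (X w 2)).inv ht').neg.congr_deriv ?_
        simp only [id]; field_simp
      have hlim : Tendsto (fun t => -(X w 2 + t)⁻¹) atTop (𝓝 0) := by
        simpa using (tendsto_inv_atTop_zero.comp
          (tendsto_atTop_add_const_left atTop (X w 2) tendsto_id)).neg
      rw [integral_Ioi_of_hasDerivAt_of_nonneg' hd (fun t ht => ?_) hlim]
      · simp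
      · have : 0 < X w 2 + t := add_pos hz ht
        positivity
    simp only [integral_mul_const, hint, hN]
    ring
  rw [energyG, h1, h2]
  ring

end


/-! ### The Euler–Lagrange field of the Helfrich energy -/

/-- The Lagrangian of the Helfrich energy. -/
noncomputable def lagrangianH (c₀ : ℝ) (p : Jet) : ℝ := (jetMean p + c₀) ^ 2 * jetArea p

theorem contDiffAt_lagrangianH {n : WithTop ℕ∞} {c₀ : ℝ} {p : Jet} (hp : p ∈ regularJets) :
    ContDiffAt ℝ n (lagrangianH c₀) p :=
  (((contDiffAt_jetMean hp).add contDiffAt_const).pow 2).mul (contDiffAt_jetArea hp)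

section
variable {a c₀ : ℝ} {X V : ℂ → Fin 3 → ℝ}

theorem hasDerivAt_helfrich (h : ∀ w ∈ dom a, Reg X w) (hV : ContDiff ℝ 4 V) :
    HasDerivAt (fun ε : ℝ => helfrich (fun w => X w + ε • V w) a c₀)
      (∫ w in dom a, fderiv ℝ (lagrangianH c₀) (jet X w) (jet V w)) 0 := by
  have hX4 : ∀ w ∈ dom a, ContDiffAt ℝ 4 X w := fun w hw => (h w hw).1
  refine (hasDerivAt_setIntegral_comp_add_smul (isCompact_dom a) isOpen_regularJets
    (fun p hp => (contDiffAt_lagrangianH hp).contDiffWithinAt) (jet_continuousOn hX4)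
    (jet_continuousOn fun w _ => hV.contDiffAt) fun w hw => (h w hw).2).congr_of_eventuallyEq ?_
  refine .of_forall fun ε => ?_
  refine setIntegral_congr_fun (isCompact_dom a).measurableSet fun w hw => ?_
  simp only [meanCurvature_eq, areaDensity_eq, jet_add_smul (hX4 w hw) hV, lagrangianH]

theorem integrableOn_mul_of_continuousOn {K : Set ℂ} (hK : IsCompact K) {f g : ℂ → ℝ}
    (hf : ContinuousOn f K) (hg : ContinuousOn g K) : IntegrableOn (fun w => f w * g w) K :=
  (hf.mul hg).integrableOn_compact hK

theorem continuousAt_fderiv_apply {f : ℂ → ℝ} {w : ℂ} (hf : ContDiffAt ℝ 1 f w) (e : ℂ) :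
    ContinuousAt (fun w => fderiv ℝ f w e) w :=
  (hf.fderiv_right (m := 0) (by norm_num)).continuousAt.clm_apply continuousAt_const

/-- The product `Pφ` vanishes on the frontier, so the integral of its derivative is zero. -/
theorem setIntegral_mul_fderiv {P φ : ℂ → ℝ} (hP : ∀ w ∈ dom a, ContDiffAt ℝ 1 P w)
    (hφ : ContDiff ℝ 1 φ) (hs : tsupport φ ⊆ interior (dom a)) {e : ℂ}
    (he : e = 1 ∨ e = Complex.I) :
    ∫ w in dom a, P w * fderiv ℝ φ w e = ∫ w in dom a, -fderiv ℝ P w e * φ w := by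
  have hK := isCompact_dom a
  have hPφ : ∀ w ∈ dom a, ContDiffAt ℝ 1 (fun w => P w * φ w) w := fun w hw =>
    (hP w hw).mul hφ.contDiffAt
  have h0 : ∀ w ∈ frontier (dom a), P w * φ w = 0 := fun w hw => by
    rw [image_eq_zero_of_notMem_tsupport (f := φ) fun hmem => hw.2 (hs hmem), mul_zero]
  have hz : ∫ w in dom a, fderiv ℝ (fun w => P w * φ w) w e = 0 := by
    rcases he with rfl | rfl
    · exact setIntegral_fderiv_one_eq_zero hK (frontier_dom_subset a) hPφ h0
    · exact setIntegral_fderiv_I_eq_zero hK (frontier_dom_subset a) hPφ h0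
  have hd : ∀ w ∈ dom a, fderiv ℝ (fun w => P w * φ w) w e =
      P w * fderiv ℝ φ w e - -fderiv ℝ P w e * φ w := fun w hw => by
    rw [fderiv_fun_mul ((hP w hw).differentiableAt one_ne_zero)
      (hφ.contDiffAt.differentiableAt one_ne_zero)]
    simp [mul_comm]
  rw [setIntegral_congr_fun hK.measurableSet hd, integral_sub, sub_eq_zero] at hz
  · exact hz
  · exact integrableOn_mul_of_continuousOn hK
      (fun w hw => (hP w hw).continuousAt.continuousWithinAt)
      (fun w _ => (continuousAt_fderiv_apply hφ.contDiffAt e).continuousWithinAt)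
  · exact integrableOn_mul_of_continuousOn hK
      (fun w hw => (continuousAt_fderiv_apply (hP w hw) e).neg.continuousWithinAt)
      hφ.continuous.continuousOn

theorem contDiffAt_fderiv_apply {φ : ℂ → ℝ} {n m : WithTop ℕ∞} {w : ℂ} (h : ContDiffAt ℝ n φ w)
    (hmn : m + 1 ≤ n) (e : ℂ) : ContDiffAt ℝ m (fun w => fderiv ℝ φ w e) w :=
  (h.fderiv_right hmn).clm_apply contDiffAt_const

theorem setIntegral_mul_fderiv_fderiv {P φ : ℂ → ℝ} (hP : ∀ w ∈ dom a, ContDiffAt ℝ 2 P w)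
    (hφ : ContDiff ℝ 2 φ) (hs : tsupport φ ⊆ interior (dom a)) {e e' : ℂ}
    (he : e = 1 ∨ e = Complex.I) (he' : e' = 1 ∨ e' = Complex.I) :
    ∫ w in dom a, P w * fderiv ℝ (fun w => fderiv ℝ φ w e) w e' =
      ∫ w in dom a, fderiv ℝ (fun w => fderiv ℝ P w e') w e * φ w := by
  have h12 : (1 : WithTop ℕ∞) + 1 ≤ 2 := by norm_num
  have h1 : ∀ w ∈ dom a, ContDiffAt ℝ 1 (fun w => -fderiv ℝ P w e') w := fun w hw =>
    (contDiffAt_fderiv_apply (hP w hw) h12 e').neg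
  rw [setIntegral_mul_fderiv (fun w hw => (hP w hw).of_le (by norm_num))
    (contDiff_iff_contDiffAt.2 fun w => contDiffAt_fderiv_apply hφ.contDiffAt h12 e)
    ((tsupport_fderiv_apply_subset ℝ e).trans hs) he',
    setIntegral_mul_fderiv h1 (hφ.of_le (by norm_num)) hs he]
  refine setIntegral_congr_fun (isCompact_dom a).measurableSet fun w hw => ?_
  simp only [fderiv_fun_neg, _root_.neg_apply, neg_neg]

/-- Integration by parts, for each component of the jet of a test field. -/
theorem exists_setIntegral_mul_jet {P : ℂ → ℝ} (hP : ∀ w ∈ dom a, ContDiffAt ℝ 2 P w) (α : Fin 6)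
    (i : Fin 3) : ∃ Q : ℂ → ℝ, ContinuousOn Q (dom a) ∧ ∀ V : ℂ → Fin 3 → ℝ, ContDiff ℝ 4 V →
      tsupport V ⊆ interior (dom a) →
      ∫ w in dom a, P w * jet V w α i = ∫ w in dom a, Q w * V w i := by
  have h12 : (1 : WithTop ℕ∞) + 1 ≤ 2 := by norm_num
  have hP1 : ∀ w ∈ dom a, ContDiffAt ℝ 1 P w := fun w hw => (hP w hw).of_le (by norm_num)
  have hts : ∀ V : ℂ → Fin 3 → ℝ, tsupport (fun w => V w i) ⊆ tsupport V := fun V =>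
    closure_mono fun w hw h0 => hw (by simp [h0])
  have hVi : ∀ V : ℂ → Fin 3 → ℝ, ContDiff ℝ 4 V → ContDiff ℝ 4 (fun w => V w i) := fun V hV =>
    (contDiff_apply ℝ ℝ i).comp hV
  have hD1 : ∀ V : ℂ → Fin 3 → ℝ, ContDiff ℝ 4 V → ∀ (w e : ℂ),
      fderiv ℝ V w e i = fderiv ℝ (fun w => V w i) w e := fun V hV w e =>
    (fderiv_comp_apply (hV.contDiffAt.differentiableAt (by norm_num)) e i).symm
  have hD2 : ∀ V : ℂ → Fin 3 → ℝ, ContDiff ℝ 4 V → ∀ (w e e' : ℂ),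
      fderiv ℝ (fun w => fderiv ℝ V w e) w e' i
        = fderiv ℝ (fun w => fderiv ℝ (fun w => V w i) w e) w e' := fun V hV w e e' => by
    have hd : ContDiffAt ℝ 3 (fun w => fderiv ℝ V w e) w :=
      (hV.contDiffAt.fderiv_right (by norm_num)).clm_apply contDiffAt_const
    rw [← fderiv_comp_apply (hd.differentiableAt (by norm_num)) e' i]
    congr 2
    funext v
    exact hD1 V hV v e
  have first : ∀ e : ℂ, e = 1 ∨ e = Complex.I → ∃ Q : ℂ → ℝ, ContinuousOn Q (dom a) ∧
      ∀ V : ℂ → Fin 3 → ℝ, ContDiff ℝ 4 V → tsupport V ⊆ interior (dom a) →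
      ∫ w in dom a, P w * fderiv ℝ V w e i = ∫ w in dom a, Q w * V w i := fun e he => by
    refine ⟨fun w => -fderiv ℝ P w e, fun w hw =>
      (continuousAt_fderiv_apply (hP1 w hw) e).neg.continuousWithinAt, fun V hV hs => ?_⟩
    simp only [hD1 V hV]
    exact setIntegral_mul_fderiv hP1 ((hVi V hV).of_le (by norm_num)) ((hts V).trans hs) he
  have second : ∀ e e' : ℂ, e = 1 ∨ e = Complex.I → e' = 1 ∨ e' = Complex.I →
      ∃ Q : ℂ → ℝ, ContinuousOn Q (dom a) ∧
      ∀ V : ℂ → Fin 3 → ℝ, ContDiff ℝ 4 V → tsupport V ⊆ interior (dom a) →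
      ∫ w in dom a, P w * fderiv ℝ (fun w => fderiv ℝ V w e) w e' i
        = ∫ w in dom a, Q w * V w i := fun e e' he he' => by
    refine ⟨fun w => fderiv ℝ (fun w => fderiv ℝ P w e') w e, fun w hw =>
      (continuousAt_fderiv_apply (contDiffAt_fderiv_apply (hP w hw) h12 e')
        e).continuousWithinAt, fun V hV hs => ?_⟩
    simp only [hD2 V hV]
    exact setIntegral_mul_fderiv_fderiv hP ((hVi V hV).of_le (by norm_num))
      ((hts V).trans hs) he he'
  fin_cases α
  · exact ⟨P, fun w hw => (hP w hw).continuousAt.continuousWithinAt, fun V _ _ => rfl⟩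
  · exact first 1 (.inl rfl)
  · exact first Complex.I (.inr rfl)
  · exact second 1 1 (.inl rfl) (.inl rfl)
  · exact second 1 Complex.I (.inl rfl) (.inr rfl)
  · exact second Complex.I Complex.I (.inr rfl) (.inr rfl)

theorem clm_jet_eq_sum (L : Jet →L[ℝ] ℝ) (p : Jet) :
    L p = ∑ α, ∑ i, L (Pi.single α (Pi.single i 1)) * p α i := by
  conv_lhs => rw [← Finset.univ_sum_single p, map_sum]
  refine Finset.sum_congr rfl fun α _ => ?_
  have h1 : ∀ v : Fin 3 → ℝ, L (Pi.single α v)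
      = L.comp (ContinuousLinearMap.single ℝ (fun _ : Fin 6 => Fin 3 → ℝ) α) v := fun v => rfl
  rw [h1]
  conv_lhs => rw [← Finset.univ_sum_single (p α), map_sum]
  refine Finset.sum_congr rfl fun i _ => ?_
  have h2 : (Pi.single i (p α i) : Fin 3 → ℝ) = p α i • Pi.single i 1 := by
    rw [← Pi.single_smul, smul_eq_mul, mul_one]
  rw [h2, map_smul, smul_eq_mul, mul_comm, h1]

/-- The first variation of the Helfrich energy is represented by a continuous field. -/
theorem exists_eulerH (c₀ : ℝ) (h : ∀ w ∈ dom a, Reg X w) :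
    ∃ G : ℂ → Fin 3 → ℝ, ContinuousOn G (dom a) ∧ ∀ V : ℂ → Fin 3 → ℝ, ContDiff ℝ 4 V →
      tsupport V ⊆ interior (dom a) →
      ∫ w in dom a, fderiv ℝ (lagrangianH c₀) (jet X w) (jet V w)
        = ∫ w in dom a, G w ⬝ᵥ V w := by
  have hK := isCompact_dom a
  -- The coefficients of the linearized Lagrangian are `C²`, just enough for two integrations by
  -- parts. Only the continuity of the resulting field is needed later, so it is never made
  -- explicit.
  set P : Fin 6 → Fin 3 → ℂ → ℝ := fun α i w =>
    fderiv ℝ (lagrangianH c₀) (jet X w) (Pi.single α (Pi.single i 1)) with hPdef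
  have hP : ∀ α i, ∀ w ∈ dom a, ContDiffAt ℝ 2 (P α i) w := fun α i w hw =>
    ContDiffAt.clm_apply (ContDiffAt.comp w (g := fderiv ℝ (lagrangianH c₀))
      ((contDiffAt_lagrangianH (n := 3) (h w hw).2).fderiv_right (by norm_num))
      (contDiffAt_jet (h w hw).1)) contDiffAt_const
  choose Q hQ hQint using fun α i => exists_setIntegral_mul_jet (hP α i) α i
  refine ⟨fun w i => ∑ α, Q α i w, ?_, fun V hV hs => ?_⟩
  · exact continuousOn_pi.2 fun i => continuousOn_finsetSum _ fun α _ => hQ α i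
  · have hVc : ∀ i, ContinuousOn (fun w => V w i) (dom a) := fun i =>
      ((continuous_apply i).comp hV.continuous).continuousOn
    have hjc : ∀ α i, ContinuousOn (fun w => jet V w α i) (dom a) := fun α i =>
      (continuous_apply_apply (ρ := fun _ _ => ℝ) α i).comp_continuousOn (f := jet V)
        (jet_continuousOn fun w _ => hV.contDiffAt)
    have hi₁ : ∀ α i, IntegrableOn (fun w => P α i w * jet V w α i) (dom a) := fun α i =>
      integrableOn_mul_of_continuousOn hK
        (fun w hw => (hP α i w hw).continuousAt.continuousWithinAt) (hjc α i)
    have hi₂ : ∀ α i, IntegrableOn (fun w => Q α i w * V w i) (dom a) := fun α i =>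
      integrableOn_mul_of_continuousOn hK (hQ α i) (hVc i)
    have e1 : ∀ w, fderiv ℝ (lagrangianH c₀) (jet X w) (jet V w)
        = ∑ α, ∑ i, P α i w * jet V w α i := fun w => clm_jet_eq_sum _ _
    have e2 : ∀ w, (fun i => ∑ α, Q α i w) ⬝ᵥ V w = ∑ α, ∑ i, Q α i w * V w i := fun w => by
      rw [dotProduct, Finset.sum_comm]
      exact Finset.sum_congr rfl fun i _ => Finset.sum_mul _ _ _
    simp only [e1, e2]
    rw [integral_finsetSum _ fun α _ => integrable_finsetSum _ fun i _ => hi₁ α i,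
      integral_finsetSum _ fun α _ => integrable_finsetSum _ fun i _ => hi₂ α i]
    refine Finset.sum_congr rfl fun α _ => ?_
    rw [integral_finsetSum _ fun i _ => hi₁ α i, integral_finsetSum _ fun i _ => hi₂ α i]
    exact Finset.sum_congr rfl fun i _ => hQint α i V hV hs

end

/-! ### The reduced equation implies criticality for the Helfrich energy -/

/-- The square of the reduced equation, as a Lagrangian. -/
noncomputable def lagrangianSq (c₀ A : ℝ) (p : Jet) : ℝ :=
  (jetMean p + c₀ + jetUnit p 2 / (p 0 2 - A)) ^ 2 * jetArea p

/-- The Lagrangian `div(∇z / (z - A))`. -/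
noncomputable def lagrangianDiv (A : ℝ) (p : Jet) : ℝ :=
  (2 * jetMean p * jetUnit p 2 / (p 0 2 - A) - (1 - jetUnit p 2 ^ 2) / (p 0 2 - A) ^ 2) * jetArea p

section
variable {c₀ A : ℝ} {p : Jet}

/-- Completing the square in `H + c₀ + ν₃/ζ`: of the cross term `2(H + c₀)ν₃/ζ`, the part with `c₀`
belongs to `𝒢` and the part with `H` to `div(∇z/ζ)`. The remaining terms in `ζ⁻²` cancel. -/
theorem lagrangianH_eq (hp : p ∈ regularJetsOff A) :
    lagrangianH c₀ p = lagrangianSq c₀ A p - lagrangianG c₀ A p - lagrangianDiv A p := by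
  have h0 : p 0 2 - A ≠ 0 := sub_ne_zero.2 hp.2
  have hN : jetNormal p 2 = jetArea p * jetUnit p 2 := by rw [jetNormal_eq_smul hp.1]; rfl
  rw [lagrangianH, lagrangianSq, lagrangianG, lagrangianDiv, hN]
  field_simp
  ring

theorem contDiffAt_jetUnit_two {n : WithTop ℕ∞} (hp : p ∈ regularJets) :
    ContDiffAt ℝ n (fun p => jetUnit p 2) p :=
  (contDiff_apply ℝ ℝ (2 : Fin 3)).contDiffAt.comp p (contDiffAt_jetUnit hp)

theorem contDiffAt_reducedJet {n : WithTop ℕ∞} (hp : p ∈ regularJetsOff A) :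
    ContDiffAt ℝ n (fun p => jetMean p + c₀ + jetUnit p 2 / (p 0 2 - A)) p :=
  ((contDiffAt_jetMean hp.1).add contDiffAt_const).add
    ((contDiffAt_jetUnit_two hp.1).div (contDiffAt_height A) (sub_ne_zero.2 hp.2))

theorem contDiffAt_lagrangianSq {n : WithTop ℕ∞} (hp : p ∈ regularJetsOff A) :
    ContDiffAt ℝ n (lagrangianSq c₀ A) p :=
  ((contDiffAt_reducedJet hp).pow 2).mul (contDiffAt_jetArea hp.1)

theorem contDiffAt_lagrangianDiv {n : WithTop ℕ∞} (hp : p ∈ regularJetsOff A) :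
    ContDiffAt ℝ n (lagrangianDiv A) p := by
  have h0 : p 0 2 - A ≠ 0 := sub_ne_zero.2 hp.2
  have hu := contDiffAt_jetUnit_two (n := n) hp.1
  have hz := contDiffAt_height (n := n) (p := p) A
  exact ((((contDiffAt_const.mul (contDiffAt_jetMean hp.1)).mul hu).div hz h0).sub
    ((contDiffAt_const.sub (hu.pow 2)).div (hz.pow 2) (pow_ne_zero 2 h0))).mul
    (contDiffAt_jetArea hp.1)

/-- A square has zero derivative where its base vanishes, and here the base is the defect of the
reduced equation. -/
theorem fderiv_lagrangianSq_eq_zero (hp : p ∈ regularJetsOff A)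
    (h : jetMean p + c₀ + jetUnit p 2 / (p 0 2 - A) = 0) (q : Jet) :
    fderiv ℝ (lagrangianSq c₀ A) p q = 0 := by
  have h1 : HasFDerivAt (lagrangianSq c₀ A) _ p :=
    ((((contDiffAt_reducedJet (n := 1) (c₀ := c₀) hp).differentiableAt
      one_ne_zero).hasFDerivAt).pow 2).mul
      ((contDiffAt_jetArea (n := 1) hp.1).differentiableAt one_ne_zero).hasFDerivAt
  rw [h1.fderiv]
  simp [h]

theorem fderiv_lagrangianH_eq (hp : p ∈ regularJetsOff A)
    (h : jetMean p + c₀ + jetUnit p 2 / (p 0 2 - A) = 0) (q : Jet) :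
    fderiv ℝ (lagrangianH c₀) p q
      = -fderiv ℝ (lagrangianG c₀ A) p q - fderiv ℝ (lagrangianDiv A) p q := by
  have he : lagrangianH c₀ =ᶠ[𝓝 p] fun p =>
      lagrangianSq c₀ A p - lagrangianG c₀ A p - lagrangianDiv A p := by
    filter_upwards [(isOpen_regularJetsOff A).mem_nhds hp] with v hv using lagrangianH_eq hv
  have hs := ((contDiffAt_lagrangianSq (n := 1) (c₀ := c₀) hp).differentiableAt
    one_ne_zero).hasFDerivAt
  have hg := ((contDiffAt_lagrangianG (n := 1) (c₀ := c₀) hp).differentiableAt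
    one_ne_zero).hasFDerivAt
  have hd := ((contDiffAt_lagrangianDiv (n := 1) hp).differentiableAt one_ne_zero).hasFDerivAt
  have H : HasFDerivAt (fun p => lagrangianSq c₀ A p - lagrangianG c₀ A p - lagrangianDiv A p)
    _ p := (hs.sub hg).sub hd
  rw [he.fderiv_eq, H.fderiv]
  simp [fderiv_lagrangianSq_eq_zero hp h]

end

section
variable {X V : ℂ → Fin 3 → ℝ} {w : ℂ} {c₀ A : ℝ}

/-- The first component of `∇z / (z - A)`, times the area density. -/
noncomputable def gradU (A : ℝ) (X : ℂ → Fin 3 → ℝ) (w : ℂ) : ℝ :=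
  (X w 2 - A)⁻¹ * (Xv X w ⨯₃ unitNormal X w) 2

/-- The second component of `∇z / (z - A)`, times the area density. -/
noncomputable def gradV (A : ℝ) (X : ℂ → Fin 3 → ℝ) (w : ℂ) : ℝ :=
  (X w 2 - A)⁻¹ * (unitNormal X w ⨯₃ Xu X w) 2

theorem Reg.contDiffAt_inv_height (h : Reg X w) (hA : X w 2 ≠ A) :
    ContDiffAt ℝ 3 (fun w => (X w 2 - A)⁻¹) w :=
  (((contDiff_apply ℝ ℝ (2 : Fin 3)).contDiffAt.comp w (h.1.of_le (by norm_num))).sub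
    contDiffAt_const).inv (sub_ne_zero.2 hA)

theorem contDiffAt_comp_two {f : ℂ → Fin 3 → ℝ} {n : WithTop ℕ∞} (hf : ContDiffAt ℝ n f w) :
    ContDiffAt ℝ n (fun w => f w 2) w :=
  (contDiff_apply ℝ ℝ (2 : Fin 3)).contDiffAt.comp w hf

theorem Reg.contDiffAt_gradU (h : Reg X w) (hA : X w 2 ≠ A) : ContDiffAt ℝ 3 (gradU A X) w :=
  (h.contDiffAt_inv_height hA).mul
    (contDiffAt_comp_two (contDiffAt_cross (contDiffAt_Xv3 h.1) h.contDiffAt_unitNormal))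

theorem Reg.contDiffAt_gradV (h : Reg X w) (hA : X w 2 ≠ A) : ContDiffAt ℝ 3 (gradV A X) w :=
  (h.contDiffAt_inv_height hA).mul
    (contDiffAt_comp_two (contDiffAt_cross h.contDiffAt_unitNormal (contDiffAt_Xu3 h.1)))

/-- This is `div(∇z/ζ) = Δz/ζ - |∇z|²/ζ²` with `Δz = 2Hν₃` and `|∇z|² = 1 - ν₃²`. -/
theorem Reg.div_grad (h : Reg X w) (hA : X w 2 ≠ A) :
    lagrangianDiv A (jet X w)
      = fderiv ℝ (gradU A X) w 1 + fderiv ℝ (gradV A X) w Complex.I := by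
  have h0 := sub_ne_zero.2 hA
  have d1 := (contDiffAt_cross (contDiffAt_Xv3 h.1) h.contDiffAt_unitNormal).differentiableAt
    (by norm_num)
  have d2 := (contDiffAt_cross h.contDiffAt_unitNormal (contDiffAt_Xu3 h.1)).differentiableAt
    (by norm_num)
  have hX : DifferentiableAt ℝ X w := h.1.differentiableAt (by norm_num)
  have hz : HasFDerivAt (fun w => X w 2 - A) (fderiv ℝ (fun w => X w 2) w) w :=
    (differentiableAt_pi.1 hX 2).hasFDerivAt.sub_const A
  have hinv : ∀ e, fderiv ℝ (fun w => (X w 2 - A)⁻¹) w e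
      = -(fderiv ℝ X w e 2) / (X w 2 - A) ^ 2 := by
    intro e
    have := (hasDerivAt_inv h0).comp_hasFDerivAt w hz
    have h2 : HasFDerivAt (fun w => (X w 2 - A)⁻¹) _ w := this
    rw [h2.fderiv, ← fderiv_comp_apply hX]
    simp
    ring
  have hi := (h.contDiffAt_inv_height hA).differentiableAt (by norm_num)
  have e1 : fderiv ℝ (gradU A X) w 1 = _ := congrArg (fun L => L 1)
    (fderiv_fun_mul hi (differentiableAt_pi.1 d1 2))
  have e2 : fderiv ℝ (gradV A X) w Complex.I = _ := congrArg (fun L => L Complex.I)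
    (fderiv_fun_mul hi (differentiableAt_pi.1 d2 2))
  simp only [_root_.add_apply, _root_.smul_apply, smul_eq_mul,
    hinv, fderiv_comp_apply d1, fderiv_comp_apply d2] at e1 e2
  rw [e1, e2]
  have hlap := congrFun h.laplace_identity 2
  have hg := congrFun h.grad_identity 2
  simp only [Pi.add_apply, Pi.sub_apply, Pi.smul_apply, smul_eq_mul, e₃_two] at hlap hg
  change Xu X w 2 * _ + Xv X w 2 * _ = _ at hg
  rw [show fderiv ℝ X w 1 2 = Xu X w 2 from rfl, show fderiv ℝ X w Complex.I 2 = Xv X w 2 from rfl,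
    lagrangianDiv, ← meanCurvature_eq, ← unitNormal_eq, ← areaDensity_eq, jet_zero]
  set ζ := X w 2 - A
  clear_value ζ
  linear_combination (-ζ⁻¹) * hlap + (ζ ^ 2)⁻¹ * hg

/-- A null Lagrangian does not contribute to the first variation. -/
theorem setIntegral_fderiv_lagrangianDiv_eq_zero {z : ℂ} {δ : ℝ}
    (h : ∀ w ∈ Metric.closedBall z δ, Reg X w) (hA : ∀ w ∈ Metric.closedBall z δ, X w 2 ≠ A)
    (hV : ContDiff ℝ 4 V) (hs : tsupport V ⊆ Metric.ball z δ) :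
    ∫ w in Metric.closedBall z δ, fderiv ℝ (lagrangianDiv A) (jet X w) (jet V w) = 0 := by
  set K := Metric.closedBall z δ with hKdef
  have hK : IsCompact K := isCompact_closedBall z δ
  have hfr : frontier K ⊆ Metric.sphere z δ ∪ Metric.sphere z δ := by
    rw [union_self]; exact Metric.frontier_closedBall_subset_sphere
  have hX4 : ∀ w ∈ K, ContDiffAt ℝ 4 X w := fun w hw => (h w hw).1
  have hS : MapsTo (jet X) K (regularJetsOff A) := fun w hw => (h w hw).mem_regularJetsOff (hA w hw)
  have hd := hasDerivAt_setIntegral_comp_add_smul hK (isOpen_regularJetsOff A)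
    (fun p hp => (contDiffAt_lagrangianDiv hp).contDiffWithinAt) (jet_continuousOn hX4)
    (jet_continuousOn fun w _ => hV.contDiffAt) hS
  refine hd.unique ((hasDerivAt_const (0 : ℝ)
    (∫ w in K, lagrangianDiv A (jet X w))).congr_of_eventuallyEq ?_)
  filter_upwards [eventually_reg_add_smul hK (isOpen_regularJetsOff A) hX4 hS hV] with ε hε
  set Y : ℂ → Fin 3 → ℝ := fun w => X w + ε • V w with hY
  have hYr : ∀ w ∈ K, Reg Y w := fun w hw => ⟨(hε w hw).1, (hε w hw).2.1⟩
  have hYA : ∀ w ∈ K, Y w 2 ≠ A := fun w hw => (hε w hw).2.2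
  -- The variation vanishes near each boundary point, so the first-order data that determine the
  -- boundary flux are unchanged and the integral of the divergence does not depend on `ε`.
  have hYX : ∀ w ∈ frontier K, Y =ᶠ[𝓝 w] X := fun w hw => by
    have hw' : w ∉ tsupport V := fun hmem => by
      have h1 := Metric.frontier_closedBall_subset_sphere hw
      have h2 := hs hmem
      rw [Metric.mem_sphere] at h1
      rw [Metric.mem_ball, h1] at h2
      exact lt_irrefl _ h2
    filter_upwards [notMem_tsupport_iff_eventuallyEq.1 hw'] with v hv
    simp [hY, hv]
  have hu : ∀ w ∈ K, ContDiffAt ℝ 1 (fun w => gradU A Y w - gradU A X w) w := fun w hw =>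
    (((hYr w hw).contDiffAt_gradU (hYA w hw)).sub
      ((h w hw).contDiffAt_gradU (hA w hw))).of_le (by norm_num)
  have hv : ∀ w ∈ K, ContDiffAt ℝ 1 (fun w => gradV A Y w - gradV A X w) w := fun w hw =>
    (((hYr w hw).contDiffAt_gradV (hYA w hw)).sub
      ((h w hw).contDiffAt_gradV (hA w hw))).of_le (by norm_num)
  have hsame : ∀ w ∈ frontier K, Y w = X w ∧ Xu Y w = Xu X w ∧ Xv Y w = Xv X w := fun w hw => by
    refine ⟨(hYX w hw).self_of_nhds, ?_, ?_⟩
    · rw [Xu, Xu, (hYX w hw).fderiv_eq]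
    · rw [Xv, Xv, (hYX w hw).fderiv_eq]
  have hu0 : ∀ w ∈ frontier K, gradU A Y w - gradU A X w = 0 := fun w hw => by
    obtain ⟨h1, h2, h3⟩ := hsame w hw
    simp only [gradU, unitNormal, areaDensity, h1, h2, h3, sub_self]
  have hv0 : ∀ w ∈ frontier K, gradV A Y w - gradV A X w = 0 := fun w hw => by
    obtain ⟨h1, h2, h3⟩ := hsame w hw
    simp only [gradV, unitNormal, areaDensity, h1, h2, h3, sub_self]
  have hi : ∀ {Z : ℂ → Fin 3 → ℝ}, (∀ w ∈ K, Reg Z w) → (∀ w ∈ K, Z w 2 ≠ A) →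
      IntegrableOn (fun w => lagrangianDiv A (jet Z w)) K := fun hZ hZA =>
    ContinuousOn.integrableOn_compact hK fun w hw =>
      (ContinuousAt.comp (g := lagrangianDiv A) (contDiffAt_lagrangianDiv (n := 0)
        ((hZ w hw).mem_regularJetsOff (hZA w hw))).continuousAt
        (contDiffAt_jet (hZ w hw).1).continuousAt).continuousWithinAt
  rw [← sub_eq_zero]
  have h1 : ∫ w in K, lagrangianDiv A (jet X w + ε • jet V w)
      = ∫ w in K, lagrangianDiv A (jet Y w) :=
    setIntegral_congr_fun hK.measurableSet fun w hw => by
      simp only [hY, jet_add_smul (hX4 w hw) hV]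
  rw [h1, ← integral_sub (hi hYr hYA) (hi h hA)]
  have h2 : ∀ w ∈ K, lagrangianDiv A (jet Y w) - lagrangianDiv A (jet X w)
      = fderiv ℝ (fun w => gradU A Y w - gradU A X w) w 1
        + fderiv ℝ (fun w => gradV A Y w - gradV A X w) w Complex.I := fun w hw => by
    have n3 : (3 : WithTop ℕ∞) ≠ 0 := by norm_num
    rw [(hYr w hw).div_grad (hYA w hw), (h w hw).div_grad (hA w hw),
      fderiv_fun_sub (((hYr w hw).contDiffAt_gradU (hYA w hw)).differentiableAt n3)
        (((h w hw).contDiffAt_gradU (hA w hw)).differentiableAt n3),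
      fderiv_fun_sub (((hYr w hw).contDiffAt_gradV (hYA w hw)).differentiableAt n3)
        (((h w hw).contDiffAt_gradV (hA w hw)).differentiableAt n3)]
    simp only [_root_.sub_apply]
    ring
  rw [setIntegral_congr_fun hK.measurableSet h2, integral_add,
    setIntegral_fderiv_one_eq_zero hK hfr hu hu0, setIntegral_fderiv_I_eq_zero hK hfr hv hv0,
    add_zero]
  · exact ContinuousOn.integrableOn_compact hK fun w hw =>
      (continuousAt_fderiv_apply (hu w hw) 1).continuousWithinAt
  · exact ContinuousOn.integrableOn_compact hK fun w hw =>
      (continuousAt_fderiv_apply (hv w hw) Complex.I).continuousWithinAt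

theorem jet_eq_zero_of_notMem_tsupport (hw : w ∉ tsupport V) : jet V w = 0 := by
  have h0 : V =ᶠ[𝓝 w] fun _ => 0 := notMem_tsupport_iff_eventuallyEq.1 hw
  have hf : fderiv ℝ V =ᶠ[𝓝 w] fun _ => 0 := by
    filter_upwards [h0.eventuallyEq_nhds] with v hv
    rw [hv.fderiv_eq]; simp
  have hu : Xu V =ᶠ[𝓝 w] fun _ => 0 := by
    filter_upwards [hf] with v hv; simp [Xu, hv]
  have hv : Xv V =ᶠ[𝓝 w] fun _ => 0 := by
    filter_upwards [hf] with v hv; simp [Xv, hv]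
  have hz : ∀ {f : ℂ → Fin 3 → ℝ}, f =ᶠ[𝓝 w] (fun _ => 0) → ∀ e, fderiv ℝ f w e = 0 :=
    fun hf e => by rw [hf.fderiv_eq]; simp
  funext i
  fin_cases i
  · exact h0.self_of_nhds
  · exact hu.self_of_nhds
  · exact hv.self_of_nhds
  · exact hz hu 1
  · exact hz hu Complex.I
  · exact hz hv Complex.I

theorem reduced_iff (hA : X w 2 ≠ A) :
    (meanCurvature X w + c₀) * (X w 2 - A) = -unitNormal X w 2 ↔
      meanCurvature X w + c₀ = -(unitNormal X w 2 / (X w 2 - A)) := by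
  rw [← neg_div, eq_div_iff (sub_ne_zero.2 hA)]

/-- Local vanishing of the first variation off the plane `z = A`. -/
theorem setIntegral_first_variation_H_eq_zero {z : ℂ} {δ : ℝ}
    (h : ∀ w ∈ Metric.closedBall z δ, Reg X w) (hA : ∀ w ∈ Metric.closedBall z δ, X w 2 ≠ A)
    (hred : ∀ w ∈ Metric.closedBall z δ,
      (meanCurvature X w + c₀) * (X w 2 - A) = -unitNormal X w 2)
    (hV : ContDiff ℝ 4 V) (hs : tsupport V ⊆ Metric.ball z δ) :
    ∫ w in Metric.closedBall z δ, fderiv ℝ (lagrangianH c₀) (jet X w) (jet V w) = 0 := by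
  set K := Metric.closedBall z δ with hKdef
  have hK : IsCompact K := isCompact_closedBall z δ
  have hfr : frontier K ⊆ Metric.sphere z δ ∪ Metric.sphere z δ := by
    rw [union_self]; exact Metric.frontier_closedBall_subset_sphere
  have hV0 : ∀ w ∈ frontier K, V w = 0 := fun w hw =>
    image_eq_zero_of_notMem_tsupport fun hmem => by
      have h1 := Metric.frontier_closedBall_subset_sphere hw
      have h2 := hs hmem
      rw [Metric.mem_sphere] at h1
      rw [Metric.mem_ball, h1] at h2
      exact lt_irrefl _ h2
  have hred' := fun w hw => (reduced_iff (hA w hw)).1 (hred w hw)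
  have e1 : ∀ w ∈ K, fderiv ℝ (lagrangianH c₀) (jet X w) (jet V w)
      = -fderiv ℝ (lagrangianG c₀ A) (jet X w) (jet V w)
        - fderiv ℝ (lagrangianDiv A) (jet X w) (jet V w) := fun w hw => by
    refine fderiv_lagrangianH_eq ((h w hw).mem_regularJetsOff (hA w hw)) ?_ _
    rw [← meanCurvature_eq, ← unitNormal_eq, jet_zero, hred' w hw]; ring
  have hJ := jet_continuousOn fun w (hw : w ∈ K) => (h w hw).1
  have hjV : ContinuousOn (jet V) K := jet_continuousOn fun w _ => hV.contDiffAt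
  have hi : ∀ {F : Jet → ℝ}, (∀ p ∈ regularJetsOff A, ContDiffAt ℝ 1 F p) →
      IntegrableOn (fun w => fderiv ℝ F (jet X w) (jet V w)) K := fun hF =>
    ContinuousOn.integrableOn_compact hK fun w hw =>
      (((hF _ ((h w hw).mem_regularJetsOff (hA w hw))).fderiv_right
        (m := 0) (by norm_num)).continuousAt.comp_continuousWithinAt (hJ w hw)).clm_apply (hjV w hw)
  have hi' : IntegrableOn (fun w => -fderiv ℝ (lagrangianG c₀ A) (jet X w) (jet V w)) K :=
    Integrable.neg (hi fun p hp => contDiffAt_lagrangianG hp)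
  rw [setIntegral_congr_fun hK.measurableSet e1,
    integral_sub hi' (hi fun p hp => contDiffAt_lagrangianDiv hp), integral_neg,
    setIntegral_first_variation_G hK hfr h hA hV hV0,
    setIntegral_fderiv_lagrangianDiv_eq_zero h hA hV hs,
    setIntegral_congr_fun (g := fun _ => 0) hK.measurableSet fun w hw => by
      simp [(eulerG_eq_zero_iff (h w hw) (hA w hw)).2 (hred' w hw)]]
  simp

/-- Under the reduced equation, the surface lies off the plane `z = A` on a dense set. -/
theorem exists_off_plane_near {a : ℝ} (h : ∀ w ∈ dom a, Reg X w)
    (hred : ∀ w ∈ dom a, (meanCurvature X w + c₀) * (X w 2 - A) = -unitNormal X w 2)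
    (hw : w ∈ interior (dom a)) : w ∈ closure {v ∈ interior (dom a) | X v 2 ≠ A} := by
  by_contra hcon
  have hn : ∀ᶠ v in 𝓝 w, X v 2 = A := by
    filter_upwards [isClosed_closure.isOpen_compl.mem_nhds hcon, isOpen_interior.mem_nhds hw]
      with v hv hvi
    by_contra hne
    exact hv (subset_closure ⟨hvi, hne⟩)
  have hr := h w (interior_subset hw)
  have hX : DifferentiableAt ℝ X w := hr.1.differentiableAt (by norm_num)
  have hz : ∀ e, fderiv ℝ X w e 2 = 0 := fun e => by
    have hc : (fun v => X v 2) =ᶠ[𝓝 w] fun _ => A := hn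
    rw [← fderiv_comp_apply hX, hc.fderiv_eq]; simp
  have hu : Xu X w 2 = 0 := hz 1
  have hv : Xv X w 2 = 0 := hz Complex.I
  have hg := congrFun hr.grad_identity 2
  -- With `z = A` near `w` the reduced equation forces `ν₃ = 0`. The gradient identity then reads `0
  -- = W e₃`, against `W > 0`.
  have hν : unitNormal X w 2 = 0 := by
    have := hred w (interior_subset hw)
    rw [hn.self_of_nhds, sub_self, mul_zero] at this
    linarith
  simp only [hu, hv, hν, zero_smul, add_zero, Pi.smul_apply, e₃_two, smul_eq_mul,
    Pi.zero_apply, sub_zero, mul_one] at hg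
  exact hr.areaDensity_pos.ne hg

/-- The Helfrich field vanishes near every interior point off the plane `z = A`, by localization to
a small ball. Such points are dense in the interior and the field is continuous, so it vanishes
throughout the interior. -/
theorem helfrichCritical_of_reduced {a : ℝ} (h : ∀ w ∈ dom a, Reg X w)
    (hred : ∀ w ∈ dom a, (meanCurvature X w + c₀) * (X w 2 - A) = -unitNormal X w 2) :
    HelfrichCritical X a c₀ := by
  obtain ⟨G, hGc, hG⟩ := exists_eulerH c₀ h
  have hoff : ∀ z ∈ {v ∈ interior (dom a) | X v 2 ≠ A}, G z = 0 := by
    rintro z ⟨hzi, hzA⟩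
    have hzc : ContinuousAt (fun v => X v 2) z :=
      (continuous_apply (2 : Fin 3)).continuousAt.comp (h z (interior_subset hzi)).1.continuousAt
    obtain ⟨δ, hδ, hball⟩ := Metric.nhds_basis_closedBall.mem_iff.1
      (inter_mem (isOpen_interior.mem_nhds hzi) (hzc.eventually_ne hzA))
    have hsub : Metric.closedBall z δ ⊆ dom a := fun w hw => interior_subset (hball hw).1
    have hOD : Metric.ball z δ ⊆ dom a := Metric.ball_subset_closedBall.trans hsub
    refine eq_zero_of_forall_setIntegral_dotProduct_eq_zero Metric.isOpen_ball hOD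
      (isCompact_dom a).measurableSet (hGc.mono hOD) (fun V hV _ hs => ?_) z
      (Metric.mem_ball_self hδ)
    have hV4 : ContDiff ℝ 4 V := hV.of_le (WithTop.coe_le_coe.2 (le_top : (4 : ℕ∞) ≤ ⊤))
    have hsi : tsupport V ⊆ interior (dom a) := fun w hw =>
      (hball (Metric.ball_subset_closedBall (hs hw))).1
    rw [← hG V hV4 hsi, ← setIntegral_first_variation_H_eq_zero (c₀ := c₀)
      (fun w hw => h w (hsub hw)) (fun w hw => (hball hw).2) (fun w hw => hred w (hsub hw)) hV4 hs]
    -- Outside the ball the test field and its jet vanish, so the integral over the domain is the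
    -- integral over the ball.
    refine setIntegral_eq_of_subset_of_forall_sdiff_eq_zero (isCompact_dom a).measurableSet hsub
      fun w hw => ?_
    rw [jet_eq_zero_of_notMem_tsupport fun hmem => hw.2 (Metric.ball_subset_closedBall (hs hmem)),
      map_zero]
  have hzero : EqOn G (fun _ => 0) (interior (dom a)) :=
    EqOn.of_subset_closure (s := {v ∈ interior (dom a) | X v 2 ≠ A}) hoff
      (hGc.mono interior_subset) continuousOn_const (fun v hv => hv.1)
      fun w hw => exists_off_plane_near h hred hw
  intro V hV hs
  have hd := hasDerivAt_helfrich (c₀ := c₀) h hV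
  rwa [hG V hV hs, setIntegral_congr_fun (g := fun _ => 0) (isCompact_dom a).measurableSet,
    integral_zero] at hd
  intro w _
  by_cases hw : w ∈ tsupport V
  · simp [hzero (hs hw)]
  · simp [image_eq_zero_of_notMem_tsupport hw]

end


/-! ### Rotations -/

/-- Rotation about the `z`-axis as a continuous linear map. -/
noncomputable def rotZL (φ : ℝ) : (Fin 3 → ℝ) →L[ℝ] (Fin 3 → ℝ) :=
  LinearMap.toContinuousLinearMap
    { toFun := rotZ φ
      map_add' := fun p q => by
        apply ext3 <;> simp [rotZ] <;> ring
      map_smul' := fun c p => by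
        apply ext3 <;> simp [rotZ] <;> ring }

theorem rotZL_apply (φ : ℝ) (p : Fin 3 → ℝ) : rotZL φ p = rotZ φ p := rfl

theorem rotZ_zero' (φ : ℝ) (p : Fin 3 → ℝ) :
    rotZ φ p 0 = Real.cos φ * p 0 - Real.sin φ * p 1 := rfl

theorem rotZ_one' (φ : ℝ) (p : Fin 3 → ℝ) :
    rotZ φ p 1 = Real.sin φ * p 0 + Real.cos φ * p 1 := rfl

theorem rotZ_two (φ : ℝ) (p : Fin 3 → ℝ) : rotZ φ p 2 = p 2 := rfl

theorem rotZ_dot (φ : ℝ) (p q : Fin 3 → ℝ) : rotZ φ p ⬝ᵥ rotZ φ q = p ⬝ᵥ q := by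
  simp only [dot3, rotZ_zero', rotZ_one', rotZ_two]
  linear_combination (p 0 * q 0 + p 1 * q 1) * Real.sin_sq_add_cos_sq φ

theorem rotZ_cross (φ : ℝ) (p q : Fin 3 → ℝ) : rotZ φ p ⨯₃ rotZ φ q = rotZ φ (p ⨯₃ q) := by
  apply ext3 <;> simp only [cross_zero, cross_one, cross_two, rotZ_zero', rotZ_one', rotZ_two]
  · ring
  · ring
  · linear_combination (p 0 * q 1 - p 1 * q 0) * Real.sin_sq_add_cos_sq φ

/-- The change of a jet under rotations of the domain and of space. -/
noncomputable def jetRot (c s φ : ℝ) (p : Jet) : Jet :=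
  ![rotZ φ (p 0), rotZ φ (c • p 1 - s • p 2), rotZ φ (s • p 1 + c • p 2),
    rotZ φ (c • (c • p 3 - s • p 4) - s • (c • p 4 - s • p 5)),
    rotZ φ (s • (c • p 3 - s • p 4) + c • (c • p 4 - s • p 5)),
    rotZ φ (s • (s • p 3 + c • p 4) + c • (s • p 4 + c • p 5))]

section
variable {c s : ℝ} (hcs : c ^ 2 + s ^ 2 = 1) (φ : ℝ) (p : Jet)
include hcs

/-- The rotation of the parameter plane has determinant `c² + s² = 1`, and rotations of space
commute with the cross product. -/
theorem jetNormal_jetRot : jetNormal (jetRot c s φ p) = rotZ φ (jetNormal p) := by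
  change rotZ φ (c • p 1 - s • p 2) ⨯₃ rotZ φ (s • p 1 + c • p 2) = rotZ φ (p 1 ⨯₃ p 2)
  rw [rotZ_cross]
  congr 1
  apply ext3 <;> simp only [cross_zero, cross_one, cross_two, Pi.add_apply, Pi.sub_apply,
    Pi.smul_apply, smul_eq_mul]
  · linear_combination (p 1 1 * p 2 2 - p 1 2 * p 2 1) * hcs
  · linear_combination (p 1 2 * p 2 0 - p 1 0 * p 2 2) * hcs
  · linear_combination (p 1 0 * p 2 1 - p 1 1 * p 2 0) * hcs

theorem jetArea_jetRot : jetArea (jetRot c s φ p) = jetArea p := by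
  rw [jetArea, jetNormal_jetRot hcs, rotZ_dot, jetArea]

theorem jetUnit_jetRot : jetUnit (jetRot c s φ p) = rotZ φ (jetUnit p) := by
  rw [jetUnit, jetNormal_jetRot hcs, jetArea_jetRot hcs, jetUnit, ← rotZL_apply, ← rotZL_apply,
    map_smul]

theorem jetMean_jetRot : jetMean (jetRot c s φ p) = jetMean p := by
  rw [jetMean, ← jetNormal_dot_self, jetNormal_jetRot hcs, rotZ_dot, jetUnit_jetRot hcs, jetMean,
    ← jetNormal_dot_self]
  congr 1
  change rotZ φ _ ⬝ᵥ rotZ φ _ * (rotZ φ _ ⬝ᵥ _) - 2 * (rotZ φ _ ⬝ᵥ rotZ φ _) * (rotZ φ _ ⬝ᵥ _)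
    + rotZ φ _ ⬝ᵥ rotZ φ _ * (rotZ φ _ ⬝ᵥ _) = _
  simp only [rotZ_dot, add_dotProduct, sub_dotProduct, smul_dotProduct, dotProduct_add,
    dotProduct_sub, dotProduct_smul, smul_eq_mul, dotProduct_comm (p 2) (p 1)]
  generalize p 1 ⬝ᵥ p 1 = E
  generalize p 1 ⬝ᵥ p 2 = F
  generalize p 2 ⬝ᵥ p 2 = G
  generalize p 3 ⬝ᵥ jetUnit p = L
  generalize p 4 ⬝ᵥ jetUnit p = M
  generalize p 5 ⬝ᵥ jetUnit p = N
  -- Both fundamental forms are transformed by the same plane matrix, so the numerator picks up the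
  -- factor `(c² + s²)²`, and `(c² + s²)² - 1 = (c² + s² + 1)(c² + s² - 1)`.
  linear_combination (G * L - 2 * F * M + E * N) * (c ^ 2 + s ^ 2 + 1) * hcs

end

/-- `Y` is equivariant with respect to rotations on the open annulus. -/
def Equivariant (a : ℝ) (k : ℤ) (Y : ℂ → Fin 3 → ℝ) : Prop :=
  ∀ θ : ℝ, ∀ w ∈ openDom a, Y (Complex.exp (θ * Complex.I) * w) = rotZ (k * θ) (Y w)

theorem norm_exp_mul (θ : ℝ) (w : ℂ) : ‖Complex.exp (θ * Complex.I) * w‖ = ‖w‖ := by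
  rw [norm_mul, Complex.norm_exp_ofReal_mul_I, one_mul]

theorem exp_mul_mem_openDom {a : ℝ} {w : ℂ} (θ : ℝ) (hw : w ∈ openDom a) :
    Complex.exp (θ * Complex.I) * w ∈ openDom a := by
  unfold openDom at *
  simpa only [mem_ofPred_eq, norm_exp_mul] using hw

/-- The chain rule for `f(v) = rotZ φ (g(ρ⁻¹v))`. Two functions are allowed because the derivatives
of an equivariant map are not equivariant themselves: `X_u` at the rotated point is expressed by a
combination of `X_u` and `X_v`. This form can be applied a second time to reach second derivatives.
-/
theorem fderiv_of_equivariant {f g : ℂ → Fin 3 → ℝ} {w : ℂ} {θ φ : ℝ}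
    (h : ∀ᶠ v in 𝓝 w, f (Complex.exp (θ * Complex.I) * v) = rotZ φ (g v))
    (hg : DifferentiableAt ℝ g w) :
    Xu f (Complex.exp (θ * Complex.I) * w)
        = rotZ φ (Real.cos θ • Xu g w - Real.sin θ • Xv g w) ∧
      Xv f (Complex.exp (θ * Complex.I) * w)
        = rotZ φ (Real.sin θ • Xu g w + Real.cos θ • Xv g w) := by
  set ρ := Complex.exp (θ * Complex.I) with hρ
  have hρ0 : ρ ≠ 0 := Complex.exp_ne_zero _
  have hinv : ρ⁻¹ = Real.cos θ • (1 : ℂ) + (-Real.sin θ) • Complex.I := by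
    rw [hρ, ← Complex.exp_neg,
      show -(θ * Complex.I) = ((-θ : ℝ) : ℂ) * Complex.I by push_cast; ring,
      Complex.exp_mul_I, ← Complex.ofReal_cos, ← Complex.ofReal_sin]
    simp
  have hinvI : ρ⁻¹ * Complex.I = Real.sin θ • (1 : ℂ) + Real.cos θ • Complex.I := by
    rw [hinv]
    apply Complex.ext <;> simp
  have hc : ContinuousAt (fun v => ρ⁻¹ * v) (ρ * w) := by fun_prop
  have hw : ρ⁻¹ * (ρ * w) = w := by field_simp
  have he : f =ᶠ[𝓝 (ρ * w)] fun v => rotZL φ (g (ρ⁻¹ * v)) := by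
    have := hc.eventually (p := fun v => f (ρ * v) = rotZ φ (g v)) (by
      change ∀ᶠ v in 𝓝 (ρ⁻¹ * (ρ * w)), _
      rw [hw]; exact h)
    filter_upwards [this] with v hv
    rw [rotZL_apply, ← hv]; congr 1; field_simp
  have hm : HasFDerivAt (fun v : ℂ => ρ⁻¹ * v) (ContinuousLinearMap.mul ℝ ℂ ρ⁻¹) (ρ * w) :=
    (ContinuousLinearMap.mul ℝ ℂ ρ⁻¹).hasFDerivAt
  have hg' : HasFDerivAt g (fderiv ℝ g w) (ρ⁻¹ * (ρ * w)) := by rw [hw]; exact hg.hasFDerivAt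
  have H : HasFDerivAt (fun v => rotZL φ (g (ρ⁻¹ * v))) _ (ρ * w) :=
    (rotZL φ).hasFDerivAt.comp _ (hg'.comp _ hm)
  have hD : ∀ e, fderiv ℝ f (ρ * w) e = rotZ φ (fderiv ℝ g w (ρ⁻¹ * e)) := fun e => by
    rw [he.fderiv_eq, H.fderiv]; rfl
  constructor
  · rw [Xu, hD, mul_one, hinv, map_add, map_smul, map_smul, neg_smul, ← sub_eq_add_neg]; rfl
  · rw [Xv, hD, hinvI, map_add, map_smul, map_smul]; rfl

section
variable {a : ℝ} {k : ℤ} {Y : ℂ → Fin 3 → ℝ} (hY : Equivariant a k Y)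
  (hr : ∀ w ∈ openDom a, ContDiffAt ℝ 4 Y w)
include hY hr

theorem Equivariant.jet_rot (θ : ℝ) {w : ℂ} (hw : w ∈ openDom a) :
    jet Y (Complex.exp (θ * Complex.I) * w)
      = jetRot (Real.cos θ) (Real.sin θ) (k * θ) (jet Y w) := by
  have n3 : (3 : WithTop ℕ∞) ≠ 0 := by norm_num
  have hev : ∀ᶠ v in 𝓝 w, v ∈ openDom a := (isOpen_openDom a).mem_nhds hw
  have h1 : ∀ v ∈ openDom a, _ := fun v hv => fderiv_of_equivariant (φ := k * θ)
    (by filter_upwards [(isOpen_openDom a).mem_nhds hv] with v hv using hY θ v hv)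
    ((hr v hv).differentiableAt (by norm_num))
  have du := (contDiffAt_Xu3 (hr w hw)).differentiableAt n3
  have dv := (contDiffAt_Xv3 (hr w hw)).differentiableAt n3
  have lin : ∀ (c d : ℝ) (e : ℂ), fderiv ℝ (fun v => c • Xu Y v + d • Xv Y v) w e
      = c • fderiv ℝ (Xu Y) w e + d • fderiv ℝ (Xv Y) w e := fun c d e => by
    have : HasFDerivAt (fun v => c • Xu Y v + d • Xv Y v) _ w :=
      (du.hasFDerivAt.const_smul c).add (dv.hasFDerivAt.const_smul d)
    rw [this.fderiv]; rfl
  have hd : ∀ c d : ℝ, DifferentiableAt ℝ (fun v => c • Xu Y v + d • Xv Y v) w := fun c d =>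
    (du.const_smul c).add (dv.const_smul d)
  have h2 := fderiv_of_equivariant (f := Xu Y)
    (g := fun v => Real.cos θ • Xu Y v + (-Real.sin θ) • Xv Y v) (θ := θ) (φ := k * θ) (w := w)
    (by filter_upwards [hev] with v hv; rw [(h1 v hv).1, neg_smul, ← sub_eq_add_neg]) (hd _ _)
  have h3 := fderiv_of_equivariant (f := Xv Y)
    (g := fun v => Real.sin θ • Xu Y v + Real.cos θ • Xv Y v) (θ := θ) (φ := k * θ) (w := w)
    (by filter_upwards [hev] with v hv using (h1 v hv).2) (hd _ _)
  have hsym := Xu_Xv_comm (hr w hw)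
  have linU : ∀ c d : ℝ, Xu (fun v => c • Xu Y v + d • Xv Y v) w
      = c • Xu (Xu Y) w + d • Xv (Xu Y) w := fun c d => by rw [← hsym]; exact lin c d 1
  have linV : ∀ c d : ℝ, Xv (fun v => c • Xu Y v + d • Xv Y v) w
      = c • Xv (Xu Y) w + d • Xv (Xv Y) w := fun c d => lin c d Complex.I
  simp only [linU, linV] at h2 h3
  simp only [neg_smul, ← sub_eq_add_neg] at h2
  funext i
  fin_cases i
  · exact hY θ w hw
  · exact (h1 w hw).1
  · exact (h1 w hw).2
  · exact h2.1
  · exact h2.2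
  · exact h3.2

theorem Equivariant.meanCurvature_rot (θ : ℝ) {w : ℂ} (hw : w ∈ openDom a) :
    meanCurvature Y (Complex.exp (θ * Complex.I) * w) = meanCurvature Y w := by
  rw [meanCurvature_eq, hY.jet_rot hr θ hw, jetMean_jetRot (Real.cos_sq_add_sin_sq θ),
    meanCurvature_eq]

theorem Equivariant.unitNormal_rot (θ : ℝ) {w : ℂ} (hw : w ∈ openDom a) :
    unitNormal Y (Complex.exp (θ * Complex.I) * w) 2 = unitNormal Y w 2 := by
  rw [unitNormal_eq, hY.jet_rot hr θ hw, jetUnit_jetRot (Real.cos_sq_add_sin_sq θ),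
    unitNormal_eq, rotZ_two]

/-! ### The jet of a surface of revolution along the real axis -/

/-- Differentiation of the equivariance at `θ = 0`: the domain rotates with velocity `iw`, and space
with velocity `k e₃ × Y`. -/
theorem Equivariant.fderiv_I_mul {w : ℂ} (hw : w ∈ openDom a) :
    w.re • Xv Y w - w.im • Xu Y w = (k : ℝ) • (e₃ ⨯₃ Y w) := by
  have hd : DifferentiableAt ℝ Y w := (hr w hw).differentiableAt (by norm_num)
  have hexp : HasDerivAt (fun θ : ℝ => Complex.exp (θ * Complex.I) * w) (Complex.I * w) 0 := by
    have h1 : HasDerivAt (fun θ : ℝ => (θ : ℂ) * Complex.I) Complex.I 0 := by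
      simpa using (Complex.ofRealCLM.hasDerivAt (x := (0 : ℝ))).mul_const Complex.I
    simpa using (h1.cexp).mul_const w
  have hd' : HasFDerivAt Y (fderiv ℝ Y w) (Complex.exp (((0 : ℝ) : ℂ) * Complex.I) * w) := by
    simpa using hd.hasFDerivAt
  have h1 := hd'.comp_hasDerivAt (0 : ℝ) hexp
  have h2 : HasDerivAt (fun θ : ℝ => rotZ (k * θ) (Y w)) ((k : ℝ) • (e₃ ⨯₃ Y w)) 0 := by
    have hk : HasDerivAt (fun θ : ℝ => (k : ℝ) * θ) k 0 := by
      simpa using (hasDerivAt_id (0 : ℝ)).const_mul (k : ℝ)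
    have hc : HasDerivAt (fun θ : ℝ => Real.cos (k * θ)) 0 0 := by simpa using hk.cos
    have hs : HasDerivAt (fun θ : ℝ => Real.sin (k * θ)) k 0 := by simpa using hk.sin
    rw [hasDerivAt_pi]
    intro i
    fin_cases i
    · refine ((hc.mul_const (Y w 0)).sub (hs.mul_const (Y w 1))).congr_deriv ?_
      simp [cross_zero, e₃_one, e₃_two]
    · refine ((hs.mul_const (Y w 0)).add (hc.mul_const (Y w 1))).congr_deriv ?_
      simp [cross_one, e₃_zero, e₃_two]
    · refine (hasDerivAt_const (0 : ℝ) (Y w 2)).congr_deriv ?_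
      simp [cross_two, e₃_zero, e₃_one]
  have h3 := h1.unique (h2.congr_of_eventuallyEq (.of_forall fun θ => hY θ w hw))
  have h4 : Complex.I * w = w.re • Complex.I + (-w.im) • (1 : ℂ) := by
    apply Complex.ext <;> simp
  rw [h4, map_add, map_smul, map_smul, neg_smul, ← sub_eq_add_neg] at h3
  exact h3

/-- The jet of a surface of revolution on the real axis. -/
theorem Equivariant.jet_real {r : ℝ} (hw : (r : ℂ) ∈ openDom a) :
    r • jet Y r 2 = (k : ℝ) • (e₃ ⨯₃ jet Y r 0) ∧
    r • jet Y r 4 = (k : ℝ) • (e₃ ⨯₃ jet Y r 1) - jet Y r 2 ∧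
    r • jet Y r 5 = jet Y r 1 + (k : ℝ) • (e₃ ⨯₃ jet Y r 2) := by
  have n3 : (3 : WithTop ℕ∞) ≠ 0 := by norm_num
  have h1 : (fun w : ℂ => w.re • Xv Y w - w.im • Xu Y w)
      =ᶠ[𝓝 (r : ℂ)] fun w => (k : ℝ) • (e₃ ⨯₃ Y w) := by
    filter_upwards [(isOpen_openDom a).mem_nhds hw] with w hw using hY.fderiv_I_mul hr hw
  have du := (contDiffAt_Xu3 (hr _ hw)).differentiableAt n3
  have dv := (contDiffAt_Xv3 (hr _ hw)).differentiableAt n3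
  have dY : DifferentiableAt ℝ Y r := (hr _ hw).differentiableAt (by norm_num)
  have H1 : HasFDerivAt (fun w : ℂ => w.re • Xv Y w - w.im • Xu Y w) _ (r : ℂ) :=
    ((Complex.reCLM.hasFDerivAt).smul dv.hasFDerivAt).sub
      ((Complex.imCLM.hasFDerivAt).smul du.hasFDerivAt)
  have H2 : HasFDerivAt (fun w : ℂ => (k : ℝ) • (e₃ ⨯₃ Y w)) _ (r : ℂ) :=
    ((crossL e₃).hasFDerivAt.comp (r : ℂ) dY.hasFDerivAt).const_smul (k : ℝ)
  have h2 := h1.fderiv_eq (𝕜 := ℝ)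
  rw [H1.fderiv, H2.fderiv] at h2
  refine ⟨?_, ?_, ?_⟩
  · have := h1.self_of_nhds
    simp only [Complex.ofReal_re, Complex.ofReal_im, zero_smul, sub_zero] at this
    exact this
  · have h3 := congrArg (fun L => L 1) h2
    simp only [_root_.sub_apply, _root_.add_apply, _root_.smul_apply, Complex.reCLM_apply,
      Complex.imCLM_apply, Complex.ofReal_re, Complex.ofReal_im, zero_smul,
      ContinuousLinearMap.smulRight_apply, Complex.one_re, Complex.one_im, one_smul,
      ContinuousLinearMap.comp_apply, add_zero, _root_.zero_apply, sub_zero] at h3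
    change r • Xu (Xv Y) r + Xv Y r = (k : ℝ) • (e₃ ⨯₃ Xu Y r) at h3
    rw [Xu_Xv_comm (hr _ hw)] at h3
    exact eq_sub_of_add_eq h3
  · have h3 := congrArg (fun L => L Complex.I) h2
    simp only [_root_.sub_apply, _root_.add_apply, _root_.smul_apply, Complex.reCLM_apply,
      Complex.imCLM_apply, Complex.ofReal_re, Complex.ofReal_im, zero_smul,
      ContinuousLinearMap.smulRight_apply, Complex.I_re, Complex.I_im, one_smul,
      ContinuousLinearMap.comp_apply, add_zero, zero_add] at h3
    change r • Xv (Xv Y) r - Xu Y r = (k : ℝ) • (e₃ ⨯₃ Xv Y r) at h3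
    rw [sub_eq_iff_eq_add, add_comm] at h3
    exact h3

end

/-! ### The profile curve -/

/-- The normal and the area density in terms of the profile curve. -/
theorem jetNormal_profile {p : Jet} {κ R R₁ : ℝ} (hR : 0 < R)
    (hR2 : R ^ 2 = p 0 0 ^ 2 + p 0 1 ^ 2)
    (hR1 : R * R₁ = p 0 0 * p 1 0 + p 0 1 * p 1 1) (h2 : p 2 = κ • (e₃ ⨯₃ p 0)) :
    jetNormal p 0 = -κ * (p 1 2 * p 0 0) ∧ jetNormal p 1 = -κ * (p 1 2 * p 0 1) ∧
      jetNormal p 2 = κ * (R * R₁) ∧ jetArea p = |κ| * R * √(R₁ ^ 2 + p 1 2 ^ 2) := by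
  have h0 : jetNormal p 0 = -κ * (p 1 2 * p 0 0) := by
    rw [jetNormal, h2]
    simp only [cross_zero, cross_one, cross_two, e₃_zero, e₃_one, e₃_two, Pi.smul_apply,
      smul_eq_mul]
    ring
  have h1 : jetNormal p 1 = -κ * (p 1 2 * p 0 1) := by
    rw [jetNormal, h2]
    simp only [cross_zero, cross_one, cross_two, e₃_zero, e₃_one, e₃_two, Pi.smul_apply,
      smul_eq_mul]
    ring
  have h2 : jetNormal p 2 = κ * (R * R₁) := by
    rw [jetNormal, h2, hR1]
    simp only [cross_zero, cross_one, cross_two, e₃_zero, e₃_one, e₃_two, Pi.smul_apply,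
      smul_eq_mul]
    ring
  refine ⟨h0, h1, h2, ?_⟩
  have hsq : jetNormal p ⬝ᵥ jetNormal p = (|κ| * R) ^ 2 * (R₁ ^ 2 + p 1 2 ^ 2) := by
    rw [dot3, h0, h1, h2, mul_pow, sq_abs]
    linear_combination (-κ ^ 2 * p 1 2 ^ 2) * hR2
  rw [jetArea, hsq, Real.sqrt_mul (sq_nonneg _), Real.sqrt_sq (by positivity)]

/-- The normal and the mean curvature in terms of the profile curve. -/
theorem jet_profile {p : Jet} {r k s R R₁ R₂ σ : ℝ} (hr : 0 < r) (hk : k ≠ 0)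
    (hs : s * |k| = k) (hR : 0 < R) (hR2 : R ^ 2 = p 0 0 ^ 2 + p 0 1 ^ 2)
    (hR1 : R * R₁ = p 0 0 * p 1 0 + p 0 1 * p 1 1)
    (hR2' : R * R₂ + R₁ ^ 2 = p 0 0 * p 3 0 + p 0 1 * p 3 1 + p 1 0 ^ 2 + p 1 1 ^ 2)
    (h2 : r • p 2 = k • (e₃ ⨯₃ p 0)) (h4 : r • p 4 = k • (e₃ ⨯₃ p 1) - p 2)
    (h5 : r • p 5 = p 1 + k • (e₃ ⨯₃ p 2)) (hσ : σ = √(R₁ ^ 2 + p 1 2 ^ 2)) (hσ0 : 0 < σ) :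
    jetArea p = |k| / r * R * σ ∧ jetUnit p 2 = s * R₁ / σ ∧
      jetMean p = s / 2 * ((R₁ * p 3 2 - p 1 2 * R₂) / σ ^ 3 + p 1 2 / (R * σ)) := by
  have hr0 := hr.ne'
  set κ := k / r with hκ
  have hcancel : ∀ {u v : Fin 3 → ℝ}, r • u = v → u = r⁻¹ • v := fun {u v} h => by
    rw [← h, smul_smul, inv_mul_cancel₀ hr0, one_smul]
  have h2' : p 2 = κ • (e₃ ⨯₃ p 0) := by rw [hcancel h2, smul_smul, hκ, div_eq_inv_mul]
  have h4' : p 4 = κ • (e₃ ⨯₃ p 1) - r⁻¹ • p 2 := by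
    rw [hcancel h4, smul_sub, smul_smul, hκ, div_eq_inv_mul]
  have h5' : p 5 = r⁻¹ • p 1 + κ • (e₃ ⨯₃ p 2) := by
    rw [hcancel h5, smul_add, smul_smul, hκ, div_eq_inv_mul]
  obtain ⟨hN0, hN1, hN2, hW⟩ := jetNormal_profile hR hR2 hR1 h2'
  have hκabs : |κ| = |k| / r := by rw [hκ, abs_div, abs_of_pos hr]
  have hk0 : 0 < |k| := abs_pos.2 hk
  have hκ0 : 0 < |κ| := by rw [hκabs]; positivity
  rw [← hσ] at hW
  have hσ2 : σ ^ 2 = R₁ ^ 2 + p 1 2 ^ 2 := by rw [hσ, Real.sq_sqrt (by positivity)]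
  have hκs : κ = s * |κ| := by rw [hκabs, hκ, ← mul_div_assoc, hs]
  -- The number `s` is the sign of `k`, which records the orientation of the normal.
  have hs2 : s ^ 2 = 1 := by
    have h1 : (s * |k|) ^ 2 = |k| ^ 2 := by rw [hs, sq_abs]
    rw [mul_pow] at h1
    exact mul_right_cancel₀ (pow_ne_zero 2 hk0.ne') (h1.trans (one_mul _).symm)
  have hdot : ∀ v : Fin 3 → ℝ, v ⬝ᵥ jetUnit p = (v ⬝ᵥ jetNormal p) / jetArea p := fun v => by
    rw [jetUnit, dotProduct_smul, smul_eq_mul, inv_mul_eq_div]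
  have e20 : p 2 0 = -(κ * p 0 1) := by
    rw [h2']; simp only [Pi.smul_apply, smul_eq_mul, cross_zero, e₃_one, e₃_two]; ring
  have e21 : p 2 1 = κ * p 0 0 := by
    rw [h2']; simp only [Pi.smul_apply, smul_eq_mul, cross_one, e₃_zero, e₃_two]; ring
  have e22 : p 2 2 = 0 := by
    rw [h2']; simp only [Pi.smul_apply, smul_eq_mul, cross_two, e₃_zero, e₃_one]; ring
  refine ⟨by rw [hW, hκabs], ?_, ?_⟩
  · have : jetUnit p 2 = (jetArea p)⁻¹ * jetNormal p 2 := rfl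
    rw [this, hN2, hW, hκs, abs_mul, abs_abs]
    have : |s| = 1 := by rw [← sq_eq_sq₀ (abs_nonneg s) zero_le_one, sq_abs, hs2, one_pow]
    rw [this]
    field_simp
  · have hG : p 2 ⬝ᵥ p 2 = κ ^ 2 * R ^ 2 := by rw [dot3, e20, e21, e22, hR2]; ring
    have hF : p 1 ⬝ᵥ p 2 = κ * (p 0 0 * p 1 1 - p 0 1 * p 1 0) := by
      rw [dot3, e20, e21, e22]; ring
    have hL : p 3 ⬝ᵥ jetNormal p
        = κ * (-p 1 2 * (p 0 0 * p 3 0 + p 0 1 * p 3 1) + R * R₁ * p 3 2) := by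
      rw [dot3, hN0, hN1, hN2]; ring
    have h1N : p 1 ⬝ᵥ jetNormal p = 0 := dot_self_cross _ _
    have h2N : p 2 ⬝ᵥ jetNormal p = 0 := dot_cross_self _ _
    have hM : p 4 ⬝ᵥ jetNormal p = κ ^ 2 * p 1 2 * (p 0 0 * p 1 1 - p 0 1 * p 1 0) := by
      rw [h4', sub_dotProduct, smul_dotProduct, smul_dotProduct, h2N, dot3, hN0, hN1]
      simp only [smul_eq_mul, cross_zero, cross_one, cross_two, e₃_zero, e₃_one, e₃_two]; ring
    have hNN : p 5 ⬝ᵥ jetNormal p = κ ^ 3 * p 1 2 * R ^ 2 := by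
      rw [h5', add_dotProduct, smul_dotProduct, smul_dotProduct, h1N, dot3, hN0, hN1, hR2]
      simp only [smul_eq_mul, cross_zero, cross_one, cross_two, e₃_zero, e₃_one, e₃_two, e20, e21]
      ring
    have hnum : p 2 ⬝ᵥ p 2 * (p 3 ⬝ᵥ jetNormal p) - 2 * (p 1 ⬝ᵥ p 2) * (p 4 ⬝ᵥ jetNormal p)
        + p 1 ⬝ᵥ p 1 * (p 5 ⬝ᵥ jetNormal p)
        = κ ^ 3 * R ^ 2 * (R * (R₁ * p 3 2 - p 1 2 * R₂) + p 1 2 * σ ^ 2) := by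
      rw [hG, hF, hL, hM, hNN, hσ2, dot3]
      -- The image of the real axis need not lie in a meridian plane. Its twist `xy' - yx'` enters
      -- only through its square, which by Lagrange's identity is `R²(x'² + y'²) - (RR')²`.
      have hD : (R * R₁) ^ 2 = (p 0 0 * p 1 0 + p 0 1 * p 1 1) ^ 2 := by rw [hR1]
      linear_combination (κ ^ 3 * R ^ 2 * p 1 2) * hR2' - 2 * κ ^ 3 * p 1 2 * hD
        + 2 * κ ^ 3 * p 1 2 * (p 1 0 ^ 2 + p 1 1 ^ 2) * hR2
    have hmean : jetMean p = (κ ^ 3 * R ^ 2 * (R * (R₁ * p 3 2 - p 1 2 * R₂) + p 1 2 * σ ^ 2))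
        / (2 * jetArea p ^ 3) := by
      rw [← hnum, jetMean, ← jetNormal_dot_self, ← jetArea_sq, hdot, hdot, hdot]
      have hA : jetArea p ≠ 0 := by rw [hW]; positivity
      field_simp
    have hκ3 : κ ^ 3 = s * |κ| ^ 3 := by
      calc κ ^ 3 = (s * |κ|) ^ 3 := by rw [← hκs]
        _ = s * |κ| ^ 3 := by linear_combination (s * |κ| ^ 3) * hs2
    rw [hmean, hW, hκ3]
    field_simp


/-! ### Vertical variations of surfaces of revolution -/

/-- The mean curvature of a surface of revolution in terms of the profile curve. -/
noncomputable def profileMean (s R R₁ R₂ q q' : ℝ) : ℝ :=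
  s / 2 * ((R₁ * q' - q * R₂) / √(R₁ ^ 2 + q ^ 2) ^ 3 + q / (R * √(R₁ ^ 2 + q ^ 2)))

/-- A vertical variation leaves the radius `R` fixed and changes only `q = z'` and `q' = z''`. The
coefficients of `α` and `β` are the momenta conjugate to `z'` and `z''`. -/
theorem hasDerivAt_profile_lagrangian {s c₀ R R₁ R₂ q q' α β σ h : ℝ} (hR : 0 < R)
    (hσ : σ = √(R₁ ^ 2 + q ^ 2)) (hσ0 : 0 < σ) (hh : h = profileMean s R R₁ R₂ q q') :
    HasDerivAt (fun ε : ℝ => (profileMean s R R₁ R₂ (q + ε * α) (q' + ε * β) + c₀) ^ 2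
        * (R * √(R₁ ^ 2 + (q + ε * α) ^ 2)))
      (α * (2 * (h + c₀) * R * σ * (s / 2 * (-R₂ / σ ^ 3 - 3 * q * (R₁ * q' - q * R₂) / σ ^ 5
          + R₁ ^ 2 / (R * σ ^ 3))) + (h + c₀) ^ 2 * R * q / σ)
        + β * ((h + c₀) * R * (s * R₁ / σ) / σ)) 0 := by
  have hσ2 : σ ^ 2 = R₁ ^ 2 + q ^ 2 := by rw [hσ, Real.sq_sqrt (by positivity)]
  have hq : HasDerivAt (fun ε : ℝ => q + ε * α) α 0 := by
    simpa using ((hasDerivAt_id (0 : ℝ)).mul_const α).const_add q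
  have hq' : HasDerivAt (fun ε : ℝ => q' + ε * β) β 0 := by
    simpa using ((hasDerivAt_id (0 : ℝ)).mul_const β).const_add q'
  have hS : HasDerivAt (fun ε : ℝ => √(R₁ ^ 2 + (q + ε * α) ^ 2)) (q * α / σ) 0 := by
    have h1 := ((hq.pow 2).const_add (R₁ ^ 2)).sqrt (by
      rw [Pi.pow_apply, zero_mul, add_zero, ← hσ2]; positivity)
    refine h1.congr_deriv ?_
    simp only [Pi.pow_apply, zero_mul, add_zero, ← hσ]
    norm_num
    field_simp
  have hS0 : √(R₁ ^ 2 + (q + 0 * α) ^ 2) = σ := by rw [zero_mul, add_zero, hσ]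
  have hM : HasDerivAt (fun ε : ℝ => profileMean s R R₁ R₂ (q + ε * α) (q' + ε * β))
      (α * (s / 2 * (-R₂ / σ ^ 3 - 3 * q * (R₁ * q' - q * R₂) / σ ^ 5 + R₁ ^ 2 / (R * σ ^ 3)))
        + β * (s / 2 * (R₁ / σ ^ 3))) 0 := by
    have h1 := (((hq'.const_mul R₁).sub (hq.mul_const R₂)).div (hS.pow 3)
      (by rw [Pi.pow_apply, hS0]; positivity)).add
      (hq.div (hS.const_mul R) (by rw [hS0]; positivity))
    refine (h1.const_mul (s / 2)).congr_deriv ?_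
    simp only [Pi.pow_apply, Pi.sub_apply, hS0]
    simp only [zero_mul, add_zero]
    have e1 : R₁ ^ 2 = σ ^ 2 - q ^ 2 := by linarith
    rw [e1]
    field_simp
    norm_num
    ring
  refine (((hM.add_const c₀).pow 2).mul (hS.const_mul R)).congr_deriv ?_
  simp only [Pi.pow_apply, hS0]
  simp only [zero_mul, add_zero, ← hh]
  norm_num
  field_simp
  ring

section
variable {E : Type*} [NormedAddCommGroup E] [NormedSpace ℝ E]

theorem contDiffAt_comp_ofReal {f : ℂ → E} {n : WithTop ℕ∞} {t : ℝ} (h : ContDiffAt ℝ n f t) :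
    ContDiffAt ℝ n (fun s : ℝ => f s) t :=
  ContDiffAt.comp t h Complex.ofRealCLM.contDiff.contDiffAt

end

/-- The ratio `R / √(R'² + z'²)` for the profile curve of a surface of revolution. -/
noncomputable def profileRatio (k : ℤ) (X : ℂ → Fin 3 → ℝ) (t : ℝ) : ℝ :=
  |(k : ℝ)| * (X t 0 ^ 2 + X t 1 ^ 2) / (t * areaDensity X t)

/-- The density of the vertical flux along the real axis. -/
noncomputable def fluxDensity (c₀ : ℝ) (X : ℂ → Fin 3 → ℝ) (t : ℝ) : ℝ :=
  (meanCurvature X t + c₀) * fderiv ℝ (fun w => unitNormal X w 2) t 1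
    - unitNormal X t 2 * fderiv ℝ (meanCurvature X) t 1
    + (meanCurvature X t + c₀) ^ 2 * Xu X t 2

/-- The momentum conjugate to the second derivative of the height. -/
noncomputable def secondMomentum (c₀ : ℝ) (k : ℤ) (X : ℂ → Fin 3 → ℝ) (t : ℝ) : ℝ :=
  (meanCurvature X t + c₀) * unitNormal X t 2 * profileRatio k X t

section
variable {c₀ : ℝ} {k : ℤ} {X : ℂ → Fin 3 → ℝ} {t : ℝ}

theorem Reg.contDiffAt_profileRatio (h : Reg X t) (ht : t ≠ 0) :
    ContDiffAt ℝ 3 (profileRatio k X) t := by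
  have hX : ∀ i, ContDiffAt ℝ 3 (fun s : ℝ => X s i) t := fun i =>
    contDiffAt_comp_ofReal
      ((contDiff_apply ℝ ℝ i).contDiffAt.comp (t : ℂ) (h.1.of_le (by norm_num)))
  exact (contDiffAt_const.mul (((hX 0).pow 2).add ((hX 1).pow 2))).div
    (contDiffAt_id.mul (contDiffAt_comp_ofReal h.contDiffAt_areaDensity))
    (mul_ne_zero ht h.areaDensity_pos.ne')

theorem Reg.contDiffAt_unitNormal_two {w : ℂ} (h : Reg X w) :
    ContDiffAt ℝ 3 (fun w => unitNormal X w 2) w := contDiffAt_comp_two h.contDiffAt_unitNormal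

theorem Reg.contDiffAt_secondMomentum (h : Reg X t) (ht : t ≠ 0) :
    ContDiffAt ℝ 2 (secondMomentum c₀ k X) t :=
  (((contDiffAt_comp_ofReal h.contDiffAt_meanCurvature).add contDiffAt_const).mul
    (contDiffAt_comp_ofReal (h.contDiffAt_unitNormal_two.of_le (by norm_num)))).mul
    ((h.contDiffAt_profileRatio ht).of_le (by norm_num))

theorem Reg.contDiffAt_fluxDensity (h : Reg X t) : ContDiffAt ℝ 1 (fluxDensity c₀ X) t := by
  have hH := (contDiffAt_comp_ofReal h.contDiffAt_meanCurvature).of_le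
    (show (1 : WithTop ℕ∞) ≤ 2 by norm_num)
  have hH' := contDiffAt_comp_ofReal
    (contDiffAt_fderiv_apply (m := 1) h.contDiffAt_meanCurvature (by norm_num) 1)
  have hν' := contDiffAt_comp_ofReal
    (contDiffAt_fderiv_apply (m := 1) h.contDiffAt_unitNormal_two (by norm_num) 1)
  have hν := contDiffAt_comp_ofReal (h.contDiffAt_unitNormal_two.of_le
    (show (1 : WithTop ℕ∞) ≤ 3 by norm_num))
  have hq := contDiffAt_comp_ofReal ((contDiffAt_comp_two (contDiffAt_Xu3 h.1)).of_le
    (show (1 : WithTop ℕ∞) ≤ 3 by norm_num))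
  exact (((hH.add contDiffAt_const).mul hν').sub (hν.mul hH')).add
    (((hH.add contDiffAt_const).pow 2).mul hq)

end

/-- The profile curve of a surface of revolution. -/
structure Profile (X : ℂ → Fin 3 → ℝ) (k : ℤ) (s t R R₁ R₂ σ : ℝ) : Prop where
  R_pos : 0 < R
  R_sq : R ^ 2 = X t 0 ^ 2 + X t 1 ^ 2
  R_mul : R * R₁ = X t 0 * Xu X t 0 + X t 1 * Xu X t 1
  R_mul' : R * R₂ + R₁ ^ 2 = X t 0 * Xu (Xu X) t 0 + X t 1 * Xu (Xu X) t 1 + Xu X t 0 ^ 2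
    + Xu X t 1 ^ 2
  sigma_eq : σ = √(R₁ ^ 2 + Xu X t 2 ^ 2)
  sigma_pos : 0 < σ
  ratio : profileRatio k X t = R / σ
  normal : unitNormal X t 2 = s * R₁ / σ
  mean : meanCurvature X t = profileMean s R R₁ R₂ (Xu X t 2) (Xu (Xu X) t 2)

section
variable {a : ℝ} {k : ℤ} {X : ℂ → Fin 3 → ℝ}

theorem ofReal_mem_openDom (ha₀ : 0 ≤ a) {t : ℝ} (ht : t ∈ Ioo a 1) : (t : ℂ) ∈ openDom a := by
  have : ‖(t : ℂ)‖ = t := by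
    rw [Complex.norm_real, Real.norm_of_nonneg (ha₀.trans ht.1.le)]
  exact ⟨by rw [this]; exact ht.1, by rw [this]; exact ht.2⟩

/-- The distance from the axis. -/
noncomputable def radiusFn (X : ℂ → Fin 3 → ℝ) (t : ℝ) : ℝ := √(X t 0 ^ 2 + X t 1 ^ 2)

/-- The derivative of the distance from the axis. -/
noncomputable def radiusFn' (X : ℂ → Fin 3 → ℝ) (t : ℝ) : ℝ :=
  (X t 0 * Xu X t 0 + X t 1 * Xu X t 1) / radiusFn X t

/-- The second derivative of the distance from the axis. -/
noncomputable def radiusFn'' (X : ℂ → Fin 3 → ℝ) (t : ℝ) : ℝ :=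
  (X t 0 * Xu (Xu X) t 0 + X t 1 * Xu (Xu X) t 1 + Xu X t 0 ^ 2 + Xu X t 1 ^ 2
    - radiusFn' X t ^ 2) / radiusFn X t

/-- The speed of the profile curve. -/
noncomputable def speedFn (X : ℂ → Fin 3 → ℝ) (t : ℝ) : ℝ := √(radiusFn' X t ^ 2 + Xu X t 2 ^ 2)

theorem Equivariant.profile (ha₀ : 0 ≤ a) (hX : Equivariant a k X) (hr : ∀ w ∈ openDom a, Reg X w)
    {s : ℝ} (hk : (k : ℝ) ≠ 0) (hs : s * |(k : ℝ)| = k) {t : ℝ} (ht : t ∈ Ioo a 1) :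
    Profile X k s t (radiusFn X t) (radiusFn' X t) (radiusFn'' X t) (speedFn X t) := by
  have ht0 : 0 < t := ha₀.trans_lt ht.1
  have hw := ofReal_mem_openDom ha₀ ht
  have hreg := hr _ hw
  obtain ⟨h2, h4, h5⟩ := hX.jet_real (fun w hw => (hr w hw).1) hw
  have hsq : radiusFn X t ^ 2 = X t 0 ^ 2 + X t 1 ^ 2 := Real.sq_sqrt (by positivity)
  -- At a point on the axis the rotation has zero velocity, so `X_v = 0` and `X` would not be
  -- immersive.
  have hR : 0 < radiusFn X t := by
    refine Real.sqrt_pos.2 (lt_of_le_of_ne (by positivity) fun h0 => ?_)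
    have h00 : X t 0 = 0 := by nlinarith [sq_nonneg (X t 0), sq_nonneg (X t 1)]
    have h01 : X t 1 = 0 := by nlinarith [sq_nonneg (X t 0), sq_nonneg (X t 1)]
    have hz : e₃ ⨯₃ jet X t 0 = 0 := by
      rw [jet_zero]
      apply ext3 <;> simp [cross_zero, cross_one, cross_two, e₃_zero, e₃_one, h00, h01]
    rw [hz, smul_zero, smul_eq_zero, or_iff_right ht0.ne'] at h2
    refine hreg.2 ?_
    rw [jetNormal, h2, map_zero, zero_dotProduct]
  have hR1 : radiusFn X t * radiusFn' X t = X t 0 * Xu X t 0 + X t 1 * Xu X t 1 := by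
    rw [radiusFn']; field_simp
  have hR2 : radiusFn X t * radiusFn'' X t + radiusFn' X t ^ 2
      = X t 0 * Xu (Xu X) t 0 + X t 1 * Xu (Xu X) t 1 + Xu X t 0 ^ 2 + Xu X t 1 ^ 2 := by
    rw [radiusFn'']; field_simp; ring
  have h2' : jet X t 2 = ((k : ℝ) / t) • (e₃ ⨯₃ jet X t 0) := by
    rw [div_eq_inv_mul, mul_smul, ← h2, smul_smul, inv_mul_cancel₀ ht0.ne', one_smul]
  -- The area density is `|k|Rσ/t`; its positivity gives that of `σ`.
  have hσ0 : 0 < speedFn X t := by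
    have hW := (jetNormal_profile (p := jet X t) hR hsq hR1 h2').2.2.2
    have hW0 := jetArea_pos hreg.2
    rw [hW] at hW0
    exact pos_of_mul_pos_right hW0 (by positivity)
  obtain ⟨hA, hν, hH⟩ := jet_profile (p := jet X t) ht0 hk hs hR hsq hR1 hR2 h2 h4 h5 rfl hσ0
  refine ⟨hR, hsq, hR1, hR2, rfl, hσ0, ?_, hν, ?_⟩
  · rw [profileRatio, areaDensity_eq, hA, ← hsq]
    have : |(k : ℝ)| ≠ 0 := abs_ne_zero.2 hk
    have hσ0' : √(radiusFn' X t ^ 2 + jet X t 1 2 ^ 2) = speedFn X t := rfl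
    simp only [hσ0']
    have h1 := hσ0.ne'
    field_simp
  · rw [meanCurvature_eq, hH]; rfl

theorem hasDerivAt_comp_ofReal {f : ℂ → Fin 3 → ℝ} {t : ℝ} (hf : DifferentiableAt ℝ f t)
    (i : Fin 3) : HasDerivAt (fun s : ℝ => f s i) (Xu f t i) t :=
  (hasDerivAt_pi.1 (fderiv_apply_one_eq_deriv hf)) i

theorem hasDerivAt_radiusFn {t : ℝ} (hX : Reg X t) (hR : 0 < radiusFn X t) :
    HasDerivAt (radiusFn X) (radiusFn' X t) t ∧
      HasDerivAt (radiusFn' X) (radiusFn'' X t) t := by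
  have hd : DifferentiableAt ℝ X t := hX.1.differentiableAt (by norm_num)
  have h0 := hasDerivAt_comp_ofReal hd 0
  have h1 := hasDerivAt_comp_ofReal hd 1
  have h0' := hasDerivAt_comp_ofReal hX.differentiableAt_Xu 0
  have h1' := hasDerivAt_comp_ofReal hX.differentiableAt_Xu 1
  have hS : X t 0 ^ 2 + X t 1 ^ 2 ≠ 0 := (Real.sqrt_pos.1 hR).ne'
  have hR1 : HasDerivAt (radiusFn X) (radiusFn' X t) t := by
    refine (((h0.pow 2).add (h1.pow 2)).sqrt hS).congr_deriv ?_
    change _ / (2 * radiusFn X t) = _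
    rw [radiusFn']
    norm_num
    field_simp
  refine ⟨hR1, ?_⟩
  refine (((h0.mul h0').add (h1.mul h1')).div hR1 hR.ne').congr_deriv ?_
  simp only [Pi.add_apply, Pi.mul_apply]
  have : X t 0 * Xu X t 0 + X t 1 * Xu X t 1 = radiusFn X t * radiusFn' X t := by
    rw [radiusFn']; field_simp
  rw [this, radiusFn'']
  field_simp
  ring

/-- The first variation for vertical variations, in divergence form. -/
theorem Equivariant.deriv_secondMomentum (ha₀ : 0 ≤ a) (hX : Equivariant a k X)
    (hr : ∀ w ∈ openDom a, Reg X w) {s c₀ : ℝ} (hk : (k : ℝ) ≠ 0) (hs : s * |(k : ℝ)| = k) {t : ℝ}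
    (ht : t ∈ Ioo a 1) :
    deriv (secondMomentum c₀ k X) t + profileRatio k X t * fluxDensity c₀ X t =
      2 * (meanCurvature X t + c₀) * radiusFn X t * speedFn X t * (s / 2 *
        (-radiusFn'' X t / speedFn X t ^ 3
          - 3 * Xu X t 2 * (radiusFn' X t * Xu (Xu X) t 2 - Xu X t 2 * radiusFn'' X t)
            / speedFn X t ^ 5
          + radiusFn' X t ^ 2 / (radiusFn X t * speedFn X t ^ 3)))
      + (meanCurvature X t + c₀) ^ 2 * radiusFn X t * Xu X t 2 / speedFn X t := by
  have hP := hX.profile ha₀ hr hk hs ht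
  have hreg := hr _ (ofReal_mem_openDom ha₀ ht)
  obtain ⟨hR1, hR2⟩ := hasDerivAt_radiusFn hreg hP.R_pos
  have hq := hasDerivAt_comp_ofReal hreg.differentiableAt_Xu 2
  have hσ0 := hP.sigma_pos
  have hσ2 : speedFn X t ^ 2 = radiusFn' X t ^ 2 + Xu X t 2 ^ 2 := Real.sq_sqrt (by positivity)
  have hσ : HasDerivAt (speedFn X)
      ((radiusFn' X t * radiusFn'' X t + Xu X t 2 * Xu (Xu X) t 2) / speedFn X t) t := by
    refine (((hR2.pow 2).add (hq.pow 2)).sqrt (Real.sqrt_pos.1 hσ0).ne').congr_deriv ?_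
    change _ / (2 * speedFn X t) = _
    norm_num
    field_simp
  have hnear : ∀ᶠ t' in 𝓝 t, t' ∈ Ioo a 1 := isOpen_Ioo.mem_nhds ht
  have hrat : HasDerivAt (profileRatio k X) _ t :=
    (hR1.div hσ hσ0.ne').congr_of_eventuallyEq
      (by filter_upwards [hnear] with t' ht' using (hX.profile ha₀ hr hk hs ht').ratio)
  have hν : HasDerivAt (fun t : ℝ => unitNormal X t 2) _ t :=
    ((hR2.const_mul s).div hσ hσ0.ne').congr_of_eventuallyEq
      (by filter_upwards [hnear] with t' ht' using (hX.profile ha₀ hr hk hs ht').normal)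
  have hν' : HasDerivAt (fun t : ℝ => unitNormal X t 2)
      (fderiv ℝ (fun w => unitNormal X w 2) t 1) t :=
    fderiv_apply_one_eq_deriv (hreg.contDiffAt_unitNormal_two.differentiableAt (by norm_num))
  have hH : HasDerivAt (fun t : ℝ => meanCurvature X t) (fderiv ℝ (meanCurvature X) t 1) t :=
    fderiv_apply_one_eq_deriv (hreg.contDiffAt_meanCurvature.differentiableAt (by norm_num))
  have hνeq := hν'.unique hν
  have hM : HasDerivAt (secondMomentum c₀ k X) _ t := ((hH.add_const c₀).mul hν).mul hrat
  rw [hM.deriv, fluxDensity, hνeq, hP.ratio, hP.normal]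
  simp only [Pi.mul_apply, hP.normal]
  set σ := speedFn X t
  set R := radiusFn X t
  set R₁ := radiusFn' X t
  set q := Xu X t 2
  have hR0 := hP.R_pos.ne'
  have e1 : q ^ 2 = σ ^ 2 - R₁ ^ 2 := by linarith
  generalize fderiv ℝ (meanCurvature X) t 1 = h'
  generalize meanCurvature X t = h
  generalize radiusFn'' X t = R₂
  generalize Xu (Xu X) t 2 = q'
  clear_value σ R R₁ q
  -- On the left side of the claim the terms with `H'` cancel and the terms with `(H + c₀)²` already
  -- agree. What remains is `(H + c₀)(ν₃(R/σ)' + 2(R/σ)ν₃')`, whose second factor is evaluated here.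
  have key : s * R₁ / σ * ((R₁ * σ - R * ((R₁ * R₂ + q * q') / σ)) / σ ^ 2)
      + 2 * (R / σ) * ((s * R₂ * σ - s * R₁ * ((R₁ * R₂ + q * q') / σ)) / σ ^ 2)
      = 2 * R * σ * (s / 2 * (-R₂ / σ ^ 3 - 3 * q * (R₁ * q' - q * R₂) / σ ^ 5
        + R₁ ^ 2 / (R * σ ^ 3))) := by
    field_simp
    linear_combination (3 * R * R₂ * s) * hσ2
  linear_combination (h + c₀) * key

end


/-! ### Critical surfaces have constant vertical momentum -/

/-- The vertical field with height `φ(|w|)`. -/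
noncomputable def radialField (φ : ℝ → ℝ) (w : ℂ) : Fin 3 → ℝ := φ ‖w‖ • e₃

section
variable {a c₀ : ℝ} {k : ℤ} {X : ℂ → Fin 3 → ℝ} {φ : ℝ → ℝ}

theorem radialField_zero (w : ℂ) : radialField φ w 0 = 0 := by simp [radialField, e₃_zero]

theorem radialField_one (w : ℂ) : radialField φ w 1 = 0 := by simp [radialField, e₃_one]

theorem radialField_two (w : ℂ) : radialField φ w 2 = φ ‖w‖ := by simp [radialField, e₃_two]

theorem Equivariant.add_radialField (hX : Equivariant a k X) (ε : ℝ) :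
    Equivariant a k (fun w => X w + ε • radialField φ w) := by
  intro θ w hw
  have h := hX θ w hw
  apply ext3
  · simp only [Pi.add_apply, Pi.smul_apply, h, rotZ_zero', radialField_zero, radialField_one,
      smul_zero, add_zero]
  · simp only [Pi.add_apply, Pi.smul_apply, h, rotZ_one', radialField_zero, radialField_one,
      smul_zero, add_zero]
  · simp only [Pi.add_apply, Pi.smul_apply, h, rotZ_two, radialField_two, norm_exp_mul]

theorem jet_radialField (hφ : ContDiff ℝ 4 φ) (hV : ContDiff ℝ 4 (radialField φ)) {t : ℝ}
    (ht : 0 < t) :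
    (jet (radialField φ) t 1 0 = 0 ∧ jet (radialField φ) t 1 1 = 0 ∧
      jet (radialField φ) t 1 2 = deriv φ t) ∧
    (jet (radialField φ) t 3 0 = 0 ∧ jet (radialField φ) t 3 1 = 0 ∧
      jet (radialField φ) t 3 2 = deriv (deriv φ) t) := by
  have h1 : ∀ t : ℝ, 0 < t → Xu (radialField φ) t 0 = 0 ∧ Xu (radialField φ) t 1 = 0 ∧
      Xu (radialField φ) t 2 = deriv φ t := fun t ht => by
    have hd : DifferentiableAt ℝ (radialField φ) t := hV.contDiffAt.differentiableAt (by norm_num)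
    refine ⟨?_, ?_, ?_⟩
    · refine (hasDerivAt_comp_ofReal hd 0).unique ?_
      simp only [radialField_zero]
      exact hasDerivAt_const _ _
    · refine (hasDerivAt_comp_ofReal hd 1).unique ?_
      simp only [radialField_one]
      exact hasDerivAt_const _ _
    · refine (hasDerivAt_comp_ofReal hd 2).unique ?_
      refine (hφ.contDiffAt.differentiableAt (by norm_num)).hasDerivAt.congr_of_eventuallyEq ?_
      filter_upwards [lt_mem_nhds ht] with s hs
      rw [radialField_two, Complex.norm_real, Real.norm_of_nonneg hs.le]
  refine ⟨h1 t ht, ?_⟩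
  have hd : DifferentiableAt ℝ (Xu (radialField φ)) t :=
    (contDiffAt_Xu3 hV.contDiffAt).differentiableAt (by norm_num)
  refine ⟨?_, ?_, ?_⟩
  · refine (hasDerivAt_comp_ofReal hd 0).unique
      ((hasDerivAt_const t (0 : ℝ)).congr_of_eventuallyEq ?_)
    filter_upwards [lt_mem_nhds ht] with s hs using (h1 s hs).1
  · refine (hasDerivAt_comp_ofReal hd 1).unique
      ((hasDerivAt_const t (0 : ℝ)).congr_of_eventuallyEq ?_)
    filter_upwards [lt_mem_nhds ht] with s hs using (h1 s hs).2.1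
  · have hφ' : HasDerivAt (deriv φ) (deriv (deriv φ) t) t :=
      (((contDiff_succ_iff_deriv (n := 3)).1 (by
        simpa [show (3 : WithTop ℕ∞) + 1 = 4 by norm_num] using hφ)).2.2.contDiffAt.differentiableAt
          (by norm_num)).hasDerivAt
    refine (hasDerivAt_comp_ofReal hd 2).unique (hφ'.congr_of_eventuallyEq ?_)
    filter_upwards [lt_mem_nhds ht] with s hs using (h1 s hs).2.2

theorem lagrangianH_jetRot {c s : ℝ} (hcs : c ^ 2 + s ^ 2 = 1) (ψ : ℝ) (p : Jet) :
    lagrangianH c₀ (jetRot c s ψ p) = lagrangianH c₀ p := by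
  rw [lagrangianH, jetMean_jetRot hcs, jetArea_jetRot hcs, lagrangianH]

theorem exists_sign {k : ℝ} (hk : k ≠ 0) : ∃ s : ℝ, s * |k| = k := by
  refine ⟨k / |k|, ?_⟩
  have := abs_ne_zero.2 hk
  field_simp

/-- The first variation of the Helfrich energy for vertical radial fields. -/
theorem first_variation_radialField (ha₀ : 0 ≤ a) (hX : Equivariant a k X)
    (hr : ∀ w ∈ openDom a, Reg X w) (hk : (k : ℝ) ≠ 0) (hφ : ContDiff ℝ 4 φ)
    (hV : ContDiff ℝ 4 (radialField φ)) {w : ℂ} (hw : w ∈ openDom a) :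
    fderiv ℝ (lagrangianH c₀) (jet X w) (jet (radialField φ) w) =
      |(k : ℝ)| / ‖w‖ * (deriv φ ‖w‖ * (deriv (secondMomentum c₀ k X) ‖w‖
        + profileRatio k X ‖w‖ * fluxDensity c₀ X ‖w‖)
        + deriv (deriv φ) ‖w‖ * secondMomentum c₀ k X ‖w‖) := by
  obtain ⟨s, hs⟩ := exists_sign hk
  set t := ‖w‖ with ht
  have htI : t ∈ Ioo a 1 := hw
  have ht0 : 0 < t := ha₀.trans_lt htI.1
  have htw := ofReal_mem_openDom ha₀ htI
  have hreg := hr _ htw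
  have hP := hX.profile ha₀ hr hk hs htI
  -- The varied surface is again one of revolution, so the Lagrangian at `w` equals that at `|w|` on
  -- the real axis.
  have hwt : w = Complex.exp (w.arg * Complex.I) * (t : ℂ) := by
    rw [mul_comm]; exact (Complex.norm_mul_exp_arg_mul_I w).symm
  obtain ⟨⟨a10, a11, a12⟩, a30, a31, a32⟩ := jet_radialField hφ hV ht0
  set α := deriv φ t
  set β := deriv (deriv φ) t
  have hlam := hasDerivAt_profile_lagrangian (s := s) (c₀ := c₀) (q := Xu X t 2)
    (q' := Xu (Xu X) t 2) (α := α) (β := β) (R₂ := radiusFn'' X t) hP.R_pos hP.sigma_eq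
    hP.sigma_pos hP.mean
  refine fderiv_apply_eq_of_hasDerivAt
    ((contDiffAt_lagrangianH (n := 1) (hr w hw).2).differentiableAt one_ne_zero) ?_
  refine ((hlam.const_mul (|(k : ℝ)| / t)).congr_of_eventuallyEq ?_).congr_deriv ?_
  · have hpos : ∀ᶠ ε : ℝ in 𝓝 0, 0 < √(radiusFn' X t ^ 2 + (Xu X t 2 + ε * α) ^ 2) := by
      have hc : Continuous fun ε : ℝ => √(radiusFn' X t ^ 2 + (Xu X t 2 + ε * α) ^ 2) := by fun_prop
      refine hc.continuousAt.eventually (lt_mem_nhds ?_)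
      simp only [zero_mul, add_zero, ← hP.sigma_eq]
      exact hP.sigma_pos
    filter_upwards [hpos] with ε hε
    have hYe := hX.add_radialField (φ := φ) ε
    have hY4 : ∀ w ∈ openDom a, ContDiffAt ℝ 4 (fun w => X w + ε • radialField φ w) w :=
      fun w hw => (hr w hw).1.add (hV.const_smul ε).contDiffAt
    rw [← jet_add_smul (hr w hw).1 hV, hwt, hYe.jet_rot hY4 _ htw,
      lagrangianH_jetRot (Real.cos_sq_add_sin_sq _)]
    obtain ⟨h2, h4, h5⟩ := hYe.jet_real hY4 htw
    set p := jet (fun w => X w + ε • radialField φ w) t with hp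
    have hpe : p = jet X t + ε • jet (radialField φ) t := jet_add_smul hreg.1 hV ε
    have hpi : ∀ i j, p i j = jet X t i j + ε * jet (radialField φ) t i j := fun i j => by
      rw [hpe]; rfl
    have p00 : p 0 0 = X t 0 := by
      rw [hpi, jet_zero, jet_zero, radialField_zero, mul_zero, add_zero]
    have p01 : p 0 1 = X t 1 := by
      rw [hpi, jet_zero, jet_zero, radialField_one, mul_zero, add_zero]
    have p10 : p 1 0 = Xu X t 0 := by rw [hpi, a10, mul_zero, add_zero, jet_one]
    have p11 : p 1 1 = Xu X t 1 := by rw [hpi, a11, mul_zero, add_zero, jet_one]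
    have p12 : p 1 2 = Xu X t 2 + ε * α := by rw [hpi, a12, jet_one]
    have p30 : p 3 0 = Xu (Xu X) t 0 := by rw [hpi, a30, mul_zero, add_zero, jet_three]
    have p31 : p 3 1 = Xu (Xu X) t 1 := by rw [hpi, a31, mul_zero, add_zero, jet_three]
    have p32 : p 3 2 = Xu (Xu X) t 2 + ε * β := by rw [hpi, a32, jet_three]
    obtain ⟨hA, -, hH⟩ := jet_profile (p := p) (R := radiusFn X t) (R₁ := radiusFn' X t)
      (R₂ := radiusFn'' X t) ht0 hk hs hP.R_pos (by rw [p00, p01, hP.R_sq])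
      (by rw [p00, p01, p10, p11, hP.R_mul]) (by rw [p00, p01, p10, p11, p30, p31, hP.R_mul'])
      h2 h4 h5 (by rw [p12]) hε
    rw [lagrangianH, hA, hH, profileMean, p12, p32]
    ring
  · rw [hX.deriv_secondMomentum ha₀ hr hk hs htI, secondMomentum, hP.ratio, hP.normal]
    ring

end


/-! ### One-dimensional calculus of variations -/

section
variable {a b : ℝ}

theorem contDiffAt_deriv {f : ℝ → ℝ} {t : ℝ} {n m : WithTop ℕ∞} (h : ContDiffAt ℝ n f t)
    (hm : m + 1 ≤ n) : ContDiffAt ℝ m (deriv f) t :=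
  (h.fderiv_right hm).clm_apply contDiffAt_const

theorem deriv_eq_zero_of_eqOn_const {f : ℝ → ℝ} {s : Set ℝ} {c t : ℝ} (hf : DifferentiableAt ℝ f t)
    (hs : UniqueDiffOn ℝ s) (h : ∀ t ∈ s, f t = c) (ht : t ∈ s) : deriv f t = 0 := by
  rw [← hf.derivWithin (hs t ht), derivWithin_congr (f := fun _ => c) h (h t ht)]
  exact congrFun (derivWithin_const s c) t

theorem integral_deriv_mul_add_mul_deriv {f g : ℝ → ℝ} {r₁ r₂ : ℝ} (h : r₁ ≤ r₂)
    (hf : ∀ t ∈ Icc r₁ r₂, ContDiffAt ℝ 1 f t) (hg : ∀ t ∈ Icc r₁ r₂, ContDiffAt ℝ 1 g t)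
    (h₁ : f r₁ = 0) (h₂ : f r₂ = 0) :
    ∫ t in r₁..r₂, (deriv f t * g t + f t * deriv g t) = 0 := by
  have hc : ∀ {f : ℝ → ℝ}, (∀ t ∈ Icc r₁ r₂, ContDiffAt ℝ 1 f t) →
      ContinuousOn f (uIcc r₁ r₂) ∧ ContinuousOn (deriv f) (uIcc r₁ r₂) := fun {f} hf => by
    rw [uIcc_of_le h]
    exact ⟨fun t ht => (hf t ht).continuousAt.continuousWithinAt, fun t ht =>
      (contDiffAt_deriv (m := 0) (hf t ht) (by simp)).continuousAt.continuousWithinAt⟩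
  rw [intervalIntegral.integral_eq_sub_of_hasDerivAt (f := fun t => f t * g t)]
  · rw [h₁, h₂]; ring
  · intro t ht
    rw [uIcc_of_le h] at ht
    exact ((hf t ht).differentiableAt one_ne_zero).hasDerivAt.mul
      ((hg t ht).differentiableAt one_ne_zero).hasDerivAt
  · exact (((hc hf).2.mul (hc hg).1).add ((hc hf).1.mul (hc hg).2)).intervalIntegrable

/-- The lemma of du Bois-Reymond. -/
theorem deriv_eq_zero_of_forall_integral_deriv_mul {m : ℝ → ℝ}
    (hm : ∀ t ∈ Ioo a b, ContDiffAt ℝ 1 m t)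
    (h : ∀ φ : ℝ → ℝ, ContDiff ℝ (⊤ : ℕ∞) φ → ∀ r₁ r₂, a < r₁ → r₁ < r₂ → r₂ < b →
      (∀ t ≤ r₁, φ t = 0) → (∀ t, r₂ ≤ t → φ t = 0) → ∫ t in r₁..r₂, deriv φ t * m t = 0) :
    ∀ t ∈ Ioo a b, deriv m t = 0 := by
  have hm' : ContinuousOn (deriv m) (Ioo a b) := fun t ht =>
    (contDiffAt_deriv (m := 0) (hm t ht) (by simp)).continuousAt.continuousWithinAt
  have hae : ∀ᵐ t, t ∈ Ioo a b → deriv m t = 0 := by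
    refine isOpen_Ioo.ae_eq_zero_of_integral_contDiff_smul_eq_zero
      (hm'.locallyIntegrableOn measurableSet_Ioo) fun φ hφ hφc hφs => ?_
    rcases (tsupport φ).eq_empty_or_nonempty with he | hne
    · rw [tsupport_eq_empty_iff] at he
      simp [he]
    obtain ⟨l₁, hl₁, hl₁'⟩ := hφc.exists_isLeast hne
    obtain ⟨l₂, hl₂, hl₂'⟩ := hφc.exists_isGreatest hne
    -- The numbers `r₁` and `r₂` are chosen strictly between the support of `φ` and the ends of the
    -- interval.
    obtain ⟨r₁, har, hr₁⟩ := exists_between (hφs hl₁).1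
    obtain ⟨r₂, hr₂, hrb⟩ := exists_between (hφs hl₂).2
    have h1 : ∀ t ≤ r₁, φ t = 0 := fun t ht => by
      by_contra h0
      exact (hl₁' (subset_tsupport _ h0)).not_gt (ht.trans_lt hr₁)
    have h2 : ∀ t, r₂ ≤ t → φ t = 0 := fun t ht => by
      by_contra h0
      exact (hl₂' (subset_tsupport _ h0)).not_gt (hr₂.trans_le ht)
    have hlt : r₁ < r₂ := hr₁.trans_le ((hl₁' hl₂).trans hr₂.le)
    have hsub : Icc r₁ r₂ ⊆ Ioo a b := fun t ht => ⟨har.trans_le ht.1, ht.2.trans_lt hrb⟩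
    have key := integral_deriv_mul_add_mul_deriv hlt.le
      (fun t _ => hφ.contDiffAt.of_le (by exact_mod_cast le_top))
      (fun t ht => hm t (hsub ht)) (h1 _ le_rfl) (h2 _ le_rfl)
    have hI1 : IntervalIntegrable (fun t => deriv φ t * m t) volume r₁ r₂ := by
      refine ContinuousOn.intervalIntegrable ?_
      rw [uIcc_of_le hlt.le]
      exact (hφ.continuous_deriv (by exact_mod_cast le_top)).continuousOn.mul
        fun t ht => (hm t (hsub ht)).continuousAt.continuousWithinAt
    have hI2 : IntervalIntegrable (fun t => φ t * deriv m t) volume r₁ r₂ := by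
      refine ContinuousOn.intervalIntegrable ?_
      rw [uIcc_of_le hlt.le]
      exact hφ.continuous.continuousOn.mul (hm'.mono hsub)
    rw [intervalIntegral.integral_add hI1 hI2, h φ hφ r₁ r₂ har hlt hrb h1 h2, zero_add,
      intervalIntegral.integral_of_le hlt.le] at key
    rw [← key, setIntegral_eq_integral_of_forall_compl_eq_zero]
    · rfl
    · intro t ht
      rw [mem_Ioc, not_and_or, not_lt, not_le] at ht
      rcases ht with ht | ht
      · rw [h1 t ht, zero_mul]
      · rw [h2 t ht.le, zero_mul]
  exact Measure.eqOn_open_of_ae_eq (g := fun _ => 0)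
    ((ae_restrict_iff' measurableSet_Ioo).2 hae) isOpen_Ioo hm' continuousOn_const

/-- Integration in polar coordinates of a radial function. -/
theorem setIntegral_fun_norm {g : ℝ → ℝ} (ha₀ : 0 ≤ a) :
    ∫ w in openDom a, g ‖w‖ = 2 * Real.pi * ∫ t in Ioo a 1, t * g t := by
  have h1 := integral_fun_norm_addHaar (volume : Measure ℂ) ((Ioo a 1).indicator g)
  have h2 : (fun w : ℂ => (Ioo a 1).indicator g ‖w‖) = (openDom a).indicator fun w => g ‖w‖ := rfl
  rw [h2, integral_indicator (isOpen_openDom a).measurableSet] at h1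
  rw [h1]
  have h3 : ∀ t : ℝ, t ^ (Module.finrank ℝ ℂ - 1) • (Ioo a 1).indicator g t
      = (Ioo a 1).indicator (fun t => t * g t) t := fun t => by
    rw [Complex.finrank_real_complex]
    by_cases ht : t ∈ Ioo a 1 <;> simp [ht]
  simp only [h3]
  rw [setIntegral_indicator measurableSet_Ioo,
    inter_eq_right.2 (show Ioo a 1 ⊆ Ioi 0 from fun t ht => ha₀.trans_lt ht.1)]
  simp [Complex.finrank_real_complex, Measure.real, Complex.volume_ball]
  ring

theorem setIntegral_dom_eq {F : ℂ → ℝ} : ∫ w in dom a, F w = ∫ w in openDom a, F w := by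
  refine setIntegral_congr_set (eventuallyLE_antisymm_iff.2 ⟨?_, ?_⟩)
  · have h1 : ∀ r, ∀ᵐ w : ℂ, w ∉ Metric.sphere 0 r := fun r =>
      measure_eq_zero_iff_ae_notMem.1 (Measure.addHaar_sphere _ _ _)
    filter_upwards [h1 a, h1 1] with w ha h1 hw
    rw [mem_sphere_zero_iff_norm] at ha h1
    exact ⟨lt_of_le_of_ne hw.1 (Ne.symm ha), lt_of_le_of_ne hw.2 h1⟩
  · exact (openDom_subset_dom a).eventuallyLE

end

/-! ### Radial test fields and conservation of the vertical momentum -/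

section
variable {a c₀ c r₁ r₂ : ℝ} {k : ℤ} {X : ℂ → Fin 3 → ℝ} {φ : ℝ → ℝ}

/-- The norm is not smooth at the origin, but there `φ(|w|)` is locally constant. -/
theorem contDiff_radialField (hφ : ContDiff ℝ 4 φ) (hr : 0 < r₁) (h : ∀ t ≤ r₁, φ t = c) :
    ContDiff ℝ 4 (radialField φ) := by
  rw [contDiff_iff_contDiffAt]
  intro w
  by_cases hw : w = 0
  · subst hw
    refine (contDiffAt_const (c := c • e₃)).congr_of_eventuallyEq ?_
    filter_upwards [Metric.ball_mem_nhds (0 : ℂ) hr] with w hw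
    rw [mem_ball_zero_iff] at hw
    rw [radialField, h _ hw.le]
  · exact ((hφ.contDiffAt.comp w (contDiffAt_norm ℝ hw)).smul contDiffAt_const)

/-- Either the field vanishes near the inner circle, or the domain is a disc, whose centre is an
interior point, so that the value `c` near the centre is unrestricted. -/
theorem tsupport_radialField_subset (har : a < r₁) (hr : r₂ < 1)
    (h₁ : ∀ t ≤ r₁, φ t = c) (h₂ : ∀ t, r₂ ≤ t → φ t = 0) (hc : c = 0 ∨ a = 0) :
    tsupport (radialField φ) ⊆ interior (dom a) := by
  have hle : tsupport (radialField φ) ⊆ {w | ‖w‖ ≤ r₂} := by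
    refine closure_minimal (fun w hw => ?_) (isClosed_le continuous_norm continuous_const)
    by_contra hlt
    exact hw (by rw [radialField, h₂ _ (not_le.1 hlt).le, zero_smul])
  rcases hc with rfl | rfl
  · refine Subset.trans (fun w hw => ?_) (openDom_subset_interior a)
    have hge : tsupport (radialField φ) ⊆ {w | r₁ ≤ ‖w‖} := by
      refine closure_minimal (fun w hw => ?_) (isClosed_le continuous_const continuous_norm)
      by_contra hlt
      exact hw (by rw [radialField, h₁ _ (not_le.1 hlt).le, zero_smul])
    exact ⟨har.trans_le (hge hw), (hle hw).trans_lt hr⟩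
  · refine hle.trans (Subset.trans (b := Metric.ball 0 1) (fun w hw => ?_)
      (interior_maximal (fun w hw => ?_) Metric.isOpen_ball))
    · exact mem_ball_zero_iff.2 (lt_of_le_of_lt hw hr)
    · exact ⟨norm_nonneg _, (mem_ball_zero_iff.1 hw).le⟩

/-- The vertical momentum of a surface of revolution. -/
noncomputable def momentum (c₀ : ℝ) (k : ℤ) (X : ℂ → Fin 3 → ℝ) (t : ℝ) : ℝ :=
  profileRatio k X t * fluxDensity c₀ X t

theorem Reg.contDiffAt_momentum {t : ℝ} (h : Reg X t) (ht : t ≠ 0) :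
    ContDiffAt ℝ 1 (momentum c₀ k X) t :=
  ((h.contDiffAt_profileRatio ht).of_le (by norm_num)).mul h.contDiffAt_fluxDensity

theorem four_le_top : (4 : WithTop ℕ∞) ≤ ((⊤ : ℕ∞) : WithTop ℕ∞) :=
  WithTop.coe_le_coe.2 (le_top : (4 : ℕ∞) ≤ ⊤)

/-- Criticality for vertical radial fields, after an integration by parts. -/
theorem integral_deriv_mul_momentum (ha₀ : 0 ≤ a) (hX : Equivariant a k X)
    (hr : ∀ w ∈ dom a, Reg X w) (hk : (k : ℝ) ≠ 0) (hcrit : HelfrichCritical X a c₀)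
    (hφ : ContDiff ℝ (⊤ : ℕ∞) φ) (har : a < r₁) (hlt : r₁ < r₂) (hrb : r₂ < 1)
    (h₁ : ∀ t ≤ r₁, φ t = c) (h₂ : ∀ t, r₂ ≤ t → φ t = 0) (hc : c = 0 ∨ a = 0) :
    ∫ t in r₁..r₂, deriv φ t * momentum c₀ k X t = 0 := by
  have hr' : ∀ w ∈ openDom a, Reg X w := fun w hw => hr w (openDom_subset_dom a hw)
  have hφ4 : ContDiff ℝ 4 φ := hφ.of_le four_le_top
  have hφ' : ContDiff ℝ 2 (deriv φ) := contDiff_iff_contDiffAt.2 fun _ =>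
    contDiffAt_deriv hφ4.contDiffAt (by norm_num)
  have hφd : ∀ t, DifferentiableAt ℝ φ t := fun _ => hφ4.contDiffAt.differentiableAt (by norm_num)
  have hV := contDiff_radialField hφ4 (ha₀.trans_lt har) h₁
  have hI := (hasDerivAt_helfrich (c₀ := c₀) hr hV).unique
    (hcrit _ hV (tsupport_radialField_subset har hrb h₁ h₂ hc))
  rw [setIntegral_dom_eq, setIntegral_congr_fun (isOpen_openDom a).measurableSet
    fun w hw => first_variation_radialField ha₀ hX hr' hk hφ4 hV hw] at hI
  rw [setIntegral_fun_norm (g := fun t => |(k : ℝ)| / t * (deriv φ t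
    * (deriv (secondMomentum c₀ k X) t + profileRatio k X t * fluxDensity c₀ X t)
    + deriv (deriv φ) t * secondMomentum c₀ k X t)) ha₀] at hI
  have hd1 : ∀ t ≤ r₁, deriv φ t = 0 := fun t =>
    deriv_eq_zero_of_eqOn_const (hφd t) (uniqueDiffOn_Iic r₁) h₁
  have hd2 : ∀ t, r₂ ≤ t → deriv φ t = 0 := fun t =>
    deriv_eq_zero_of_eqOn_const (hφd t) (uniqueDiffOn_Ici r₂) h₂
  have hdd1 : ∀ t < r₁, deriv (deriv φ) t = 0 := fun t ht => by
    have : deriv φ =ᶠ[𝓝 t] fun _ => 0 := by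
      filter_upwards [gt_mem_nhds ht] with s hs using hd1 s hs.le
    rw [this.deriv_eq, deriv_const]
  have hdd2 : ∀ t, r₂ < t → deriv (deriv φ) t = 0 := fun t ht => by
    have : deriv φ =ᶠ[𝓝 t] fun _ => 0 := by
      filter_upwards [lt_mem_nhds ht] with s hs using hd2 s hs.le
    rw [this.deriv_eq, deriv_const]
  have hsub : Icc r₁ r₂ ⊆ Ioo a 1 := fun t ht => ⟨har.trans_le ht.1, ht.2.trans_lt hrb⟩
  have hreg : ∀ t ∈ Icc r₁ r₂, Reg X t ∧ t ≠ 0 := fun t ht =>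
    ⟨hr' _ (ofReal_mem_openDom ha₀ (hsub ht)), (ha₀.trans_lt (hsub ht).1).ne'⟩
  -- The weight `t` of polar coordinates cancels the factor `1/t` of the area density, and the
  -- integral is confined to `[r₁, r₂]`, since `φ'` and `φ''` vanish outside.
  have hI2 : ∫ t in r₁..r₂, |(k : ℝ)| * ((deriv (deriv φ) t * secondMomentum c₀ k X t
      + deriv φ t * deriv (secondMomentum c₀ k X) t) + deriv φ t * momentum c₀ k X t) = 0 := by
    have h0 := (mul_eq_zero.1 hI).resolve_left (by positivity)
    rw [intervalIntegral.integral_of_le hlt.le, ← integral_Icc_eq_integral_Ioc, ← h0,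
      ← setIntegral_eq_of_subset_of_forall_sdiff_eq_zero measurableSet_Ioo hsub]
    · refine setIntegral_congr_fun measurableSet_Ioo fun t ht => ?_
      have : t ≠ 0 := (ha₀.trans_lt ht.1).ne'
      simp only [momentum]
      field_simp
      ring
    · rintro t ⟨-, ht⟩
      rw [mem_Icc, not_and_or, not_le, not_le] at ht
      rcases ht with ht | ht
      · rw [hd1 t ht.le, hdd1 t ht]; ring
      · rw [hd2 t ht.le, hdd2 t ht]; ring
  have hSM : ∀ t ∈ Icc r₁ r₂, ContDiffAt ℝ 1 (secondMomentum c₀ k X) t := fun t ht =>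
    ((hreg t ht).1.contDiffAt_secondMomentum (hreg t ht).2).of_le (by norm_num)
  have hm : ∀ t ∈ Icc r₁ r₂, ContDiffAt ℝ 1 (momentum c₀ k X) t := fun t ht =>
    (hreg t ht).1.contDiffAt_momentum (hreg t ht).2
  -- The terms with the second momentum form the derivative of its product with `φ'`, which vanishes
  -- at both ends.
  have key := integral_deriv_mul_add_mul_deriv hlt.le
    (fun t _ => hφ'.contDiffAt.of_le (by norm_num)) hSM (hd1 _ le_rfl) (hd2 _ le_rfl)
  rw [intervalIntegral.integral_const_mul] at hI2
  have h0 := (mul_eq_zero.1 hI2).resolve_left (abs_ne_zero.2 hk)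
  rw [intervalIntegral.integral_add, key, zero_add] at h0
  · exact h0
  · refine ContinuousOn.intervalIntegrable ?_
    rw [uIcc_of_le hlt.le]
    refine ContinuousOn.add (ContinuousOn.mul ?_ ?_) (ContinuousOn.mul ?_ ?_)
    · exact (hφ'.continuous_deriv (by norm_num)).continuousOn
    · exact fun t ht => (hSM t ht).continuousAt.continuousWithinAt
    · exact hφ'.continuous.continuousOn
    · exact fun t ht =>
        (contDiffAt_deriv (m := 0) (hSM t ht) (by simp)).continuousAt.continuousWithinAt
  · refine ContinuousOn.intervalIntegrable ?_
    rw [uIcc_of_le hlt.le]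
    exact hφ'.continuous.continuousOn.mul fun t ht => (hm t ht).continuousAt.continuousWithinAt

/-- The vertical momentum of a critical surface is constant; on a disc it vanishes. -/
theorem HelfrichCritical.exists_momentum_eq (ha₀ : 0 ≤ a) (ha₁ : a < 1) (hX : Equivariant a k X)
    (hr : ∀ w ∈ dom a, Reg X w) (hk : (k : ℝ) ≠ 0) (hcrit : HelfrichCritical X a c₀) :
    ∃ m₀ : ℝ, (∀ t ∈ Ioo a 1, momentum c₀ k X t = m₀) ∧ (a = 0 → m₀ = 0) := by
  have hm : ∀ t ∈ Ioo a 1, ContDiffAt ℝ 1 (momentum c₀ k X) t := fun t ht =>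
    (hr _ (openDom_subset_dom a (ofReal_mem_openDom ha₀ ht))).contDiffAt_momentum
      (ha₀.trans_lt ht.1).ne'
  have hd := deriv_eq_zero_of_forall_integral_deriv_mul hm fun φ hφ r₁ r₂ h1 h2 h3 h4 h5 =>
    integral_deriv_mul_momentum ha₀ hX hr hk hcrit hφ h1 h2 h3 h4 h5 (Or.inl rfl)
  obtain ⟨m₀, hm₀⟩ := isOpen_Ioo.exists_is_const_of_deriv_eq_zero isPreconnected_Ioo
    (fun t ht => ((hm t ht).differentiableAt one_ne_zero).differentiableWithinAt) hd
  refine ⟨m₀, hm₀, ?_⟩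
  rintro rfl
  -- A cutoff equal to `1` for `t ≤ 1/3` and to `0` for `t ≥ 2/3`; it is admissible on the disc.
  -- Since `∫ φ' = -1`, the identity reads `-m₀ = 0`.
  set φ : ℝ → ℝ := fun t => Real.smoothTransition (2 - 3 * t) with hφ
  have hφs : ContDiff ℝ (⊤ : ℕ∞) φ := Real.smoothTransition.contDiff.comp (by fun_prop)
  have h1 : ∀ t ≤ (1 / 3 : ℝ), φ t = 1 := fun t ht =>
    Real.smoothTransition.one_of_one_le (by linarith)
  have h2 : ∀ t, (2 / 3 : ℝ) ≤ t → φ t = 0 := fun t ht =>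
    Real.smoothTransition.zero_of_nonpos (by linarith)
  have h0 := integral_deriv_mul_momentum ha₀ hX hr hk hcrit hφs (by norm_num) (by norm_num)
    (by norm_num) h1 h2 (Or.inr rfl)
  rw [intervalIntegral.integral_congr (g := fun t => deriv φ t * m₀) fun t ht => by
    rw [uIcc_of_le (by norm_num)] at ht
    simp only
    rw [hm₀ t ⟨by linarith [ht.1], by linarith [ht.2]⟩], intervalIntegral.integral_mul_const,
    intervalIntegral.integral_deriv_eq_sub (fun t _ => hφs.differentiable (by simp) t)
      (hφs.continuous_deriv (by exact_mod_cast le_top)).continuousOn.intervalIntegrable,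
    h1 _ le_rfl, h2 _ le_rfl] at h0
  linarith

end


/-! ### The flux through parallels -/

section
variable {a : ℝ} {f : ℂ → ℝ}

theorem fderiv_rot_of_radial
    (hf : ∀ θ : ℝ, ∀ w ∈ openDom a, f (Complex.exp (θ * Complex.I) * w) = f w)
    (hd : ∀ w ∈ openDom a, DifferentiableAt ℝ f w) (θ : ℝ) {w : ℂ} (hw : w ∈ openDom a) :
    fderiv ℝ f (Complex.exp (θ * Complex.I) * w) (Complex.exp (θ * Complex.I) * w)
      = fderiv ℝ f w w := by
  set e := Complex.exp (θ * Complex.I)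
  have h1 : HasFDerivAt (fun v : ℂ => f (e * v)) _ w :=
    (hd _ (exp_mul_mem_openDom θ hw)).hasFDerivAt.comp w
      ((ContinuousLinearMap.mul ℝ ℂ e).hasFDerivAt)
  have h2 : (fun v : ℂ => f (e * v)) =ᶠ[𝓝 w] f := by
    filter_upwards [(isOpen_openDom a).mem_nhds hw] with v hv using hf θ v hv
  have h3 := h2.fderiv_eq (𝕜 := ℝ)
  rw [h1.fderiv] at h3
  exact congrArg (fun L => L w) h3

theorem fderiv_I_mul_of_radial
    (hf : ∀ θ : ℝ, ∀ w ∈ openDom a, f (Complex.exp (θ * Complex.I) * w) = f w)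
    {w : ℂ} (hd : DifferentiableAt ℝ f w) (hw : w ∈ openDom a) :
    fderiv ℝ f w (Complex.I * w) = 0 := by
  have hexp : HasDerivAt (fun θ : ℝ => Complex.exp (θ * Complex.I) * w) (Complex.I * w) 0 := by
    have h1 : HasDerivAt (fun θ : ℝ => (θ : ℂ) * Complex.I) Complex.I 0 := by
      simpa using (Complex.ofRealCLM.hasDerivAt (x := (0 : ℝ))).mul_const Complex.I
    simpa using (h1.cexp).mul_const w
  have hd' : HasFDerivAt f (fderiv ℝ f w) (Complex.exp (((0 : ℝ) : ℂ) * Complex.I) * w) := by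
    simpa using hd.hasFDerivAt
  exact (hd'.comp_hasDerivAt (0 : ℝ) hexp).unique
    ((hasDerivAt_const (0 : ℝ) (f w)).congr_of_eventuallyEq (.of_forall fun θ => hf θ w hw))

theorem exp_mul_mem_dom {w : ℂ} (θ : ℝ) (hw : w ∈ dom a) :
    Complex.exp (θ * Complex.I) * w ∈ dom a := by
  rw [dom, mem_ofPred_eq, norm_exp_mul]; exact hw

/-- Rotationally invariant functions, up to the boundary. -/
theorem radial_dom (ha₀ : 0 ≤ a) (ha₁ : a < 1)
    (hf : ∀ θ : ℝ, ∀ w ∈ openDom a, f (Complex.exp (θ * Complex.I) * w) = f w)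
    (hd : ∀ w ∈ dom a, ContDiffAt ℝ 1 f w) (θ : ℝ) {w : ℂ} (hw : w ∈ dom a) :
    f (Complex.exp (θ * Complex.I) * w) = f w ∧
    fderiv ℝ f (Complex.exp (θ * Complex.I) * w)
      (Complex.I * (Complex.exp (θ * Complex.I) * w)) = 0 ∧
    fderiv ℝ f (Complex.exp (θ * Complex.I) * w) (Complex.exp (θ * Complex.I) * w)
      = fderiv ℝ f w w := by
  set e := Complex.exp (θ * Complex.I) with he
  have hmaps : MapsTo (fun w => e * w) (dom a) (dom a) := fun w hw => exp_mul_mem_dom θ hw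
  have hdo : ∀ w ∈ openDom a, DifferentiableAt ℝ f w := fun w hw =>
    (hd w (openDom_subset_dom a hw)).differentiableAt one_ne_zero
  have hc : ContinuousOn f (dom a) := fun w hw => (hd w hw).continuousAt.continuousWithinAt
  have hc' : ContinuousOn (fderiv ℝ f) (dom a) := fun w hw =>
    ((hd w hw).fderiv_right (m := 0) (by simp)).continuousAt.continuousWithinAt
  have hm : ContinuousOn (fun w : ℂ => e * w) (dom a) := by fun_prop
  have hz : EqOn (fun w => fderiv ℝ f w (Complex.I * w)) (fun _ => 0) (dom a) :=
    eqOn_dom_of_eqOn_openDom ha₀ ha₁ (hc'.clm_apply (by fun_prop)) continuousOn_const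
      fun w hw => fderiv_I_mul_of_radial hf (hdo w hw) hw
  exact ⟨eqOn_dom_of_eqOn_openDom ha₀ ha₁ (f := fun w => f (e * w)) (hc.comp hm hmaps) hc
      (fun w hw => hf θ w hw) hw, hz (hmaps hw),
    eqOn_dom_of_eqOn_openDom ha₀ ha₁ (f := fun w => fderiv ℝ f (e * w) (e * w))
      (g := fun w => fderiv ℝ f w w) ((hc'.comp hm hmaps).clm_apply hm)
      (hc'.clm_apply continuousOn_id) (fun w hw => fderiv_rot_of_radial hf hdo θ hw) hw⟩

end

section
variable {a c₀ : ℝ} {k : ℤ} {X : ℂ → Fin 3 → ℝ}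

theorem dot_self_pos {v : Fin 3 → ℝ} (hv : v ≠ 0) : 0 < v ⬝ᵥ v :=
  lt_of_le_of_ne (dot_self_nonneg v) fun h => hv (dotProduct_self_eq_zero.1 h.symm)

/-- The vertical flux is a positive multiple of its density on the real axis. -/
theorem verticalFlux_eq_zero_iff (ha₀ : 0 ≤ a) (ha₁ : a < 1) (hX : Equivariant a k X)
    (hr : ∀ w ∈ dom a, Reg X w) (hinj : ∀ w ∈ dom a, Function.Injective (fderiv ℝ X w)) {ρ : ℝ}
    (hρ : ρ ∈ Icc a 1) (hρ0 : 0 < ρ) : verticalFlux X c₀ ρ = 0 ↔ fluxDensity c₀ X ρ = 0 := by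
  have hr4 : ∀ w ∈ openDom a, ContDiffAt ℝ 4 X w := fun w hw => (hr w (openDom_subset_dom a hw)).1
  have hρd : (ρ : ℂ) ∈ dom a := by
    rw [dom, mem_ofPred_eq, Complex.norm_real, Real.norm_of_nonneg hρ0.le]; exact hρ
  set γ : ℝ → ℂ := fun θ => ρ * Complex.exp (θ * Complex.I) with hγ
  have hγe : ∀ θ, γ θ = Complex.exp (θ * Complex.I) * ρ := fun θ => mul_comm _ _
  have hγd : ∀ θ, γ θ ∈ dom a := fun θ => by rw [hγe]; exact exp_mul_mem_dom θ hρd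
  have hγ0 : ∀ θ, γ θ ≠ 0 := fun θ =>
    mul_ne_zero (Complex.ofReal_ne_zero.2 hρ0.ne') (Complex.exp_ne_zero _)
  have hγc : Continuous γ := by fun_prop
  set T : ℝ → Fin 3 → ℝ := fun θ => fderiv ℝ X (γ θ) (Complex.I * γ θ) with hT
  set lam : ℝ → ℝ := fun θ => (fderiv ℝ X (γ θ) (γ θ) ⬝ᵥ T θ) / (T θ ⬝ᵥ T θ) with hlam
  set d : ℝ → ℂ := fun θ => γ θ - lam θ • (Complex.I * γ θ) with hd
  set D : ℝ → Fin 3 → ℝ := fun θ => fderiv ℝ X (γ θ) (d θ) with hD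
  set K : ℝ → ℝ := fun θ => (√(D θ ⬝ᵥ D θ))⁻¹ * √(T θ ⬝ᵥ T θ) with hK
  have hne : ∀ θ v, v ≠ 0 → 0 < fderiv ℝ X (γ θ) v ⬝ᵥ fderiv ℝ X (γ θ) v := fun θ v hv =>
    dot_self_pos fun h0 => hv (hinj _ (hγd θ) (by rw [h0, map_zero]))
  have hTpos : ∀ θ, 0 < T θ ⬝ᵥ T θ := fun θ => hne θ _ (mul_ne_zero Complex.I_ne_zero (hγ0 θ))
  have hDpos : ∀ θ, 0 < D θ ⬝ᵥ D θ := fun θ => by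
    refine hne θ _ ?_
    -- The first factor has real part `1`, so the conormal direction is not zero.
    have : d θ = (1 - lam θ * Complex.I) * γ θ := by
      simp only [hd, Complex.real_smul]; ring
    rw [this]
    refine mul_ne_zero (fun h => ?_) (hγ0 θ)
    simpa using congrArg Complex.re h
  have hfc : Continuous fun θ => fderiv ℝ X (γ θ) := continuous_iff_continuousAt.2 fun θ =>
    ContinuousAt.comp (f := γ)
      (((hr _ (hγd θ)).1.fderiv_right (m := 3) (by norm_num)).continuousAt) hγc.continuousAt
  have hTc : Continuous T := hfc.clm_apply (by fun_prop)
  have hlc : Continuous lam := ((hfc.clm_apply hγc).dotProduct hTc).div (hTc.dotProduct hTc)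
    fun θ => (hTpos θ).ne'
  have hdc : Continuous d := hγc.sub (hlc.smul (by fun_prop))
  have hDc : Continuous D := hfc.clm_apply hdc
  have hKc : Continuous K := ((hDc.dotProduct hDc).sqrt.inv₀
    fun θ => (Real.sqrt_pos.2 (hDpos θ)).ne').mul (hTc.dotProduct hTc).sqrt
  have hKpos : 0 < ∫ θ in (0 : ℝ)..(2 * Real.pi), K θ :=
    intervalIntegral.intervalIntegral_pos_of_pos (hKc.intervalIntegrable _ _)
      (fun θ => mul_pos (inv_pos.2 (Real.sqrt_pos.2 (hDpos θ))) (Real.sqrt_pos.2 (hTpos θ)))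
      (by positivity)
  have hn : ∀ θ, conormal X (γ θ) = (√(D θ ⬝ᵥ D θ))⁻¹ • d θ := fun θ => rfl
  -- For a rotationally invariant function the angular part of the conormal contributes nothing, and
  -- the radial derivative is the same all along the parallel. Hence each conormal derivative is a
  -- positive factor times the derivative on the real axis.
  have hrad : ∀ f : ℂ → ℝ,
      (∀ θ : ℝ, ∀ w ∈ openDom a, f (Complex.exp (θ * Complex.I) * w) = f w) →
      (∀ w ∈ dom a, ContDiffAt ℝ 1 f w) → ∀ θ, f (γ θ) = f ρ ∧
        fderiv ℝ f (γ θ) (conormal X (γ θ)) = (√(D θ ⬝ᵥ D θ))⁻¹ * (ρ * fderiv ℝ f ρ 1) :=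
    fun f hf hfd θ => by
      obtain ⟨h1, h2, h3⟩ := radial_dom ha₀ ha₁ hf hfd θ hρd
      rw [← hγe] at h1 h2 h3
      refine ⟨h1, ?_⟩
      have h4 : fderiv ℝ f ρ (ρ : ℂ) = ρ * fderiv ℝ f ρ 1 := by
        rw [← smul_eq_mul, ← map_smul, Complex.real_smul, mul_one]
      rw [hn, map_smul, smul_eq_mul, hd, map_sub, map_smul, h2, h3, smul_zero, sub_zero, h4]
  have hν := hrad (fun w => unitNormal X w 2) (fun θ w hw => hX.unitNormal_rot hr4 θ hw)
    fun w hw => (hr w hw).contDiffAt_unitNormal_two.of_le (by norm_num)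
  have hH := hrad (meanCurvature X) (fun θ w hw => hX.meanCurvature_rot hr4 θ hw)
    fun w hw => (hr w hw).contDiffAt_meanCurvature.of_le (by norm_num)
  have hz := hrad (fun w => X w 2) (fun θ w hw => by rw [hX θ w hw, rotZ_two])
    fun w hw => contDiffAt_comp_two ((hr w hw).1.of_le (by norm_num))
  have hXu : fderiv ℝ (fun w => X w 2) ρ 1 = Xu X ρ 2 :=
    fderiv_comp_apply ((hr _ hρd).1.differentiableAt (by norm_num)) 1 2
  have hflux : verticalFlux X c₀ ρ
      = (∫ θ in (0 : ℝ)..(2 * Real.pi), K θ) * (ρ * fluxDensity c₀ X ρ) := by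
    rw [← intervalIntegral.integral_mul_const]
    refine intervalIntegral.integral_congr fun θ _ => ?_
    change ((meanCurvature X (γ θ) + c₀) * fderiv ℝ (fun w => unitNormal X w 2) (γ θ)
        (conormal X (γ θ))
        - unitNormal X (γ θ) 2 * fderiv ℝ (meanCurvature X) (γ θ) (conormal X (γ θ))
        + (meanCurvature X (γ θ) + c₀) ^ 2 * fderiv ℝ (fun w => X w 2) (γ θ) (conormal X (γ θ)))
      * √(T θ ⬝ᵥ T θ) = K θ * (ρ * fluxDensity c₀ X ρ)
    rw [(hν θ).2, (hH θ).2, (hz θ).2, (hH θ).1, hXu, show unitNormal X (γ θ) 2 = _ from (hν θ).1,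
      fluxDensity]
    simp only [hK]
    ring
  rw [hflux, mul_eq_zero, or_iff_right hKpos.ne', mul_eq_zero, or_iff_right hρ0.ne']

/-! ### The first integral -/

/-- By the quotient rule the flux density is an exact derivative up to the factor `(H + c₀)²`. This
integrates the conservation law once more. -/
theorem Reg.hasDerivAt_potential {t : ℝ} (h : Reg X t) (hH : meanCurvature X t + c₀ ≠ 0) :
    HasDerivAt (fun s : ℝ => X s 2 + unitNormal X s 2 / (meanCurvature X s + c₀))
      (fluxDensity c₀ X t / (meanCurvature X t + c₀) ^ 2) t := by
  have hν : HasDerivAt (fun t : ℝ => unitNormal X t 2)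
      (fderiv ℝ (fun w => unitNormal X w 2) t 1) t :=
    fderiv_apply_one_eq_deriv (h.contDiffAt_unitNormal_two.differentiableAt (by norm_num))
  have hHd : HasDerivAt (fun t : ℝ => meanCurvature X t) (fderiv ℝ (meanCurvature X) t 1) t :=
    fderiv_apply_one_eq_deriv (h.contDiffAt_meanCurvature.differentiableAt (by norm_num))
  refine ((hasDerivAt_comp_ofReal (h.1.differentiableAt (by norm_num)) 2).add
    (hν.div (hHd.add_const c₀) hH)).congr_deriv ?_
  rw [fluxDensity]
  field_simp
  ring

/-- For `k = 0` the map would be constant along parallels and its angular derivative would vanish.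
-/
theorem Equivariant.ne_zero (ha₀ : 0 ≤ a) (ha₁ : a < 1) (hX : Equivariant a k X)
    (hr : ∀ w ∈ openDom a, Reg X w) : (k : ℝ) ≠ 0 := by
  intro hk
  obtain ⟨t, hat, ht1⟩ := exists_between ha₁
  have hw := ofReal_mem_openDom ha₀ ⟨hat, ht1⟩
  have h := hX.fderiv_I_mul (fun w hw => (hr w hw).1) hw
  rw [hk, zero_smul, Complex.ofReal_re, Complex.ofReal_im, zero_smul, sub_zero,
    smul_eq_zero, or_iff_right (ha₀.trans_lt hat).ne'] at h
  have hA := (hr _ hw).areaDensity_pos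
  rw [areaDensity, h, map_zero, zero_dotProduct, Real.sqrt_zero] at hA
  exact lt_irrefl _ hA

/-- The constant momentum is zero, by the flux condition or at the centre of the disc. So `z + ν₃/(H
+ c₀)` is a constant `A` on the radius, and rotation and continuity extend this to the whole domain.
-/
theorem HelfrichCritical.exists_reduced (ha₀ : 0 ≤ a) (ha₁ : a < 1) (hX : Equivariant a k X)
    (hr : ∀ w ∈ dom a, Reg X w) (hinj : ∀ w ∈ dom a, Function.Injective (fderiv ℝ X w))
    (hH : ∀ w ∈ dom a, meanCurvature X w + c₀ ≠ 0) (hcrit : HelfrichCritical X a c₀)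
    (hflux : 0 < a → ∃ ρ ∈ Icc a 1, verticalFlux X c₀ ρ = 0) :
    ∃ A : ℝ, ∀ w ∈ dom a, (meanCurvature X w + c₀) * (X w 2 - A) = -unitNormal X w 2 := by
  have hr' : ∀ w ∈ openDom a, Reg X w := fun w hw => hr w (openDom_subset_dom a hw)
  have hr4 : ∀ w ∈ openDom a, ContDiffAt ℝ 4 X w := fun w hw => (hr' w hw).1
  have hk := hX.ne_zero ha₀ ha₁ hr'
  obtain ⟨s, hs⟩ := exists_sign hk
  obtain ⟨m₀, hm, hm0⟩ := hcrit.exists_momentum_eq ha₀ ha₁ hX hr hk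
  have hm0 : m₀ = 0 := by
    rcases ha₀.eq_or_lt with h0 | h0
    · exact hm0 h0.symm
    obtain ⟨ρ, hρ, hfl⟩ := hflux h0
    have hρ0 : 0 < ρ := h0.trans_le hρ.1
    rw [verticalFlux_eq_zero_iff ha₀ ha₁ hX hr hinj hρ hρ0] at hfl
    -- The parallel with zero flux may be a boundary circle, so the constancy of the momentum is
    -- needed on the closed interval.
    have hc : ContinuousOn (momentum c₀ k X) (Icc a 1) := fun t ht => by
      have ht0 : 0 < t := h0.trans_le ht.1
      have htd : (t : ℂ) ∈ dom a := by
        rw [dom, mem_ofPred_eq, Complex.norm_real, Real.norm_of_nonneg ht0.le]; exact ht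
      exact ((hr _ htd).contDiffAt_momentum ht0.ne').continuousAt.continuousWithinAt
    have h1 : EqOn (momentum c₀ k X) (fun _ => m₀) (Icc a 1) :=
      EqOn.of_subset_closure (fun t ht => hm t ht) hc continuousOn_const Ioo_subset_Icc_self
        (closure_Ioo ha₁.ne).ge
    rw [← show momentum c₀ k X ρ = m₀ from h1 hρ, momentum, hfl, mul_zero]
  have hfd : ∀ t ∈ Ioo a 1, fluxDensity c₀ X t = 0 := fun t ht => by
    have hP := hX.profile ha₀ hr' hk hs ht
    have h1 := hm t ht
    rw [hm0, momentum, hP.ratio] at h1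
    exact (mul_eq_zero.1 h1).resolve_left (div_pos hP.R_pos hP.sigma_pos).ne'
  have hQ : ∀ t ∈ Ioo a 1, HasDerivAt
      (fun s : ℝ => X s 2 + unitNormal X s 2 / (meanCurvature X s + c₀)) 0 t := fun t ht => by
    have hw := ofReal_mem_openDom ha₀ ht
    have := (hr' _ hw).hasDerivAt_potential (hH _ (openDom_subset_dom a hw))
    rwa [hfd t ht, zero_div] at this
  obtain ⟨A, hA⟩ := isOpen_Ioo.exists_is_const_of_deriv_eq_zero isPreconnected_Ioo
    (fun t ht => (hQ t ht).differentiableAt.differentiableWithinAt) fun t ht => (hQ t ht).deriv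
  refine ⟨A, ?_⟩
  have hcX : ContinuousOn (fun w => X w 2) (dom a) := fun w hw =>
    (contDiffAt_comp_two (hr w hw).1).continuousAt.continuousWithinAt
  have hcν : ContinuousOn (fun w => unitNormal X w 2) (dom a) := fun w hw =>
    (hr w hw).contDiffAt_unitNormal_two.continuousAt.continuousWithinAt
  have hcH : ContinuousOn (meanCurvature X) (dom a) := fun w hw =>
    (hr w hw).contDiffAt_meanCurvature.continuousAt.continuousWithinAt
  refine eqOn_dom_of_eqOn_openDom ha₀ ha₁
    ((hcH.add continuousOn_const).mul (hcX.sub continuousOn_const)) hcν.neg fun w hw => ?_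
  have htw := ofReal_mem_openDom ha₀ (t := ‖w‖) hw
  have hwt : w = Complex.exp (w.arg * Complex.I) * (‖w‖ : ℂ) := by
    rw [mul_comm]; exact (Complex.norm_mul_exp_arg_mul_I w).symm
  have hAt := hA ‖w‖ hw
  have hHt := hH _ (openDom_subset_dom a htw)
  change (meanCurvature X w + c₀) * (X w 2 - A) = -unitNormal X w 2
  rw [hwt, hX.meanCurvature_rot hr4 _ htw, hX.unitNormal_rot hr4 _ htw, hX _ _ htw, rotZ_two, ← hAt]
  field_simp
  ring

/-- Under the reduced equation the potential is the constant `A`, and its derivative is the flux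
density divided by `(H + c₀)²`. -/
theorem verticalFlux_eq_zero_of_reduced (ha₀ : 0 ≤ a) (ha₁ : a < 1) (hX : Equivariant a k X)
    (hr : ∀ w ∈ dom a, Reg X w) (hinj : ∀ w ∈ dom a, Function.Injective (fderiv ℝ X w))
    (hH : ∀ w ∈ dom a, meanCurvature X w + c₀ ≠ 0) {A : ℝ}
    (hred : ∀ w ∈ dom a, (meanCurvature X w + c₀) * (X w 2 - A) = -unitNormal X w 2) {ρ : ℝ}
    (hρ : ρ ∈ Ioo a 1) : verticalFlux X c₀ ρ = 0 := by
  rw [verticalFlux_eq_zero_iff ha₀ ha₁ hX hr hinj (Ioo_subset_Icc_self hρ) (ha₀.trans_lt hρ.1)]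
  have hw := openDom_subset_dom a (ofReal_mem_openDom ha₀ hρ)
  have h1 := (hr _ hw).hasDerivAt_potential (hH _ hw)
  have h2 : HasDerivAt (fun s : ℝ => X s 2 + unitNormal X s 2 / (meanCurvature X s + c₀)) 0 ρ := by
    refine (hasDerivAt_const ρ A).congr_of_eventuallyEq ?_
    filter_upwards [isOpen_Ioo.mem_nhds hρ] with s hs
    have hsd := openDom_subset_dom a (ofReal_mem_openDom ha₀ hs)
    have h3 := hred _ hsd
    have h4 := hH _ hsd
    field_simp
    linear_combination h3
  exact (div_eq_zero_iff.1 (h1.unique h2)).resolve_right (pow_ne_zero 2 (hH _ hw))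

/-- The first integral of the Euler–Lagrange equation. -/
theorem helfrichCritical_and_zero_flux_iff (ha₀ : 0 ≤ a) (ha₁ : a < 1)
    (hX : IsAxiallySymmetricImmersion a X) (hH : ∀ w ∈ dom a, meanCurvature X w ≠ -c₀) :
    (HelfrichCritical X a c₀ ∧ (0 < a → ∃ ρ ∈ Icc a 1, verticalFlux X c₀ ρ = 0)) ↔
      ∃! A : ℝ, ∀ w ∈ dom a, (meanCurvature X w + c₀) * (X w 2 - A) = -unitNormal X w 2 := by
  have hr : ∀ w ∈ dom a, Reg X w := fun w hw => hX.reg hw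
  have hH' : ∀ w ∈ dom a, meanCurvature X w + c₀ ≠ 0 := fun w hw h =>
    hH w hw (eq_neg_of_add_eq_zero_left h)
  obtain ⟨k, hk⟩ := hX.symm
  have hE : Equivariant a k X := fun θ w hw => hk θ w (openDom_subset_dom a hw)
  constructor
  · rintro ⟨hcrit, hflux⟩
    obtain ⟨A, hA⟩ := hcrit.exists_reduced ha₀ ha₁ hE hr hX.immersion hH' hflux
    refine ⟨A, hA, fun B hB => ?_⟩
    obtain ⟨t, ht⟩ := exists_between ha₁
    have hw := openDom_subset_dom a (ofReal_mem_openDom ha₀ ht)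
    -- Uniqueness needs a single point: `H + c₀ ≠ 0` can be cancelled there.
    have h1 := mul_left_cancel₀ (hH' _ hw) ((hA _ hw).trans (hB _ hw).symm)
    linarith
  · rintro ⟨A, hA, -⟩
    refine ⟨helfrichCritical_of_reduced hr hA, fun _ => ?_⟩
    obtain ⟨t, ht⟩ := exists_between ha₁
    exact ⟨t, Ioo_subset_Icc_self ht,
      verticalFlux_eq_zero_of_reduced ha₀ ha₁ hE hr hX.immersion hH' hA ht⟩

end

end AxialHelfrich

/-! ### Assembly of the three statements -/

open AxialHelfrich in
theorem mainTheorem7 (a c₀ : ℝ) (ha₀ : 0 ≤ a) (ha₁ : a < 1) (X : ℂ → Fin 3 → ℝ)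
    (hX : IsAxiallySymmetricImmersion a X)
    (hH : ∀ w ∈ dom a, meanCurvature X w ≠ -c₀) :
    -- the first integral: reduced equation after a unique vertical translation
    ((HelfrichCritical X a c₀ ∧ (0 < a → ∃ ρ ∈ Set.Icc a 1, verticalFlux X c₀ ρ = 0)) ↔
      ∃! A : ℝ, ∀ w ∈ dom a,
        (meanCurvature X w + c₀) * (X w 2 - A) = -unitNormal X w 2) ∧
    ((∀ w ∈ dom a, X w 2 ≠ 0) →
      -- criticality for the second functional is the reduced equation
      (GCritical X a c₀ ↔
        ∀ w ∈ dom a, meanCurvature X w + c₀ = -(unitNormal X w 2 / X w 2)) ∧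
      (GCritical X a c₀ → HelfrichCritical X a c₀) ∧
      -- normalized surfaces: zero flux (automatic for discs) and vertical position fixed at a point
      ((0 < a → ∃ ρ ∈ Set.Icc a 1, verticalFlux X c₀ ρ = 0) →
        (∃ w ∈ dom a, meanCurvature X w + c₀ = -(unitNormal X w 2 / X w 2)) →
        ((HelfrichCritical X a c₀ ↔ GCritical X a c₀) ∧
          (HelfrichCritical X a c₀ →
            ∀ w ∈ dom a, meanCurvature X w + c₀ = -(unitNormal X w 2 / X w 2))))) ∧
    -- the functional as hyperbolic area plus weighted hyperbolic volume
    ((∀ w ∈ dom a, 0 < X w 2) →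
      energyG X a c₀ = hyperbolicArea X a - 2 * c₀ * weightedHyperbolicVolume X a) := by
  have hr : ∀ w ∈ dom a, Reg X w := fun w hw => hX.reg hw
  have hmain := helfrichCritical_and_zero_flux_iff ha₀ ha₁ hX hH
  refine ⟨hmain, fun h0 => ?_, energyG_eq_hyperbolic hr⟩
  have hG : GCritical X a c₀ ↔ _ := gCritical_iff (c₀ := c₀) ha₀ ha₁ hr h0
  have hred : ∀ w ∈ dom a, (meanCurvature X w + c₀) * (X w 2 - 0) = -unitNormal X w 2 ↔
      meanCurvature X w + c₀ = -(unitNormal X w 2 / X w 2) := fun w hw => by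
    rw [reduced_iff (h0 w hw), sub_zero]
  have hGH : GCritical X a c₀ → HelfrichCritical X a c₀ := fun h =>
    helfrichCritical_of_reduced hr fun w hw => (hred w hw).2 (hG.1 h w hw)
  refine ⟨hG, hGH, fun hflux ⟨p, hp, hpn⟩ => ?_⟩
  have hHG : HelfrichCritical X a c₀ →
      ∀ w ∈ dom a, meanCurvature X w + c₀ = -(unitNormal X w 2 / X w 2) := fun h w hw => by
    obtain ⟨A, hA, -⟩ := hmain.1 ⟨h, hflux⟩
    -- At the normalizing point both `A` and `0` satisfy the equation; cancelling `H + c₀` gives `A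
    -- = 0`.
    have h1 := (hA p hp).trans ((hred p hp).2 hpn).symm
    have hne : meanCurvature X p + c₀ ≠ 0 := fun h => hH p hp (eq_neg_of_add_eq_zero_left h)
    have hA0 : A = 0 := by linarith [mul_left_cancel₀ hne h1]
    exact (hred w hw).1 (hA0 ▸ hA w hw)
  exact ⟨⟨fun h => hG.2 (hHG h), hGH⟩, hHG⟩
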